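/- Let $V(\rho)=-144\,\frac{5-\rho^2}{(5+3\rho^2)^2}$, $Df(\rho)=\frac1\rho f'(\rho)$ and $Kf(\rho)=\int_0^\rho s f(s)\,ds$ for $\rho\in[0,1]$. Let $\mathcal H$ be the Hilbert space completion of $$\tilde{\mathcal H}=\{\mathbf u=(u_1,u_2)\in C^4[0,1]\times C^1[0,1] : u_1^{(k)}(0)=u_2(0)=0,\ k=0,1,2,3\}$$ (complex-valued functions) with respect to the inner product $$(\mathbf u|\mathbf v)=\int_0^1 D^2u_1\,\overline{D^2v_1}\,d\rho+\int_0^1 u_2'\,\overline{v_2'}\,d\rho ;$$ its elements are identified with pairs of functions on $[0,1]$ through $u_1=K^2(D^2u_1)$, $u_2(\rho)=\int_0^\rho u_2'(s)\,ds$, where $D^2u_1,u_2'\in L^2(0,1)$. Let $\mathbf L_0$ be the closure in $\mathcal H$ of the operator $$\tilde{\mathbf L}_0\mathbf u=\bigl(-\rho u_1'+2u_1+\rho^2u_2-3Ku_2,\ D^2u_1-\rho u_2'-u_2\bigr)$$ with domain $\{\mathbf u\in C^\infty[0,1]\times C^\infty[0,1] : u_1^{(k)}(0)=u_2(0)=0,\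 k=0,1,2,3,4\}$, let $\mathbf L'\mathbf u=(-VK^2u_2,0)$ for $\mathbf u\in\mathcal H$, and let $\mathbf L=\mathbf L_0+\mathbf L'$ with domain $\mathcal D(\mathbf L)=\mathcal D(\mathbf L_0)$. Then $1$ is an isolated point of the spectrum $\sigma(\mathbf L)$, so that there is a circle $\Gamma$ contained in the resolvent set of $\mathbf L$ whose interior contains $1$ and no other point of $\sigma(\mathbf L)$. For every such (positively oriented) circle $\Gamma$, the range of the Riesz projection $$\mathbf P=\frac1{2\pi i}\int_\Gamma(\lambda-\mathbf L)^{-1}\,d\lambda$$ is one-dimensional and is spanned by the symmetry mode $$\mathbf g(\rho)=\left(\frac{\rho^5(5-\rho^2)}{(5+3\rho^2)^3},\ \frac{\rho(125-50\rho^2-3\rho^4)}{(5+3\rho^2)^4}\right).$$ -/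

import Mathlib

open Set MeasureTheory
open scoped ContDiff

noncomputable section

namespace YangMills

/-- The closed unit interval. Functions on `[0,1]` are represented by functions `ℝ → ℂ`; only
their restriction to `[0,1]` is ever used, and derivatives are taken within `[0,1]` (so they are
one-sided at the endpoints). -/
abbrev I : Set ℝ := Icc 0 1

/-- `D f (ρ) = f'(ρ) / ρ`. -/
def D (f : ℝ → ℂ) (ρ : ℝ) : ℂ := ρ⁻¹ • derivWithin f I ρ

/-- `K f (ρ) = ∫₀^ρ s f(s) ds`. -/
def K (f : ℝ → ℂ) (ρ : ℝ) : ℂ := ∫ s in (0 : ℝ)..ρ, s • f s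

/-- The potential `V(ρ) = (3 F'(W₀(ρ) - 1) - 6) / ρ²`, where `F(ψ) = ψ (ψ + 1) (ψ + 2)` and
`W₀(ρ) = (1 - ρ²) / (1 + 3 ρ² / 5)`, in its explicit form (which is also regular at `ρ = 0`). -/
def V (ρ : ℝ) : ℝ := -144 * (5 - ρ ^ 2) / (5 + 3 * ρ ^ 2) ^ 2

/-- All pairs `(u₁, u₂) ∈ Cᵐ[0,1] × Cⁿ[0,1]` with `u₂(0) = 0` and `u₁⁽ᵏ⁾(0) = 0` for
`k = 0, …, j`. -/
def smoothPairs (m n : WithTop ℕ∞) (j : ℕ) (hj : (j : WithTop ℕ∞) ≤ m) :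
    Submodule ℂ ((ℝ → ℂ) × (ℝ → ℂ)) where
  carrier := {u | ContDiffOn ℝ m u.1 I ∧ ContDiffOn ℝ n u.2 I ∧
    (∀ k ≤ j, iteratedDerivWithin k u.1 I 0 = 0) ∧ u.2 0 = 0}
  zero_mem' := by
    refine ⟨contDiffOn_const, contDiffOn_const, fun k _ => ?_, rfl⟩
    have h : iteratedDerivWithin k (fun _ : ℝ => (0 : ℂ)) I 0 = 0 := by simp
    exact h
  add_mem' := by
    rintro u v ⟨h1, h2, h3, h4⟩ ⟨k1, k2, k3, k4⟩
    refine ⟨h1.add k1, h2.add k2, fun k hk => ?_, by simp [h4, k4]⟩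
    have hk' : (k : WithTop ℕ∞) ≤ m := le_trans (by exact_mod_cast hk) hj
    have h0 : (0 : ℝ) ∈ I := by simp
    rw [Prod.fst_add, iteratedDerivWithin_add h0 (uniqueDiffOn_Icc one_pos)
      ((h1 0 h0).of_le hk') ((k1 0 h0).of_le hk'), h3 k hk, k3 k hk, add_zero]
  smul_mem' := by
    rintro c u ⟨h1, h2, h3, h4⟩
    refine ⟨h1.const_smul c, h2.const_smul c, fun k hk => ?_, by simp [h4]⟩
    have hk' : (k : WithTop ℕ∞) ≤ m := le_trans (by exact_mod_cast hk) hj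
    have h0 : (0 : ℝ) ∈ I := by simp
    rw [Prod.smul_fst, iteratedDerivWithin_const_smul h0 (uniqueDiffOn_Icc one_pos) c
      ((h1 0 h0).of_le hk'), h3 k hk, smul_zero]

/-- The pre-Hilbert space of all `(u₁, u₂) ∈ C⁴[0,1] × C¹[0,1]` with `u₁⁽ᵏ⁾(0) = u₂(0) = 0` for
`k = 0, 1, 2, 3`. -/
abbrev PreH : Submodule ℂ ((ℝ → ℂ) × (ℝ → ℂ)) := smoothPairs 4 1 3 (by norm_num)

/-- The domain of the free operator before closure: all `(u₁, u₂) ∈ C^∞[0,1] × C^∞[0,1]` with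
`u₁⁽ᵏ⁾(0) = u₂(0) = 0` for `k = 0, 1, 2, 3, 4`. -/
abbrev Dom₀ : Submodule ℂ ((ℝ → ℂ) × (ℝ → ℂ)) :=
  smoothPairs ∞ ∞ 4 (WithTop.coe_le_coe.2 (le_top : ((4 : ℕ) : ℕ∞) ≤ ⊤))

/-- Lebesgue measure on `(0,1]`. -/
abbrev μ : Measure ℝ := volume.restrict (Ioc 0 1)

/-- The Hilbert space `L²(0,1)` of complex-valued functions. -/
abbrev L2 : Type := Lp ℂ 2 μ

theorem hasDerivWithinAt_of {f : ℝ → ℂ} (hf : ContDiffOn ℝ 1 f I) {ρ : ℝ} (hρ : ρ ∈ I) :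
    HasDerivWithinAt f (derivWithin f I ρ) I ρ :=
  ((hf.differentiableOn one_ne_zero) ρ hρ).hasDerivWithinAt

theorem contDiffOn_derivWithin_of {f : ℝ → ℂ} {m n : WithTop ℕ∞} (hf : ContDiffOn ℝ n f I)
    (h : m + 1 ≤ n) : ContDiffOn ℝ m (derivWithin f I) I :=
  hf.derivWithin (uniqueDiffOn_Icc one_pos) h

theorem hasDerivWithinAt_D {f : ℝ → ℂ} (hf : ContDiffOn ℝ 2 f I) {ρ : ℝ} (hρ : ρ ∈ Ioc (0 : ℝ) 1) :
    HasDerivWithinAt (D f)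
      (ρ⁻¹ • derivWithin (derivWithin f I) I ρ + (-(ρ ^ 2)⁻¹) • derivWithin f I ρ) I ρ :=
  ((hasDerivAt_inv hρ.1.ne').hasDerivWithinAt).smul
    (hasDerivWithinAt_of (contDiffOn_derivWithin_of hf (by norm_num))
      ⟨hρ.1.le, hρ.2⟩)

theorem DD_eq {f : ℝ → ℂ} (hf : ContDiffOn ℝ 2 f I) {ρ : ℝ} (hρ : ρ ∈ Ioc (0 : ℝ) 1) :
    D (D f) ρ = ρ⁻¹ •
      (ρ⁻¹ • derivWithin (derivWithin f I) I ρ + (-(ρ ^ 2)⁻¹) • derivWithin f I ρ) := by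
  rw [D, (hasDerivWithinAt_D hf hρ).derivWithin
    (uniqueDiffOn_Icc one_pos ρ ⟨hρ.1.le, hρ.2⟩)]

theorem derivWithin_add' {f g : ℝ → ℂ} (hf : ContDiffOn ℝ 1 f I) (hg : ContDiffOn ℝ 1 g I)
    {ρ : ℝ} (hρ : ρ ∈ I) : derivWithin (f + g) I ρ = derivWithin f I ρ + derivWithin g I ρ :=
  ((hasDerivWithinAt_of hf hρ).add (hasDerivWithinAt_of hg hρ)).derivWithin
    (uniqueDiffOn_Icc one_pos ρ hρ)

theorem derivWithin_smul' {f : ℝ → ℂ} (hf : ContDiffOn ℝ 1 f I) (c : ℂ)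
    {ρ : ℝ} (hρ : ρ ∈ I) : derivWithin (c • f) I ρ = c • derivWithin f I ρ :=
  ((hasDerivWithinAt_of hf hρ).const_smul c).derivWithin (uniqueDiffOn_Icc one_pos ρ hρ)

theorem DD_add {f g : ℝ → ℂ} (hf : ContDiffOn ℝ 2 f I) (hg : ContDiffOn ℝ 2 g I)
    {ρ : ℝ} (hρ : ρ ∈ Ioc (0 : ℝ) 1) : D (D (f + g)) ρ = D (D f) ρ + D (D g) ρ := by
  have hI := Ioc_subset_Icc_self hρ
  have e : EqOn (D (f + g)) (D f + D g) I := fun x hx => by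
    simp only [D, Pi.add_apply, ← smul_add,
      derivWithin_add' (hf.of_le (by norm_num)) (hg.of_le (by norm_num)) hx]
  have := ((hasDerivWithinAt_D hf hρ).add (hasDerivWithinAt_D hg hρ)).derivWithin
    (uniqueDiffOn_Icc one_pos ρ hI)
  rw [DD_eq hf hρ, DD_eq hg hρ, ← smul_add, ← this, D, derivWithin_congr e (e hI)]

theorem DD_smul {f : ℝ → ℂ} (hf : ContDiffOn ℝ 2 f I) (c : ℂ)
    {ρ : ℝ} (hρ : ρ ∈ Ioc (0 : ℝ) 1) : D (D (c • f)) ρ = c • D (D f) ρ := by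
  have hI := Ioc_subset_Icc_self hρ
  have e : EqOn (D (c • f)) (c • D f) I := fun x hx => by
    simp only [D, Pi.smul_apply, smul_comm c, derivWithin_smul' (hf.of_le (by norm_num)) c hx]
  have := ((hasDerivWithinAt_D hf hρ).const_smul c).derivWithin (uniqueDiffOn_Icc one_pos ρ hI)
  rw [DD_eq hf hρ, smul_comm c, ← this, D, derivWithin_congr e (e hI)]

/-- Taylor bound at `0`. -/
theorem exists_bound {f : ℝ → ℂ} {n : ℕ} (hf : ContDiffOn ℝ (n + 1) f I)
    (h : ∀ k ≤ n, iteratedDerivWithin k f I 0 = 0) :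
    ∃ C, ∀ ρ ∈ I, ‖f ρ‖ ≤ C * ρ ^ (n + 1) := by
  obtain ⟨C, hC⟩ := exists_taylor_mean_remainder_bound zero_le_one hf
  refine ⟨C, fun ρ hρ => ?_⟩
  have : taylorWithinEval f n (Icc 0 1) 0 ρ = 0 := by
    rw [taylor_within_apply]
    refine Finset.sum_eq_zero fun k hk => ?_
    rw [h k (by simpa [Nat.lt_succ_iff] using hk), smul_zero]
  simpa [this] using hC ρ hρ

theorem exists_bound_derivs {u : (ℝ → ℂ) × (ℝ → ℂ)} (hu : u ∈ PreH) :
    ∃ C, ∀ ρ ∈ I, ‖derivWithin u.1 I ρ‖ ≤ C * ρ ^ 3 ∧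
      ‖derivWithin (derivWithin u.1 I) I ρ‖ ≤ C * ρ ^ 2 := by
  obtain ⟨h1, -, h3, -⟩ := hu
  have d1 : ContDiffOn ℝ 3 (derivWithin u.1 I) I :=
    contDiffOn_derivWithin_of h1 (by norm_num)
  have d2 : ContDiffOn ℝ 2 (derivWithin (derivWithin u.1 I) I) I :=
    contDiffOn_derivWithin_of d1 (by norm_num)
  have e1 : ∀ k, iteratedDerivWithin k (derivWithin u.1 I) I = iteratedDerivWithin (k + 1) u.1 I :=
    fun k => (iteratedDerivWithin_succ').symm
  have e2 : ∀ k, iteratedDerivWithin k (derivWithin (derivWithin u.1 I) I) I =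
      iteratedDerivWithin (k + 2) u.1 I := fun k => by rw [← e1, iteratedDerivWithin_succ']
  obtain ⟨C, hC⟩ := exists_bound (n := 2) (f := derivWithin u.1 I) (by exact_mod_cast d1)
    fun k hk => by rw [e1]; exact h3 _ (by omega)
  obtain ⟨C', hC'⟩ := exists_bound (n := 1) (f := derivWithin (derivWithin u.1 I) I)
    (by exact_mod_cast d2) fun k hk => by rw [e2]; exact h3 _ (by omega)
  refine ⟨max C C', fun ρ hρ => ⟨(hC ρ hρ).trans ?_, (hC' ρ hρ).trans ?_⟩⟩
  · exact mul_le_mul_of_nonneg_right (le_max_left _ _) (pow_nonneg hρ.1 _)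
  · exact mul_le_mul_of_nonneg_right (le_max_right _ _) (pow_nonneg hρ.1 _)

theorem memLp_DD {u : (ℝ → ℂ) × (ℝ → ℂ)} (hu : u ∈ PreH) : MemLp (D (D u.1)) 2 μ := by
  have h2 : ContDiffOn ℝ 2 u.1 I := hu.1.of_le (by norm_num)
  have d1 : ContDiffOn ℝ 1 (derivWithin u.1 I) I :=
    contDiffOn_derivWithin_of h2 (by norm_num)
  have d2 : ContDiffOn ℝ 0 (derivWithin (derivWithin u.1 I) I) I :=
    contDiffOn_derivWithin_of d1 (by norm_num)
  obtain ⟨C, hC⟩ := exists_bound_derivs hu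
  have hc : ContinuousOn (fun ρ : ℝ => ρ⁻¹ •
      (ρ⁻¹ • derivWithin (derivWithin u.1 I) I ρ + (-(ρ ^ 2)⁻¹) • derivWithin u.1 I ρ))
      (Ioc 0 1) := by
    have i1 : ContinuousOn (fun ρ : ℝ => ρ⁻¹) (Ioc 0 1) :=
      continuousOn_inv₀.mono fun x hx => hx.1.ne'
    have i2 : ContinuousOn (fun ρ : ℝ => -(ρ ^ 2)⁻¹) (Ioc 0 1) :=
      (ContinuousOn.inv₀ (by fun_prop) fun x hx => (pow_pos hx.1 2).ne').neg
    exact i1.smul ((i1.smul (d2.continuousOn.mono Ioc_subset_Icc_self)).add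
      (i2.smul (d1.continuousOn.mono Ioc_subset_Icc_self)))
  refine MemLp.of_bound (C := C + C) ?_ ?_
  · exact (hc.aestronglyMeasurable measurableSet_Ioc).congr
      ((ae_restrict_iff' measurableSet_Ioc).2 (ae_of_all _ fun ρ hρ => (DD_eq h2 hρ).symm))
  · refine (ae_restrict_iff' measurableSet_Ioc).2 (ae_of_all _ fun ρ hρ => ?_)
    obtain ⟨b1, b2⟩ := hC ρ ⟨hρ.1.le, hρ.2⟩
    have hp := hρ.1
    rw [DD_eq h2 hρ, smul_add, smul_smul, smul_smul]
    refine (norm_add_le _ _).trans (add_le_add ?_ ?_)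
    · rw [norm_smul, Real.norm_of_nonneg (by positivity)]
      calc ρ⁻¹ * ρ⁻¹ * _ ≤ ρ⁻¹ * ρ⁻¹ * (C * ρ ^ 2) := by gcongr
        _ = C := by field_simp
    · rw [norm_smul, mul_neg, norm_neg, Real.norm_of_nonneg (by positivity)]
      calc ρ⁻¹ * (ρ ^ 2)⁻¹ * _ ≤ ρ⁻¹ * (ρ ^ 2)⁻¹ * (C * ρ ^ 3) := by gcongr
        _ = C := by field_simp

theorem memLp_deriv {u : (ℝ → ℂ) × (ℝ → ℂ)} (hu : u ∈ PreH) : MemLp (derivWithin u.2 I) 2 μ := by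
  have d : ContDiffOn ℝ 0 (derivWithin u.2 I) I :=
    contDiffOn_derivWithin_of hu.2.1 (by norm_num)
  obtain ⟨C, hC⟩ := isCompact_Icc.exists_bound_of_continuousOn d.continuousOn
  refine MemLp.of_bound (C := C)
    ((d.continuousOn.mono Ioc_subset_Icc_self).aestronglyMeasurable measurableSet_Ioc) ?_
  exact (ae_restrict_iff' measurableSet_Ioc).2
    (ae_of_all _ fun ρ hρ => hC ρ (Ioc_subset_Icc_self hρ))

/-- The map `(u₁, u₂) ↦ (D² u₁, u₂')` into `L²(0,1) × L²(0,1)` with its Hilbert space norm. By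
definition, the inner product on `PreH` is the one that this map pulls back. -/
def embed : PreH →ₗ[ℂ] WithLp 2 (L2 × L2) where
  toFun u := WithLp.toLp 2 ((memLp_DD u.2).toLp _, (memLp_deriv u.2).toLp _)
  map_add' u v := by
    rw [← WithLp.toLp_add, Prod.mk_add_mk, ← MemLp.toLp_add, ← MemLp.toLp_add]
    congr 2 <;> refine MemLp.toLp_congr _ _ ((ae_restrict_iff' measurableSet_Ioc).2
      (ae_of_all _ fun ρ hρ => ?_))
    · exact DD_add (u.2.1.of_le (by norm_num)) (v.2.1.of_le (by norm_num)) hρ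
    · exact derivWithin_add' u.2.2.1 v.2.2.1 (Ioc_subset_Icc_self hρ)
  map_smul' c u := by
    rw [RingHom.id_apply, ← WithLp.toLp_smul, Prod.smul_mk, ← MemLp.toLp_const_smul,
      ← MemLp.toLp_const_smul]
    congr 2 <;> refine MemLp.toLp_congr _ _ ((ae_restrict_iff' measurableSet_Ioc).2
      (ae_of_all _ fun ρ hρ => ?_))
    · exact DD_smul (u.2.1.of_le (by norm_num)) c hρ
    · exact derivWithin_smul' u.2.2.1 c (Ioc_subset_Icc_self hρ)

/-- The inner product that `embed` induces on `PreH` is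
`(u|v) = ∫₀¹ D²u₁ conj(D²v₁) + ∫₀¹ u₂' conj(v₂')`
(`inner` is conjugate linear in its first slot, whence the order of the arguments). -/
theorem inner_embed (u v : PreH) :
    inner ℂ (embed v) (embed u) =
      (∫ ρ in (0 : ℝ)..1, D (D u.1.1) ρ * starRingEnd ℂ (D (D v.1.1) ρ)) +
        ∫ ρ in (0 : ℝ)..1, derivWithin u.1.2 I ρ * starRingEnd ℂ (derivWithin v.1.2 I ρ) := by
  rw [WithLp.prod_inner_apply, L2.inner_def, L2.inner_def,
    intervalIntegral.integral_of_le zero_le_one, intervalIntegral.integral_of_le zero_le_one]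
  congr 1
  · refine integral_congr_ae ?_
    filter_upwards [(memLp_DD u.2).coeFn_toLp, (memLp_DD v.2).coeFn_toLp] with ρ h1 h2
    change inner ℂ ((memLp_DD v.2).toLp _ ρ) ((memLp_DD u.2).toLp _ ρ) = _
    rw [h1, h2]; rfl
  · refine integral_congr_ae ?_
    filter_upwards [(memLp_deriv u.2).coeFn_toLp, (memLp_deriv v.2).coeFn_toLp] with ρ h1 h2
    change inner ℂ ((memLp_deriv v.2).toLp _ ρ) ((memLp_deriv u.2).toLp _ ρ) = _
    rw [h1, h2]; rfl

/-- The Hilbert space `ℋ`, the completion of `PreH`, realized as the closure of the image of `PreH`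
under its isometric embedding into the Hilbert space `L²(0,1) × L²(0,1)`. -/
abbrev H : Type := ↥(LinearMap.range embed).topologicalClosure

/-- The canonical (dense, isometric) inclusion of `PreH` into its completion. -/
def toH : PreH →ₗ[ℂ] H :=
  embed.codRestrict _ fun u =>
    (LinearMap.range embed).le_topologicalClosure (LinearMap.mem_range_self embed u)

/-- The first component of `u ∈ ℋ` as a function on `[0,1]`: the function `u₁ = K² (D² u₁)`. -/
def fn₁ (u : H) : ℝ → ℂ := K (K u.1.fst)

/-- The second component of `u ∈ ℋ` as a function on `[0,1]`: the function `u₂ = ∫₀ u₂'`. -/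
def fn₂ (u : H) (ρ : ℝ) : ℂ := ∫ s in (0 : ℝ)..ρ, u.1.snd s

theorem K_congr {f g : ℝ → ℂ} (h : f =ᵐ[μ] g) {ρ : ℝ} (hρ : ρ ∈ I) : K f ρ = K g ρ := by
  rw [K, K, intervalIntegral.integral_of_le hρ.1, intervalIntegral.integral_of_le hρ.1]
  refine integral_congr_ae ?_
  filter_upwards [ae_restrict_of_ae_restrict_of_subset (Ioc_subset_Ioc_right hρ.2) h] with s hs
  rw [hs]

theorem K_D {f : ℝ → ℂ} (hf : ContinuousOn f I)
    (hd : ∀ s ∈ Ioc (0 : ℝ) 1, DifferentiableWithinAt ℝ f I s)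
    (hi : IntegrableOn (derivWithin f I) (Ioc 0 1)) {ρ : ℝ} (hρ : ρ ∈ I) :
    K (D f) ρ = f ρ - f 0 := by
  have e : K (D f) ρ = ∫ s in (0 : ℝ)..ρ, derivWithin f I s := by
    rw [K, intervalIntegral.integral_of_le hρ.1, intervalIntegral.integral_of_le hρ.1]
    refine setIntegral_congr_fun measurableSet_Ioc fun s hs => ?_
    simp only [D, smul_smul, mul_inv_cancel₀ hs.1.ne', one_smul]
  rw [e]
  refine intervalIntegral.integral_eq_sub_of_hasDerivAt_of_le hρ.1
    (hf.mono (Icc_subset_Icc_right hρ.2)) (fun s hs => ?_) ?_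
  · have hs' : s ∈ Ioo (0 : ℝ) 1 := ⟨hs.1, hs.2.trans_le hρ.2⟩
    exact (hd s ⟨hs'.1, hs'.2.le⟩).hasDerivWithinAt.hasDerivAt (Icc_mem_nhds hs'.1 hs'.2)
  · rw [intervalIntegrable_iff_integrableOn_Ioc_of_le hρ.1]
    exact hi.mono_set (Ioc_subset_Ioc_right hρ.2)

theorem continuousOn_D {u : (ℝ → ℂ) × (ℝ → ℂ)} (hu : u ∈ PreH) : ContinuousOn (D u.1) I := by
  intro ρ hρ
  rcases hρ.1.eq_or_lt with h | h
  · subst h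
    obtain ⟨C, hC⟩ := exists_bound_derivs hu
    have h0 : D u.1 0 = 0 := by simp [D]
    rw [ContinuousWithinAt, h0]
    refine squeeze_zero_norm' (a := fun ρ : ℝ => C * ρ ^ 2) ?_ ?_
    · filter_upwards [self_mem_nhdsWithin] with x hx
      rcases hx.1.eq_or_lt with h | h
      · subst h; simp [D]
      · rw [D, norm_smul, Real.norm_of_nonneg (by positivity)]
        calc x⁻¹ * _ ≤ x⁻¹ * (C * x ^ 3) := by gcongr; exact (hC x hx).1
          _ = C * x ^ 2 := by field_simp
    · have : ContinuousWithinAt (fun ρ : ℝ => C * ρ ^ 2) I 0 := by fun_prop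
      simpa [ContinuousWithinAt] using this
  · exact (hasDerivWithinAt_D (hu.1.of_le (by norm_num)) ⟨h, hρ.2⟩).continuousWithinAt

theorem fn₁_toH (u : PreH) {ρ : ℝ} (hρ : ρ ∈ I) : fn₁ (toH u) ρ = u.1.1 ρ := by
  have h2 : ContDiffOn ℝ 2 u.1.1 I := u.2.1.of_le (by norm_num)
  have d1 : ContDiffOn ℝ 1 (derivWithin u.1.1 I) I :=
    contDiffOn_derivWithin_of h2 (by norm_num)
  have hint : IntegrableOn (derivWithin (D u.1.1) I) (Ioc 0 1) := by
    have h := (memLp_DD u.2).integrable (by norm_num)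
    have h' := MeasureTheory.Integrable.bdd_smul (φ := fun s : ℝ => s) h 1
      measurable_id.aestronglyMeasurable
      ((ae_restrict_iff' measurableSet_Ioc).2 (ae_of_all _ fun s hs => by
        rw [Real.norm_of_nonneg hs.1.le]; exact hs.2))
    refine Integrable.congr h' ((ae_restrict_iff' measurableSet_Ioc).2 (ae_of_all _ fun s hs => ?_))
    change s • (s⁻¹ • derivWithin (D u.1.1) I s) = _
    rw [smul_smul, mul_inv_cancel₀ hs.1.ne', one_smul]
  have e : ∀ s ∈ I, K (toH u).1.fst s = D u.1.1 s := fun s hs => by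
    have h1 : K (toH u).1.fst s = K (D (D u.1.1)) s :=
      K_congr (memLp_DD u.2).coeFn_toLp hs
    rw [h1, K_D (continuousOn_D u.2)
      (fun s hs => (hasDerivWithinAt_D h2 hs).differentiableWithinAt) hint hs]
    simp [D]
  have h0 : u.1.1 0 = 0 := by simpa using u.2.2.2.1 0 (by norm_num)
  rw [fn₁, K_congr (g := D u.1.1) ((ae_restrict_iff' measurableSet_Ioc).2 (ae_of_all _ fun s hs =>
    e s (Ioc_subset_Icc_self hs))) hρ, K_D h2.continuousOn
      (fun s hs => h2.differentiableOn (by norm_num) s (Ioc_subset_Icc_self hs))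
      ((d1.continuousOn.integrableOn_Icc).mono_set Ioc_subset_Icc_self) hρ, h0, sub_zero]

theorem fn₂_toH (u : PreH) {ρ : ℝ} (hρ : ρ ∈ I) : fn₂ (toH u) ρ = u.1.2 ρ := by
  have d : ContDiffOn ℝ 0 (derivWithin u.1.2 I) I :=
    contDiffOn_derivWithin_of u.2.2.1 (by norm_num)
  have e : fn₂ (toH u) ρ = ∫ s in (0 : ℝ)..ρ, derivWithin u.1.2 I s := by
    rw [fn₂, intervalIntegral.integral_of_le hρ.1, intervalIntegral.integral_of_le hρ.1]
    exact integral_congr_ae (ae_restrict_of_ae_restrict_of_subset (Ioc_subset_Ioc_right hρ.2)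
      (memLp_deriv u.2).coeFn_toLp)
  have key : ∫ s in (0 : ℝ)..ρ, derivWithin u.1.2 I s = u.1.2 ρ - u.1.2 0 := by
    refine intervalIntegral.integral_eq_sub_of_hasDerivAt_of_le hρ.1
      (u.2.2.1.continuousOn.mono (Icc_subset_Icc_right hρ.2)) (fun s hs => ?_) ?_
    · have hs' : s ∈ Ioo (0 : ℝ) 1 := ⟨hs.1, hs.2.trans_le hρ.2⟩
      exact (hasDerivWithinAt_of u.2.2.1 (Ioo_subset_Icc_self hs')).hasDerivAt
        (Icc_mem_nhds hs'.1 hs'.2)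
    · rw [intervalIntegrable_iff_integrableOn_Ioc_of_le hρ.1]
      exact (d.continuousOn.integrableOn_Icc).mono_set
        (Ioc_subset_Icc_self.trans (Icc_subset_Icc_right hρ.2))
  rw [e, key, u.2.2.2.2, sub_zero]

theorem integrableOn_smul {f : ℝ → ℂ} (hf : IntegrableOn f (Ioc 0 1)) :
    IntegrableOn (fun s : ℝ => s • f s) (Ioc 0 1) :=
  Integrable.bdd_smul (φ := fun s : ℝ => s) hf 1 measurable_id.aestronglyMeasurable
    ((ae_restrict_iff' measurableSet_Ioc).2 (ae_of_all _ fun s hs => by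
      rw [Real.norm_of_nonneg hs.1.le]; exact hs.2))

theorem intervalIntegrable_of {f : ℝ → ℂ} (hf : IntegrableOn f (Ioc 0 1)) {ρ : ℝ} (hρ : ρ ∈ I) :
    IntervalIntegrable f volume 0 ρ := by
  rw [intervalIntegrable_iff_integrableOn_Ioc_of_le hρ.1]
  exact hf.mono_set (Ioc_subset_Ioc_right hρ.2)

theorem K_add {f g : ℝ → ℂ} (hf : IntegrableOn f (Ioc 0 1)) (hg : IntegrableOn g (Ioc 0 1))
    {ρ : ℝ} (hρ : ρ ∈ I) : K (f + g) ρ = K f ρ + K g ρ := by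
  simp only [K, Pi.add_apply, smul_add]
  exact intervalIntegral.integral_add (intervalIntegrable_of (integrableOn_smul hf) hρ)
    (intervalIntegrable_of (integrableOn_smul hg) hρ)

theorem K_smul (f : ℝ → ℂ) (c : ℂ) : K (c • f) = c • K f := by
  funext ρ
  simp only [K, Pi.smul_apply, smul_comm _ c]
  exact intervalIntegral.integral_smul c _

theorem integrableOn_primitive {f : ℝ → ℂ} (hf : IntegrableOn f (Ioc 0 1)) :
    IntegrableOn (fun ρ => ∫ s in (0 : ℝ)..ρ, f s) (Ioc 0 1) := by
  have h : ContinuousOn (fun ρ => ∫ s in (0 : ℝ)..ρ, f s) (uIcc 0 1) :=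
    intervalIntegral.continuousOn_primitive_interval
      (by rw [uIcc_of_le zero_le_one]; exact (integrableOn_Icc_iff_integrableOn_Ioc).2 hf)
  rw [uIcc_of_le zero_le_one] at h
  exact h.integrableOn_Icc.mono_set Ioc_subset_Icc_self

theorem integrableOn_K {f : ℝ → ℂ} (hf : IntegrableOn f (Ioc 0 1)) :
    IntegrableOn (K f) (Ioc 0 1) :=
  integrableOn_primitive (integrableOn_smul hf)

theorem integrableOn_L2 (f : L2) : IntegrableOn f (Ioc 0 1) :=
  (Lp.memLp f).integrable (by norm_num)

theorem integrableOn_fn₂ (u : H) : IntegrableOn (fn₂ u) (Ioc 0 1) :=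
  integrableOn_primitive (integrableOn_L2 _)

theorem ae_of_I {f g : ℝ → ℂ} (h : ∀ ρ ∈ I, f ρ = g ρ) : f =ᵐ[μ] g :=
  (ae_restrict_iff' measurableSet_Ioc).2 (ae_of_all _ fun s hs => h s (Ioc_subset_Icc_self hs))

theorem fn₁_add (u v : H) {ρ : ℝ} (hρ : ρ ∈ I) : fn₁ (u + v) ρ = fn₁ u ρ + fn₁ v ρ := by
  rw [fn₁, fn₁, fn₁, ← K_add (integrableOn_K (integrableOn_L2 _))
    (integrableOn_K (integrableOn_L2 _)) hρ]
  refine K_congr (ae_of_I fun s hs => ?_) hρ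
  rw [Pi.add_apply, ← K_add (integrableOn_L2 _) (integrableOn_L2 _) hs]
  exact K_congr (Lp.coeFn_add u.1.fst v.1.fst) hs

theorem fn₁_smul (c : ℂ) (u : H) {ρ : ℝ} (hρ : ρ ∈ I) : fn₁ (c • u) ρ = c • fn₁ u ρ := by
  rw [fn₁, fn₁, ← Pi.smul_apply, ← K_smul]
  refine K_congr (ae_of_I fun s hs => ?_) hρ
  rw [← K_smul]
  exact K_congr (Lp.coeFn_smul c u.1.fst) hs

theorem fn₂_add (u v : H) {ρ : ℝ} (hρ : ρ ∈ I) : fn₂ (u + v) ρ = fn₂ u ρ + fn₂ v ρ := by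
  rw [fn₂, fn₂, fn₂, ← intervalIntegral.integral_add
    (intervalIntegrable_of (integrableOn_L2 _) hρ) (intervalIntegrable_of (integrableOn_L2 _) hρ),
    intervalIntegral.integral_of_le hρ.1, intervalIntegral.integral_of_le hρ.1]
  exact integral_congr_ae (ae_restrict_of_ae_restrict_of_subset (Ioc_subset_Ioc_right hρ.2)
    (Lp.coeFn_add u.1.snd v.1.snd))

theorem fn₂_smul (c : ℂ) (u : H) {ρ : ℝ} (hρ : ρ ∈ I) : fn₂ (c • u) ρ = c • fn₂ u ρ := by
  rw [fn₂, fn₂, ← intervalIntegral.integral_smul,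
    intervalIntegral.integral_of_le hρ.1, intervalIntegral.integral_of_le hρ.1]
  exact integral_congr_ae (ae_restrict_of_ae_restrict_of_subset (Ioc_subset_Ioc_right hρ.2)
    (Lp.coeFn_smul c u.1.snd))

theorem fn₁_zero {ρ : ℝ} (hρ : ρ ∈ I) : fn₁ 0 ρ = 0 := by
  simpa using fn₁_smul 0 0 hρ

theorem fn₂_zero {ρ : ℝ} (hρ : ρ ∈ I) : fn₂ 0 ρ = 0 := by
  simpa using fn₂_smul 0 0 hρ

/-- The first component `-ρ u₁' + 2 u₁ + ρ² u₂ - 3 K u₂` of the free operator. -/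
def free₁ (u : (ℝ → ℂ) × (ℝ → ℂ)) (ρ : ℝ) : ℂ :=
  -(ρ • derivWithin u.1 I ρ) + 2 * u.1 ρ + ρ ^ 2 • u.2 ρ - 3 * K u.2 ρ

/-- The second component `D² u₁ - ρ u₂' - u₂` of the free operator. -/
def free₂ (u : (ℝ → ℂ) × (ℝ → ℂ)) (ρ : ℝ) : ℂ :=
  D (D u.1) ρ - ρ • derivWithin u.2 I ρ - u.2 ρ

theorem integrableOn_snd {u : (ℝ → ℂ) × (ℝ → ℂ)} (hu : u ∈ PreH) :
    IntegrableOn u.2 (Ioc 0 1) :=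
  (hu.2.1.continuousOn.integrableOn_Icc).mono_set Ioc_subset_Icc_self

theorem free₁_add {u v : (ℝ → ℂ) × (ℝ → ℂ)} (hu : u ∈ PreH) (hv : v ∈ PreH) {ρ : ℝ}
    (hρ : ρ ∈ I) : free₁ (u + v) ρ = free₁ u ρ + free₁ v ρ := by
  simp only [free₁, Prod.fst_add, Prod.snd_add, Pi.add_apply, smul_add,
    derivWithin_add' (hu.1.of_le (by norm_num)) (hv.1.of_le (by norm_num)) hρ,
    K_add (integrableOn_snd hu) (integrableOn_snd hv) hρ]
  ring

theorem free₁_smul {u : (ℝ → ℂ) × (ℝ → ℂ)} (hu : u ∈ PreH) (c : ℂ) {ρ : ℝ}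
    (hρ : ρ ∈ I) : free₁ (c • u) ρ = c • free₁ u ρ := by
  simp only [free₁, Prod.smul_fst, Prod.smul_snd, Pi.smul_apply,
    derivWithin_smul' (hu.1.of_le (by norm_num)) c hρ, K_smul, smul_eq_mul, Complex.real_smul]
  ring

theorem free₂_add {u v : (ℝ → ℂ) × (ℝ → ℂ)} (hu : u ∈ PreH) (hv : v ∈ PreH) {ρ : ℝ}
    (hρ : ρ ∈ Ioc (0 : ℝ) 1) : free₂ (u + v) ρ = free₂ u ρ + free₂ v ρ := by
  simp only [free₂, Prod.fst_add, Prod.snd_add, Pi.add_apply, smul_add,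
    derivWithin_add' hu.2.1 hv.2.1 (Ioc_subset_Icc_self hρ),
    DD_add (hu.1.of_le (by norm_num)) (hv.1.of_le (by norm_num)) hρ]
  ring

theorem free₂_smul {u : (ℝ → ℂ) × (ℝ → ℂ)} (hu : u ∈ PreH) (c : ℂ) {ρ : ℝ}
    (hρ : ρ ∈ Ioc (0 : ℝ) 1) : free₂ (c • u) ρ = c • free₂ u ρ := by
  simp only [free₂, Prod.smul_fst, Prod.smul_snd, Pi.smul_apply,
    derivWithin_smul' hu.2.1 c (Ioc_subset_Icc_self hρ),
    DD_smul (hu.1.of_le (by norm_num)) c hρ, smul_eq_mul, Complex.real_smul]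
  ring

/-- The graph of the free operator before closure: the pairs `(u, v)` with `u ∈ Dom₀` and
`v = (-ρ u₁' + 2 u₁ + ρ² u₂ - 3 K u₂, D² u₁ - ρ u₂' - u₂) ∈ PreH`. (For every `u ∈ Dom₀` this
formula does give an element of `PreH`, its value at `ρ = 0` being given by continuity.) -/
def graph₀ : Submodule ℂ (H × H) where
  carrier := {p | ∃ u v : PreH, u.1 ∈ Dom₀ ∧
    (∀ ρ ∈ Ioc (0 : ℝ) 1, v.1.1 ρ = free₁ u.1 ρ ∧ v.1.2 ρ = free₂ u.1 ρ) ∧ p = (toH u, toH v)}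
  zero_mem' := by
    refine ⟨0, 0, zero_mem _, fun ρ hρ => ⟨?_, ?_⟩, ?_⟩
    · have := free₁_smul (zero_mem PreH) 0 (Ioc_subset_Icc_self hρ)
      rw [zero_smul, zero_smul] at this
      exact this.symm
    · have := free₂_smul (zero_mem PreH) 0 hρ
      rw [zero_smul, zero_smul] at this
      exact this.symm
    · rw [map_zero]; rfl
  add_mem' := by
    rintro _ _ ⟨u, v, h1, h2, rfl⟩ ⟨u', v', h1', h2', rfl⟩
    refine ⟨u + u', v + v', add_mem h1 h1', fun ρ hρ => ⟨?_, ?_⟩, by rw [map_add, map_add]; rfl⟩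
    · refine Eq.trans ?_ (free₁_add u.2 u'.2 (Ioc_subset_Icc_self hρ)).symm
      rw [← (h2 ρ hρ).1, ← (h2' ρ hρ).1]; rfl
    · refine Eq.trans ?_ (free₂_add u.2 u'.2 hρ).symm
      rw [← (h2 ρ hρ).2, ← (h2' ρ hρ).2]; rfl
  smul_mem' := by
    rintro c _ ⟨u, v, h1, h2, rfl⟩
    refine ⟨c • u, c • v, Submodule.smul_mem _ c h1, fun ρ hρ => ⟨?_, ?_⟩,
      by rw [map_smul, map_smul]; rfl⟩
    · refine Eq.trans ?_ (free₁_smul u.2 c (Ioc_subset_Icc_self hρ)).symm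
      rw [← (h2 ρ hρ).1]; rfl
    · refine Eq.trans ?_ (free₂_smul u.2 c hρ).symm
      rw [← (h2 ρ hρ).2]; rfl

/-- The free operator before closure, with domain (the image of) `Dom₀`. -/
def preL₀ : H →ₗ.[ℂ] H := graph₀.toLinearPMap

/-- The free operator `L₀`, the closure of `preL₀`. -/
def L₀ : H →ₗ.[ℂ] H := preL₀.closure

/-- The graph of the operator `u ↦ (-V K² u₂, 0)` on `ℋ` (which is defined on all of `ℋ`). -/
def graphPot : Submodule ℂ (H × H) where
  carrier := {p | ∀ ρ ∈ I, fn₁ p.2 ρ = -(V ρ • K (K (fn₂ p.1)) ρ) ∧ fn₂ p.2 ρ = 0}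
  zero_mem' := fun ρ hρ => by
    have e : K (K (fn₂ 0)) ρ = K (K (0 : ℝ → ℂ)) ρ :=
      K_congr (ae_of_I fun s hs => K_congr (ae_of_I fun t ht => fn₂_zero ht) hs) hρ
    have e' : K (0 : ℝ → ℂ) = 0 := by simpa using K_smul 0 0
    simp [fn₁_zero hρ, fn₂_zero hρ, e, e']
  add_mem' := by
    intro p q hp hq ρ hρ
    have e : K (K (fn₂ (p.1 + q.1))) ρ = K (K (fn₂ p.1)) ρ + K (K (fn₂ q.1)) ρ := by
      rw [← K_add (integrableOn_K (integrableOn_fn₂ _)) (integrableOn_K (integrableOn_fn₂ _)) hρ]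
      refine K_congr (ae_of_I fun s hs => ?_) hρ
      rw [Pi.add_apply, ← K_add (integrableOn_fn₂ _) (integrableOn_fn₂ _) hs]
      exact K_congr (ae_of_I fun t ht => fn₂_add _ _ ht) hs
    refine ⟨?_, ?_⟩
    · rw [Prod.snd_add, Prod.fst_add, fn₁_add _ _ hρ, e, (hp ρ hρ).1, (hq ρ hρ).1, smul_add,
        neg_add]
    · rw [Prod.snd_add, fn₂_add _ _ hρ, (hp ρ hρ).2, (hq ρ hρ).2, add_zero]
  smul_mem' := by
    intro c p hp ρ hρ
    have e : K (K (fn₂ (c • p.1))) ρ = c • K (K (fn₂ p.1)) ρ := by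
      rw [← Pi.smul_apply c (K (K (fn₂ p.1))), ← K_smul, ← K_smul]
      exact K_congr (ae_of_I fun s hs => K_congr (ae_of_I fun t ht => fn₂_smul _ _ ht) hs) hρ
    refine ⟨?_, ?_⟩
    · rw [Prod.smul_snd, Prod.smul_fst, fn₁_smul _ _ hρ, e, (hp ρ hρ).1, smul_neg, smul_comm]
    · rw [Prod.smul_snd, fn₂_smul _ _ hρ, (hp ρ hρ).2, smul_zero]

/-- The potential operator `L' u = (-V K² u₂, 0)`. -/
def Lpot : H →ₗ.[ℂ] H := graphPot.toLinearPMap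

/-- The generator `L = L₀ + L'` of the linearized evolution. -/
def L : H →ₗ.[ℂ] H := L₀ + Lpot

/-- `R` is a bounded two-sided inverse of `z - A : D(A) → E`. -/
def IsResolventAt {E : Type*} [NormedAddCommGroup E] [NormedSpace ℂ E] (A : E →ₗ.[ℂ] E) (z : ℂ)
    (R : E →L[ℂ] E) : Prop :=
  (∀ y : E, ∃ h : R y ∈ A.domain, z • R y - A ⟨R y, h⟩ = y) ∧
    ∀ x : A.domain, R (z • (x : E) - A x) = x

/-- The resolvent set of an unbounded operator. -/
def resolventSet {E : Type*} [NormedAddCommGroup E] [NormedSpace ℂ E] (A : E →ₗ.[ℂ] E) : Set ℂ :=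
  {z | ∃ R : E →L[ℂ] E, IsResolventAt A z R}

/-- The spectrum of an unbounded operator. -/
def spectrum {E : Type*} [NormedAddCommGroup E] [NormedSpace ℂ E] (A : E →ₗ.[ℂ] E) : Set ℂ :=
  (resolventSet A)ᶜ

open Classical in
/-- The resolvent `(z - A)⁻¹`, for `z` in the resolvent set (and `0` elsewhere). -/
def resolvent {E : Type*} [NormedAddCommGroup E] [NormedSpace ℂ E] (A : E →ₗ.[ℂ] E) (z : ℂ) :
    E →L[ℂ] E :=
  if h : ∃ R : E →L[ℂ] E, IsResolventAt A z R then h.choose else 0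

/-- The circle with centre `c` and radius `r > 0` lies in the resolvent set of `A`, encloses the
point `z ∈ σ(A)`, and encloses no other point of the spectrum. -/
def Separates {E : Type*} [NormedAddCommGroup E] [NormedSpace ℂ E] (A : E →ₗ.[ℂ] E) (z : ℂ)
    (c : ℂ) (r : ℝ) : Prop :=
  0 < r ∧ Metric.sphere c r ⊆ resolventSet A ∧ Metric.ball c r ∩ spectrum A = {z}

/-- The Riesz projection `(2πi)⁻¹ ∮ (z - A)⁻¹ dz` over the circle with centre `c` and radius `r`. -/
def rieszProjection {E : Type*} [NormedAddCommGroup E] [NormedSpace ℂ E] (A : E →ₗ.[ℂ] E)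
    (c : ℂ) (r : ℝ) : E →L[ℂ] E :=
  (2 * (Real.pi : ℂ) * Complex.I)⁻¹ • circleIntegral (resolvent A) c r

/-- The components of the symmetry mode,
`(ρ⁵ (5 - ρ²) / (5 + 3 ρ²)³, ρ (125 - 50 ρ² - 3 ρ⁴) / (5 + 3 ρ²)⁴)`. -/
def symFun : (ℝ → ℂ) × (ℝ → ℂ) :=
  (fun ρ => ((ρ ^ 5 * ((5 - ρ ^ 2) / (5 + 3 * ρ ^ 2) ^ 3) : ℝ) : ℂ),
    fun ρ => ((ρ * (125 - 50 * ρ ^ 2 - 3 * ρ ^ 4) / (5 + 3 * ρ ^ 2) ^ 4 : ℝ) : ℂ))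

theorem iteratedDeriv_pow_mul (k : ℕ) : ∀ (n : ℕ) (h : ℝ → ℝ), k < n → ContDiff ℝ ∞ h →
    iteratedDeriv k (fun x => x ^ n * h x) 0 = 0 := by
  induction k with
  | zero => intro n h hn _; simp [(Nat.pos_of_ne_zero (by omega) : 0 < n).ne']
  | succ k ih =>
    intro n h hn hh
    obtain ⟨m, rfl⟩ : ∃ m, n = m + 1 := ⟨n - 1, by omega⟩
    have hd : ContDiff ℝ ∞ (deriv h) := (contDiff_infty_iff_deriv.1 hh).2
    have e : deriv (fun x => x ^ (m + 1) * h x) =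
        fun x => x ^ m * ((m + 1) * h x + x * deriv h x) := by
      funext x
      have := ((hasDerivAt_pow (m + 1) x).mul
        ((hh.differentiable (by simp)) x).hasDerivAt).deriv
      refine Eq.trans this ?_
      simp only [Nat.add_sub_cancel]
      push_cast
      ring
    rw [iteratedDeriv_succ', e]
    exact ih m _ (by omega) (by fun_prop)

theorem symFun_mem : symFun ∈ PreH := by
  have hp : ∀ x : ℝ, 5 + 3 * x ^ 2 ≠ 0 := fun x => by positivity
  have h : ContDiff ℝ ∞ (fun ρ : ℝ => (5 - ρ ^ 2) / (5 + 3 * ρ ^ 2) ^ 3) :=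
    ContDiff.div (by fun_prop) (by fun_prop) fun x => pow_ne_zero _ (hp x)
  have h1 : ContDiff ℝ ∞ (fun ρ : ℝ => ρ ^ 5 * ((5 - ρ ^ 2) / (5 + 3 * ρ ^ 2) ^ 3)) :=
    (contDiff_id.pow 5).mul h
  have h2 : ContDiff ℝ ∞
      (fun ρ : ℝ => ρ * (125 - 50 * ρ ^ 2 - 3 * ρ ^ 4) / (5 + 3 * ρ ^ 2) ^ 4) :=
    ContDiff.div (by fun_prop) (by fun_prop) fun x => pow_ne_zero _ (hp x)
  have c1 : ContDiff ℝ ∞ symFun.1 := Complex.ofRealCLM.contDiff.comp h1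
  have c2 : ContDiff ℝ ∞ symFun.2 := Complex.ofRealCLM.contDiff.comp h2
  refine ⟨(c1.of_le (WithTop.coe_le_coe.2 (le_top : ((4 : ℕ) : ℕ∞) ≤ ⊤))).contDiffOn,
    (c2.of_le (by exact_mod_cast le_top)).contDiffOn, fun k hk => ?_, by simp [symFun]⟩
  have c1k : ContDiff ℝ k symFun.1 := c1.of_le (by exact_mod_cast le_top)
  rw [iteratedDerivWithin_eq_iteratedDeriv (uniqueDiffOn_Icc one_pos) c1k.contDiffAt (by simp)]
  have hz := iteratedDeriv_pow_mul k 5 _ (by omega) h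
  have hc : iteratedDeriv k symFun.1 0 = Complex.ofRealCLM
      (iteratedDeriv k (fun ρ : ℝ => ρ ^ 5 * ((5 - ρ ^ 2) / (5 + 3 * ρ ^ 2) ^ 3)) 0) := by
    have := Complex.ofRealCLM.iteratedFDeriv_comp_left (x := 0) h1.contDiffAt (i := k)
      (by exact_mod_cast le_top)
    rw [iteratedDeriv, iteratedDeriv]
    exact congrArg (fun T => T fun _ => (1 : ℝ)) this
  rw [hc, hz, map_zero]

/-- The symmetry mode as an element of `ℋ`. -/
def symmetryMode : H := toH ⟨symFun, symFun_mem⟩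

end YangMills

end

/-! The number 1 turns out to be an algebraically simple eigenvalue of a compact perturbation of an
operator with 1 in its resolvent set. This makes 1 a simple pole of the resolvent, with residue a
rank-one projection onto the eigenvector.

The free operator. In the coordinates `a = D² u₁`, `b = u₂'` the free operator becomes the
first-order system `(-ρ a' + b' - 2a, a' - ρ b' - 2b)` with boundary condition `a(0) = 0`. The real
part of `(x | (L₀ + 3/2) x)` is the integral of an exact derivative and equals `-|a(1) - b(1)|² /
2`, so `1 - L₀` is bounded below (`re_inner_le_of_mem_graph₀`, `norm_le_of_mem_closure`). In the
characteristic variables `a + b` and `a - b` the system decouples, and explicit powers of `1 ∓ ρ`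
show that the range of `1 - L₀` is dense (`eq_zero_of_forall_inner_eq_zero`). Hence 1 is in the
resolvent set of `L₀`.

The potential. Since `D` is a derivation inverse to `K`, the coordinate `D² (V K² u₂)` is a bounded
expression in `u₂ = ∫₀ b`, and `b ↦ ∫₀ b` is compact on `L²(0,1)` (`isCompactOperator_potOp`).

Simplicity. If `u - L u = c g`, then `u₁` can be eliminated and `w = K² u₂` satisfies a second-order
linear equation, solved for `c = 0` by the mode itself. A weighted Wronskian of `w` with the mode,
corrected by a multiple of `c`, is constant and vanishes at `ρ = 0`. At `ρ = 1` the weight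
degenerates and only the term in `c` survives, so `c = 0`; then the Wronskian vanishes and `u` is a
multiple of `g` (`simple_of_mem_graph`). This excludes both a second eigenvector and a Jordan chain.

Conclusion. Adding the rank-one operator `ψ(·) g` makes `1 - L` injective, hence invertible by the
Fredholm alternative, and yields a reduced resolvent `S` and a functional `φ`
(`exists_isReducedResolventAt`). Near 1 the resolvent is `(z - 1)⁻¹ φ(·) g` plus a holomorphic
function of `z`, so Cauchy's theorem gives `φ(·) g` for the Riesz projection (`rieszProjection_eq`).
-/

noncomputable section

namespace YangMills

/-! ### Resolvents of unbounded operators near a simple eigenvalue -/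

section Abstract

variable {E : Type*} [NormedAddCommGroup E] [NormedSpace ℂ E]

theorem mem_graph_of_eq {A : E →ₗ.[ℂ] E} {x x' y y' : E} (h : (x, y) ∈ A.graph) (hx : x' = x)
    (hy : y' = y) : (x', y') ∈ A.graph := by
  rwa [hx, hy]

/-- Stated through the graph, the resolvent conditions carry no domain proofs; all later arguments
are linear algebra in `A.graph`. -/
theorem isResolventAt_iff {A : E →ₗ.[ℂ] E} {z : ℂ} {R : E →L[ℂ] E} :
    IsResolventAt A z R ↔ (∀ y, (R y, z • R y - y) ∈ A.graph) ∧
      ∀ x y, (x, y) ∈ A.graph → R (z • x - y) = x := by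
  constructor
  · rintro ⟨h1, h2⟩
    refine ⟨fun y => ?_, fun x y hxy => ?_⟩
    · obtain ⟨h, e⟩ := h1 y
      refine (LinearPMap.mem_graph_iff A).2 ⟨⟨R y, h⟩, rfl, ?_⟩
      rw [eq_sub_iff_add_eq, ← eq_sub_iff_add_eq', e]
    · obtain ⟨x', rfl, rfl⟩ := (LinearPMap.mem_graph_iff A).1 hxy
      exact h2 x'
  · rintro ⟨h1, h2⟩
    refine ⟨fun y => ?_, fun x => h2 _ _ (A.mem_graph x)⟩
    obtain ⟨x', e1, e2⟩ := (LinearPMap.mem_graph_iff A).1 (h1 y)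
    have h : R y ∈ A.domain := by
      have := x'.2
      rwa [e1] at this
    refine ⟨h, ?_⟩
    have : x' = ⟨R y, h⟩ := Subtype.ext e1
    rw [← this, e2, sub_sub_cancel]

/-- Uniqueness of the inverse, which identifies the operator chosen in `resolvent` with any explicit
candidate. -/
theorem IsResolventAt.resolvent_eq {A : E →ₗ.[ℂ] E} {z : ℂ} {R : E →L[ℂ] E}
    (h : IsResolventAt A z R) : resolvent A z = R := by
  have hex : ∃ R : E →L[ℂ] E, IsResolventAt A z R := ⟨R, h⟩
  rw [resolvent, dif_pos hex]
  have h' := isResolventAt_iff.1 hex.choose_spec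
  ext y
  have := h'.2 _ _ ((isResolventAt_iff.1 h).1 y)
  rwa [sub_sub_cancel] at this

/-- On the domain of `A`, `z - A = (1 + (z - z₀) R) (z₀ - A)`, and `R` commutes with the first
factor. -/
theorem isResolventAt_of_isUnit {A : E →ₗ.[ℂ] E} {z₀ z : ℂ} {R : E →L[ℂ] E}
    (h : IsResolventAt A z₀ R) (hu : IsUnit (1 + (z - z₀) • R)) :
    IsResolventAt A z (R * Ring.inverse (1 + (z - z₀) • R)) := by
  obtain ⟨h1, h2⟩ := isResolventAt_iff.1 h
  set N := Ring.inverse (1 + (z - z₀) • R)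
  have e1 : (1 + (z - z₀) • R) * N = 1 := Ring.mul_inverse_cancel _ hu
  have e2 : N * (1 + (z - z₀) • R) = 1 := Ring.inverse_mul_cancel _ hu
  have hc : Commute R N := by
    have hc' : Commute R (1 + (z - z₀) • R) :=
      (Commute.one_right R).add_right ((Commute.refl R).smul_right _)
    calc R * N = N * (1 + (z - z₀) • R) * R * N := by rw [e2, one_mul]
      _ = N * (R * (1 + (z - z₀) • R)) * N := by rw [hc'.eq, mul_assoc N]
      _ = N * R := by rw [mul_assoc, mul_assoc R, e1, mul_one]
  refine isResolventAt_iff.2 ⟨fun y => ?_, fun x y hxy => ?_⟩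
  · have e : N y + (z - z₀) • R (N y) = y := by
      simpa using congrArg (fun T : E →L[ℂ] E => T y) e1
    have := h1 (N y)
    refine mem_graph_of_eq this rfl ?_
    change z • R (N y) - y = z₀ • R (N y) - N y
    nth_rewrite 2 [← e]
    rw [sub_smul]; abel
  · have e : ∀ x, N (x + (z - z₀) • R x) = x := fun x => by
      simpa using congrArg (fun T : E →L[ℂ] E => T x) e2
    rw [hc.eq]
    change N (R (z • x - y)) = x
    have : z • x - y = (z₀ • x - y) + (z - z₀) • x := by rw [sub_smul]; abel
    rw [this, map_add, h2 x y hxy, map_smul, e]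

section Complete

variable [CompleteSpace E]

theorem eventually_isUnit_one_add_smul (R : E →L[ℂ] E) (z₀ : ℂ) :
    ∀ᶠ z in nhds z₀, IsUnit (1 + (z - z₀) • R) := by
  have hc : ContinuousAt (fun z : ℂ => 1 + (z - z₀) • R) z₀ := by fun_prop
  refine hc.eventually_mem (Units.isOpen.mem_nhds ?_)
  simp

theorem differentiableAt_mul_inverse (R : E →L[ℂ] E) (z₀ : ℂ) :
    DifferentiableAt ℂ (fun z => R * Ring.inverse (1 + (z - z₀) • R)) z₀ := by
  have h1 : DifferentiableAt ℂ (fun z : ℂ => 1 + (z - z₀) • R) z₀ := by fun_prop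
  have hu : IsUnit (1 + (z₀ - z₀) • R) := by simp
  exact ((differentiableAt_inverse (𝕜 := ℂ) hu).comp z₀ h1).const_mul R

theorem differentiableAt_resolvent {A : E →ₗ.[ℂ] E} {z₀ : ℂ} (h : z₀ ∈ resolventSet A) :
    DifferentiableAt ℂ (resolvent A) z₀ := by
  obtain ⟨R, hR⟩ := h
  refine (differentiableAt_mul_inverse R z₀).congr_of_eventuallyEq ?_
  filter_upwards [eventually_isUnit_one_add_smul R z₀] with z hz
  exact (isResolventAt_of_isUnit hR hz).resolvent_eq

end Complete

/-- `S` is the reduced resolvent of `A` at the simple eigenvalue `z₀` with eigenvector `g` and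
spectral projection `φ(·) g`. -/
structure IsReducedResolventAt (A : E →ₗ.[ℂ] E) (z₀ : ℂ) (g : E) (φ : E →L[ℂ] ℂ)
    (S : E →L[ℂ] E) : Prop where
  apply_eq_one : φ g = 1
  mem_graph : (g, z₀ • g) ∈ A.graph
  right_inv : ∀ y, (S y, z₀ • S y - (y - φ y • g)) ∈ A.graph
  left_inv : ∀ x y, (x, y) ∈ A.graph → S (z₀ • x - y) = x - φ x • g
  apply_comp : ∀ x, φ (S x) = 0

namespace IsReducedResolventAt

variable {A : E →ₗ.[ℂ] E} {z₀ : ℂ} {g : E} {φ : E →L[ℂ] ℂ} {S : E →L[ℂ] E}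

/-- `φ` annihilates the range of `z₀ - A`: both `right_inv` and linearity of the graph give a value
of `A` at `x - φ x • g`, and single-valuedness forces the discrepancy `φ (z₀ • x - y) • g` to
vanish. -/
theorem apply_sub (h : IsReducedResolventAt A z₀ g φ S) {x y : E} (hxy : (x, y) ∈ A.graph) :
    φ (z₀ • x - y) = 0 := by
  have h1 := h.right_inv (z₀ • x - y)
  rw [h.left_inv x y hxy] at h1
  have h2 := A.graph.sub_mem hxy (A.graph.smul_mem (φ x) h.mem_graph)
  have h3 := A.mem_graph_snd_inj h1 h2 (by simp)
  have h4 : φ (z₀ • x - y) • g = 0 := by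
    have : φ (z₀ • x - y) • g = (z₀ • (x - φ x • g) - (z₀ • x - y - φ (z₀ • x - y) • g)) -
      (y - φ x • z₀ • g) := by
      rw [smul_sub, smul_comm z₀ (φ x)]; abel
    rw [this, h3]; simp
  have h5 := congrArg φ h4
  rwa [map_smul, h.apply_eq_one, map_zero, smul_eq_mul, mul_one] at h5

/-- The space splits as the line of `g` plus the kernel of `φ`. On the line, `z - A` is
multiplication by `z - z₀`; on the kernel, `S` inverts `z₀ - A`, so the factorization of the regular
case applies with `S` in place of the resolvent. -/
theorem isResolventAt (h : IsReducedResolventAt A z₀ g φ S) {z : ℂ} (hz : z ≠ z₀)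
    (hu : IsUnit (1 + (z - z₀) • S)) :
    IsResolventAt A z ((z - z₀)⁻¹ • φ.smulRight g + S * Ring.inverse (1 + (z - z₀) • S)) := by
  have hz' : z - z₀ ≠ 0 := sub_ne_zero.2 hz
  set N := Ring.inverse (1 + (z - z₀) • S)
  have e1 : ∀ y, N y + (z - z₀) • S (N y) = y := fun y => by
    simpa using congrArg (fun T : E →L[ℂ] E => T y) (Ring.mul_inverse_cancel _ hu)
  have e2 : ∀ x, N (x + (z - z₀) • S x) = x := fun x => by
    simpa using congrArg (fun T : E →L[ℂ] E => T x) (Ring.inverse_mul_cancel _ hu)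
  have hN : ∀ y, φ (N y) = φ y := fun y => by
    conv_rhs => rw [← e1 y]
    rw [map_add, map_smul, h.apply_comp, smul_zero, add_zero]
  have right : ∀ y, (((z - z₀)⁻¹ • φ.smulRight g + S * N) y,
      z • ((z - z₀)⁻¹ • φ.smulRight g + S * N) y - y) ∈ A.graph := fun y => by
    have h1 := A.graph.add_mem (A.graph.smul_mem ((z - z₀)⁻¹ * φ y) h.mem_graph)
      (h.right_inv (N y))
    refine mem_graph_of_eq h1 ?_ ?_
    · change (z - z₀)⁻¹ • φ y • g + S (N y) = _
      rw [smul_smul]; rfl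
    · change z • ((z - z₀)⁻¹ • φ y • g + S (N y)) - y = ((z - z₀)⁻¹ * φ y) • z₀ • g +
        (z₀ • S (N y) - (N y - φ (N y) • g))
      rw [hN]
      nth_rewrite 3 [← e1 y]
      have : z • (z - z₀)⁻¹ • φ y • g = φ y • g + ((z - z₀)⁻¹ * φ y) • z₀ • g := by
        simp only [smul_smul, ← add_smul]
        congr 1
        field_simp
        ring
      rw [smul_add, this, sub_smul]; abel
  -- Injectivity of `z - A` upgrades the right inverse to a two-sided one.
  have inj : ∀ x, (x, z • x) ∈ A.graph → x = 0 := fun x hx => by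
    have h1 : (z₀ - z) * φ x = 0 := by
      have := h.apply_sub hx
      rwa [← sub_smul, map_smul] at this
    have h2 : φ x = 0 := (mul_eq_zero.1 h1).resolve_left (sub_ne_zero.2 hz.symm)
    have h3 := h.left_inv _ _ hx
    rw [← sub_smul, map_smul, h2, zero_smul, sub_zero] at h3
    have h4 : x + (z - z₀) • S x = 0 := by
      nth_rewrite 1 [← h3]
      rw [← add_smul]; simp
    have := e2 x
    rw [h4, map_zero] at this
    exact this.symm
  refine isResolventAt_iff.2 ⟨right, fun x y hxy => ?_⟩
  have h1 := A.graph.sub_mem (right (z • x - y)) hxy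
  rw [← sub_eq_zero]
  refine inj _ ?_
  refine mem_graph_of_eq h1 rfl ?_
  dsimp only; rw [smul_sub]; abel

theorem mem_spectrum (h : IsReducedResolventAt A z₀ g φ S) : z₀ ∈ spectrum A := by
  rintro ⟨R, hR⟩
  have h1 := (isResolventAt_iff.1 hR).2 _ _ h.mem_graph
  rw [sub_self, map_zero] at h1
  have := h.apply_eq_one
  rw [← h1, map_zero] at this
  exact zero_ne_one this

theorem exists_separates [CompleteSpace E] (h : IsReducedResolventAt A z₀ g φ S) : ∃ c r, Separates A z₀ c r := by
  obtain ⟨ε, hε, hb⟩ := Metric.eventually_nhds_iff.1 (eventually_isUnit_one_add_smul S z₀)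
  have key : ∀ z, dist z z₀ < ε → z ≠ z₀ → z ∈ resolventSet A := fun z hz hne =>
    ⟨_, h.isResolventAt hne (hb hz)⟩
  refine ⟨z₀, ε / 2, by positivity, fun z hz => ?_, ?_⟩
  · rw [Metric.mem_sphere] at hz
    refine key z (by linarith) fun e => ?_
    rw [e, dist_self] at hz
    linarith
  · ext z
    constructor
    · rintro ⟨h1, h2⟩
      by_contra hne
      exact h2 (key z (by rw [Metric.mem_ball] at h1; linarith) hne)
    · rintro rfl
      exact ⟨Metric.mem_ball_self (by positivity), h.mem_spectrum⟩

/-- Removing the polar part `(z - z₀)⁻¹ • P` leaves a function holomorphic on the closed disc, which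
integrates to zero; the polar part contributes `2πi P` wherever `z₀` lies inside the circle. -/
theorem rieszProjection_eq [CompleteSpace E] (h : IsReducedResolventAt A z₀ g φ S) {c : ℂ} {r : ℝ}
    (hs : Separates A z₀ c r) : rieszProjection A c r = φ.smulRight g := by
  obtain ⟨hr, hsph, hball⟩ := hs
  set P : E →L[ℂ] E := φ.smulRight g
  have hz₀ : z₀ ∈ Metric.ball c r := (hball.symm.subset rfl).1
  have hreg : ∀ z ∈ Metric.closedBall c r, z ≠ z₀ → z ∈ resolventSet A := fun z hz hne => by
    by_contra hn
    rw [← Metric.ball_union_sphere] at hz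
    rcases hz with hz | hz
    · exact hne (hball.subset ⟨hz, hn⟩)
    · exact hn (hsph hz)
  -- The value `S` at `z₀` is that of `S (1 + (z - z₀) S)⁻¹`, so it fills in the removable
  -- singularity.
  set F : ℂ → E →L[ℂ] E := Function.update (fun z => resolvent A z - (z - z₀)⁻¹ • P) z₀ S
  have hFne : ∀ z, z ≠ z₀ → F z = resolvent A z - (z - z₀)⁻¹ • P := fun z hz => by
    simp [F, Function.update_of_ne hz]
  have hF : ∀ z ∈ Metric.closedBall c r, DifferentiableAt ℂ F z := fun z hz => by
    rcases eq_or_ne z z₀ with rfl | hne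
    · refine (differentiableAt_mul_inverse S z).congr_of_eventuallyEq ?_
      filter_upwards [eventually_isUnit_one_add_smul S z] with x hx
      rcases eq_or_ne x z with rfl | hx'
      · simp [F]
      · rw [hFne x hx', (h.isResolventAt hx' hx).resolvent_eq, add_sub_cancel_left]
    · have h1 : DifferentiableAt ℂ (fun z => resolvent A z - (z - z₀)⁻¹ • P) z := by
        refine (differentiableAt_resolvent (hreg z hz hne)).sub ?_
        exact ((differentiableAt_id.sub_const z₀).inv (sub_ne_zero.2 hne)).smul_const P
      refine h1.congr_of_eventuallyEq ?_
      filter_upwards [isOpen_ne.mem_nhds hne] with x hx using hFne x hx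
  have hint : circleIntegral F c r = 0 :=
    Complex.circleIntegral_eq_zero_of_differentiable_on_off_countable hr.le countable_empty
      (fun z hz => (hF z hz).continuousAt.continuousWithinAt)
      (fun z hz => hF z (Metric.ball_subset_closedBall hz.1))
  have hne : ∀ z ∈ Metric.sphere c r, z ≠ z₀ := fun z hz e => by
    rw [e, Metric.mem_sphere] at hz
    exact absurd hz (Metric.mem_ball.1 hz₀).ne
  have hG : ContinuousOn (fun z => (z - z₀)⁻¹) (Metric.sphere c r) :=
    ContinuousOn.inv₀ (by fun_prop) fun z hz => sub_ne_zero.2 (hne z hz)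
  have e : circleIntegral (resolvent A) c r =
      circleIntegral (fun z => F z + (z - z₀)⁻¹ • P) c r :=
    circleIntegral.integral_congr hr.le fun z hz => by
      simp only [hFne z (hne z hz), sub_add_cancel]
  have i1 : CircleIntegrable F c r := ContinuousOn.circleIntegrable hr.le fun z hz =>
    (hF z (Metric.sphere_subset_closedBall hz)).continuousAt.continuousWithinAt
  have i2 : CircleIntegrable (fun z => (z - z₀)⁻¹ • P) c r :=
    ContinuousOn.circleIntegrable hr.le (hG.smul continuousOn_const)
  rw [rieszProjection, e, circleIntegral.integral_add i1 i2, hint, zero_add,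
    circleIntegral.integral_smul_const, circleIntegral.integral_sub_inv_of_mem_ball hz₀,
    smul_smul, inv_mul_cancel₀ Complex.two_pi_I_ne_zero, one_smul]

theorem range_smulRight (h : IsReducedResolventAt A z₀ g φ S) :
    (φ.smulRight g).range = ℂ ∙ g := by
  ext x
  rw [Submodule.mem_span_singleton]
  constructor
  · rintro ⟨y, rfl⟩
    exact ⟨φ y, rfl⟩
  · rintro ⟨a, rfl⟩
    refine ⟨a • g, ?_⟩
    change φ (a • g) • g = _
    rw [map_smul, h.apply_eq_one, smul_eq_mul, mul_one]

theorem ne_zero (h : IsReducedResolventAt A z₀ g φ S) : g ≠ 0 := fun e => by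
  have := h.apply_eq_one
  rw [e, map_zero] at this
  exact zero_ne_one this

end IsReducedResolventAt

/-- If `A = A₀ + B` where `z₀ - A₀` is invertible and `B` is compact, and if `z₀` is an
algebraically simple eigenvalue of `A`, then the reduced resolvent exists. -/
theorem exists_isReducedResolventAt [CompleteSpace E] {A A₀ : E →ₗ.[ℂ] E} {B R₀ : E →L[ℂ] E} {z₀ : ℂ} {g : E}
    (hA : ∀ x y, (x, y) ∈ A.graph ↔ (x, y - B x) ∈ A₀.graph) (hR₀ : IsResolventAt A₀ z₀ R₀)
    (hB : IsCompactOperator B) (hg : (g, z₀ • g) ∈ A.graph) (hg0 : g ≠ 0)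
    (hsimple : ∀ (c : ℂ) x, (x, z₀ • x - c • g) ∈ A.graph → c = 0 ∧ x ∈ ℂ ∙ g) :
    ∃ φ S, IsReducedResolventAt A z₀ g φ S := by
  obtain ⟨r1, r2⟩ := isResolventAt_iff.1 hR₀
  obtain ⟨ψ, hψ⟩ : ∃ ψ : E →L[ℂ] ℂ, ψ g = 1 := by
    obtain ⟨ψ, -, hψ⟩ := exists_dual_vector ℂ g (norm_ne_zero_iff.2 hg0)
    have hn : ((‖g‖ : ℝ) : ℂ) ≠ 0 := by simpa using hg0
    refine ⟨((‖g‖ : ℝ) : ℂ)⁻¹ • ψ, ?_⟩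
    change ((‖g‖ : ℝ) : ℂ)⁻¹ * ψ g = 1
    rw [hψ]
    exact inv_mul_cancel₀ hn
  -- Chosen so that `(z₀ - A + ψ(·) g) R₀ = 1 - T`.
  set T : E →L[ℂ] E := (B - ψ.smulRight g) * R₀
  have hT : IsCompactOperator T := by
    refine IsCompactOperator.comp_clm (f := fun x => (B - ψ.smulRight g) x) ?_ R₀
    refine hB.sub ?_
    have h1 : IsCompactOperator (ψ : E → ℂ) := isCompactOperator_of_locallyCompactSpace_dom ψ
    exact h1.clm_comp ((ContinuousLinearMap.id ℂ ℂ).smulRight g)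
  have hTx : ∀ y, T y = B (R₀ y) - ψ (R₀ y) • g := fun y => rfl
  -- The kernel of `z₀ - A + ψ(·) g` is trivial: simplicity with `c = -ψ x` gives `ψ x = 0` and `x =
  -- a • g`, whence `a = ψ x = 0`.
  have hinj : ∀ x, (x, z₀ • x + ψ x • g) ∈ A.graph → x = 0 := fun x hx => by
    have h1 := hsimple (-ψ x) x (by rwa [neg_smul, sub_neg_eq_add])
    obtain ⟨a, rfl⟩ := Submodule.mem_span_singleton.1 h1.2
    have h2 := h1.1
    rw [map_smul, hψ, smul_eq_mul, mul_one, neg_eq_zero] at h2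
    rw [h2, zero_smul]
  have hmem : ∀ y, (R₀ y, z₀ • R₀ y - y + B (R₀ y)) ∈ A.graph := fun y => by
    rw [hA, add_sub_cancel_right]
    exact r1 y
  -- Fredholm alternative: if `T y = y`, then `R₀ y` lies in the trivial kernel above, and `R₀ y =
  -- 0` gives `y = T y = 0`.
  have hunit : IsUnit (1 - T) := by
    rcases hT.hasEigenvalue_or_mem_resolventSet (one_ne_zero (α := ℂ)) with h | h
    · exfalso
      obtain ⟨y, hy⟩ := h.exists_hasEigenvector
      have hTy : T y = y := by simpa using hy.apply_eq_smul
      have h0 : R₀ y = 0 := by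
        refine hinj _ ?_
        refine mem_graph_of_eq (hmem y) rfl ?_
        have : y = B (R₀ y) - ψ (R₀ y) • g := (hTx y).symm.trans hTy |>.symm
        rw [eq_sub_iff_add_eq] at this
        rw [← this]; abel
      refine hy.2 ?_
      rw [← hTy, hTx, h0]; simp
    · have : IsUnit (algebraMap ℂ (E →L[ℂ] E) 1 - T) := h
      simpa using this
  set N := Ring.inverse (1 - T)
  have n1 : ∀ y, N y - T (N y) = y := fun y => by
    simpa using congrArg (fun X : E →L[ℂ] E => X y) (Ring.mul_inverse_cancel _ hunit)
  -- `S₁` is the inverse of `z₀ - A + ψ(·) g`; it fixes `g`, since that operator does.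
  set S₁ : E →L[ℂ] E := R₀ * N
  have s1 : ∀ y, (S₁ y, z₀ • S₁ y - y + ψ (S₁ y) • g) ∈ A.graph := fun y => by
    refine mem_graph_of_eq (hmem (N y)) rfl ?_
    change z₀ • R₀ (N y) - y + ψ (R₀ (N y)) • g = z₀ • R₀ (N y) - N y + B (R₀ (N y))
    nth_rewrite 2 [← n1 y]
    rw [hTx]; abel
  have s2 : ∀ x y, (x, y) ∈ A.graph → S₁ (z₀ • x - y + ψ x • g) = x := fun x y hxy => by
    rw [← sub_eq_zero]
    refine hinj _ ?_
    refine mem_graph_of_eq (A.graph.sub_mem (s1 (z₀ • x - y + ψ x • g)) hxy) rfl ?_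
    dsimp only; rw [map_sub ψ, smul_sub, sub_smul]; abel
  set φ : E →L[ℂ] ℂ := ψ ∘L S₁
  have hφ : ∀ y, φ y = ψ (S₁ y) := fun y => rfl
  have s3 : S₁ g = g := by
    have := s2 _ _ hg
    rwa [sub_self, zero_add, hψ, one_smul] at this
  have hφg : φ g = 1 := by rw [hφ, s3, hψ]
  -- The spectral projection complementary to `g`; compressing `S₁` by it gives the reduced
  -- resolvent.
  set Q : E →L[ℂ] E := 1 - φ.smulRight g
  have hQ : ∀ y, Q y = y - φ y • g := fun y => rfl
  have hφQ : ∀ y, φ (Q y) = 0 := fun y => by rw [hQ, map_sub, map_smul, hφg]; simp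
  refine ⟨φ, Q * S₁ * Q, hφg, hg, fun y => ?_, fun x y hxy => ?_, fun x => hφQ _⟩
  · change (Q (S₁ (Q y)), z₀ • Q (S₁ (Q y)) - Q y) ∈ A.graph
    rw [hQ (S₁ (Q y))]
    have h1 := s1 (Q y)
    rw [← hφ, hφQ, zero_smul, add_zero] at h1
    refine mem_graph_of_eq (A.graph.sub_mem h1 (A.graph.smul_mem (φ (S₁ (Q y))) hg)) rfl ?_
    rw [Prod.smul_snd, smul_sub, smul_comm]; dsimp only; abel
  · change Q (S₁ (Q (z₀ • x - y))) = Q x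
    have h1 : S₁ (z₀ • x - y) = x - ψ x • g := by
      have := s2 x y hxy
      rw [map_add, map_smul, s3] at this
      exact eq_sub_of_add_eq this
    have h2 : φ (z₀ • x - y) = 0 := by rw [hφ, h1, map_sub, map_smul, hψ]; simp
    have h3 : Q g = 0 := by rw [hQ, hφg, one_smul, sub_self]
    rw [hQ (z₀ • x - y), h2, zero_smul, sub_zero, h1, map_sub, map_smul, h3, smul_zero, sub_zero]

end Abstract

/-! ### Calculus of the primitive and of `K` on `[0,1]` -/

section Primitive

/-- The primitive `ρ ↦ ∫₀^ρ f(s) ds`. -/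
def primitive (f : ℝ → ℂ) (ρ : ℝ) : ℂ := ∫ s in (0 : ℝ)..ρ, f s

theorem primitive_zero_right (f : ℝ → ℂ) : primitive f 0 = 0 := by simp [primitive]

theorem K_zero_right (f : ℝ → ℂ) : K f 0 = 0 := by simp [K]

theorem K_eq_primitive (f : ℝ → ℂ) : K f = primitive fun s => s • f s := rfl

theorem fn₂_eq_primitive (u : H) : fn₂ u = primitive u.1.snd := rfl

theorem primitive_congr {f g : ℝ → ℂ} (h : f =ᵐ[μ] g) {ρ : ℝ} (hρ : ρ ∈ I) :
    primitive f ρ = primitive g ρ := by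
  rw [primitive, primitive, intervalIntegral.integral_of_le hρ.1,
    intervalIntegral.integral_of_le hρ.1]
  exact integral_congr_ae (ae_restrict_of_ae_restrict_of_subset (Ioc_subset_Ioc_right hρ.2) h)

theorem ae_of_Ioc {f g : ℝ → ℂ} (h : ∀ ρ ∈ Ioc (0 : ℝ) 1, f ρ = g ρ) : f =ᵐ[μ] g :=
  (ae_restrict_iff' measurableSet_Ioc).2 (ae_of_all _ h)

theorem integrableOn_of_continuousOn {f : ℝ → ℂ} (hf : ContinuousOn f I) :
    IntegrableOn f (Ioc 0 1) :=
  hf.integrableOn_Icc.mono_set Ioc_subset_Icc_self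

theorem continuousOn_primitive {f : ℝ → ℂ} (hf : IntegrableOn f (Ioc 0 1)) :
    ContinuousOn (primitive f) I := by
  have h := intervalIntegral.continuousOn_primitive_interval (f := f) (μ := volume) (a := 0) (b := 1)
    (by rw [uIcc_of_le zero_le_one]; exact (integrableOn_Icc_iff_integrableOn_Ioc).2 hf)
  rwa [uIcc_of_le zero_le_one] at h

theorem continuousOn_K {f : ℝ → ℂ} (hf : IntegrableOn f (Ioc 0 1)) : ContinuousOn (K f) I :=
  continuousOn_primitive (integrableOn_smul hf)

theorem hasDerivWithinAt_primitive {f : ℝ → ℂ} (hf : ContinuousOn f I) {ρ : ℝ} (hρ : ρ ∈ I) :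
    HasDerivWithinAt (primitive f) (f ρ) I ρ := by
  have : Fact (ρ ∈ Icc (0 : ℝ) 1) := ⟨hρ⟩
  exact intervalIntegral.integral_hasDerivWithinAt_right
    (intervalIntegrable_of (integrableOn_of_continuousOn hf) hρ)
    (hf.stronglyMeasurableAtFilter_nhdsWithin measurableSet_Icc ρ) (hf ρ hρ)

theorem hasDerivWithinAt_K {f : ℝ → ℂ} (hf : ContinuousOn f I) {ρ : ℝ} (hρ : ρ ∈ I) :
    HasDerivWithinAt (K f) (ρ • f ρ) I ρ :=
  hasDerivWithinAt_primitive (f := fun s => s • f s) (continuousOn_id.smul hf) hρ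

theorem derivWithin_of_hasDerivWithinAt {f : ℝ → ℂ} {f' : ℂ} {ρ : ℝ} (hρ : ρ ∈ I)
    (h : HasDerivWithinAt f f' I ρ) : derivWithin f I ρ = f' :=
  h.derivWithin (uniqueDiffOn_Icc one_pos ρ hρ)

theorem contDiffOn_primitive {f : ℝ → ℂ} (hf : ContDiffOn ℝ ∞ f I) :
    ContDiffOn ℝ ∞ (primitive f) I := by
  have h : ∀ ρ ∈ I, HasDerivWithinAt (primitive f) (f ρ) I ρ := fun ρ hρ =>
    hasDerivWithinAt_primitive hf.continuousOn hρ
  refine (contDiffOn_infty_iff_derivWithin (uniqueDiffOn_Icc one_pos)).2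
    ⟨fun ρ hρ => (h ρ hρ).differentiableWithinAt, ?_⟩
  exact hf.congr fun ρ hρ => derivWithin_of_hasDerivWithinAt hρ (h ρ hρ)

theorem contDiffOn_K {f : ℝ → ℂ} (hf : ContDiffOn ℝ ∞ f I) : ContDiffOn ℝ ∞ (K f) I :=
  contDiffOn_primitive (contDiffOn_id.smul hf)

theorem primitive_eq_of_hasDerivAt {f F : ℝ → ℂ} (hF : ContinuousOn F I)
    (h : ∀ ρ ∈ Ioo (0 : ℝ) 1, HasDerivAt F (f ρ) ρ) (hi : IntegrableOn f (Ioc 0 1))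
    (h0 : F 0 = 0) {ρ : ℝ} (hρ : ρ ∈ I) : primitive f ρ = F ρ := by
  rw [primitive, intervalIntegral.integral_eq_sub_of_hasDerivAt_of_le hρ.1
    (hF.mono (Icc_subset_Icc_right hρ.2)) (fun s hs => h s ⟨hs.1, hs.2.trans_le hρ.2⟩)
    (intervalIntegrable_of hi hρ), h0, sub_zero]

theorem primitive_eq_of_hasDerivWithinAt {f F : ℝ → ℂ} (hf : ContinuousOn f I)
    (h : ∀ ρ ∈ I, HasDerivWithinAt F (f ρ) I ρ) (h0 : F 0 = 0) {ρ : ℝ} (hρ : ρ ∈ I) :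
    primitive f ρ = F ρ :=
  primitive_eq_of_hasDerivAt (fun s hs => (h s hs).continuousWithinAt)
    (fun s hs => (h s (Ioo_subset_Icc_self hs)).hasDerivAt (Icc_mem_nhds hs.1 hs.2))
    (integrableOn_of_continuousOn hf) h0 hρ

/-- The tool for the closed formulas below: an integral `K f` is evaluated by differentiating the
proposed answer, which replaces every integration by parts. -/
theorem K_eq_of_hasDerivWithinAt {f F : ℝ → ℂ} (hf : ContinuousOn f I)
    (h : ∀ ρ ∈ I, HasDerivWithinAt F (ρ • f ρ) I ρ) (h0 : F 0 = 0) {ρ : ℝ} (hρ : ρ ∈ I) :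
    K f ρ = F ρ :=
  primitive_eq_of_hasDerivWithinAt (continuousOn_id.smul hf) h h0 hρ

theorem norm_primitive_le_of_bound {f : ℝ → ℂ} {C : ℝ} (h : ∀ s ∈ I, ‖f s‖ ≤ C) {ρ : ℝ}
    (hρ : ρ ∈ I) : ‖primitive f ρ‖ ≤ C * ρ := by
  have := intervalIntegral.norm_integral_le_of_norm_le_const (a := 0) (b := ρ) (f := f) (C := C)
    fun s hs => by
      rw [uIoc_of_le hρ.1] at hs
      exact h s ⟨hs.1.le, hs.2.trans hρ.2⟩
  rwa [sub_zero, abs_of_nonneg hρ.1] at this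

theorem norm_K_le_of_bound {f : ℝ → ℂ} {C : ℝ} (h : ∀ s ∈ I, ‖f s‖ ≤ C) {ρ : ℝ}
    (hρ : ρ ∈ I) : ‖K f ρ‖ ≤ C := by
  have hC : 0 ≤ C := (norm_nonneg _).trans (h ρ hρ)
  have := norm_primitive_le_of_bound (f := fun s => s • f s) (C := C) (fun s hs => by
    rw [norm_smul, Real.norm_of_nonneg hs.1]
    exact (mul_le_of_le_one_left (norm_nonneg _) hs.2).trans (h s hs)) hρ
  exact this.trans (mul_le_of_le_one_right hC hρ.2)

instance : IsProbabilityMeasure μ := ⟨by simp⟩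

/-- `μ` has total mass 1, so the inclusion of `L²` in `L¹` is a contraction. -/
theorem integral_norm_le (f : L2) : ∫ s, ‖f s‖ ∂μ ≤ ‖f‖ := by
  have h1 := eLpNorm_le_eLpNorm_of_exponent_le (μ := μ) (p := 1) (q := 2) (by norm_num)
    (Lp.aestronglyMeasurable f)
  rw [Lp.norm_def, integral_norm_eq_lintegral_enorm (Lp.aestronglyMeasurable f),
    ← eLpNorm_one_eq_lintegral_enorm]
  exact ENNReal.toReal_mono (Lp.eLpNorm_ne_top f) h1

theorem norm_primitive_le (f : L2) {ρ : ℝ} (hρ : ρ ∈ I) : ‖primitive f ρ‖ ≤ ‖f‖ := by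
  refine le_trans ?_ (integral_norm_le f)
  rw [primitive, intervalIntegral.integral_of_le hρ.1]
  refine (norm_integral_le_integral_norm _).trans ?_
  exact setIntegral_mono_set (integrableOn_L2 f).norm (ae_of_all _ fun _ => norm_nonneg _)
    (Ioc_subset_Ioc_right hρ.2).eventuallyLE

theorem norm_K_le (f : L2) {ρ : ℝ} (hρ : ρ ∈ I) : ‖K f ρ‖ ≤ ‖f‖ := by
  refine le_trans ?_ (integral_norm_le f)
  rw [K, intervalIntegral.integral_of_le hρ.1]
  refine (norm_integral_le_integral_norm _).trans ?_
  refine le_trans ?_ (setIntegral_mono_set (integrableOn_L2 f).norm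
    (ae_of_all _ fun _ => norm_nonneg _) (Ioc_subset_Ioc_right hρ.2).eventuallyLE)
  refine setIntegral_mono_on ((integrableOn_smul (integrableOn_L2 f)).mono_set
    (Ioc_subset_Ioc_right hρ.2)).norm ((integrableOn_L2 f).mono_set
    (Ioc_subset_Ioc_right hρ.2)).norm measurableSet_Ioc fun s hs => ?_
  rw [norm_smul, Real.norm_of_nonneg hs.1.le]
  exact mul_le_of_le_one_left (norm_nonneg _) (hs.2.trans hρ.2)

/-- By Lebesgue differentiation the primitive has derivative `f` almost everywhere. -/
theorem ae_eq_zero_of_primitive_eq_zero {f : ℝ → ℂ} (hf : IntegrableOn f (Ioc 0 1))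
    (h : ∀ ρ ∈ I, primitive f ρ = 0) : f =ᵐ[μ] 0 := by
  have hi : IntervalIntegrable f volume 0 1 :=
    (intervalIntegrable_iff_integrableOn_Ioc_of_le zero_le_one).2 hf
  have h1 : ∀ᵐ x : ℝ, x ≠ 1 := by simp [ae_iff, measure_singleton]
  refine (ae_restrict_iff' measurableSet_Ioc).2 ?_
  filter_upwards [hi.ae_hasDerivAt_integral, h1] with x hx hx1 hx01
  have hd := hx (by rw [uIcc_of_le zero_le_one]; exact Ioc_subset_Icc_self hx01) 0 (by simp)
  have hz : HasDerivAt (fun x => ∫ t in (0 : ℝ)..x, f t) 0 x := by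
    refine (hasDerivAt_const x (0 : ℂ)).congr_of_eventuallyEq ?_
    filter_upwards [Icc_mem_nhds hx01.1 (lt_of_le_of_ne hx01.2 hx1)] with y hy using h y hy
  exact hd.unique hz

theorem ae_eq_zero_of_K_eq_zero {f : ℝ → ℂ} (hf : IntegrableOn f (Ioc 0 1))
    (h : ∀ ρ ∈ I, K f ρ = 0) : f =ᵐ[μ] 0 := by
  have h1 := ae_eq_zero_of_primitive_eq_zero (integrableOn_smul hf) h
  filter_upwards [h1, ae_restrict_mem measurableSet_Ioc] with s hs hs0
  exact (smul_eq_zero.1 hs).resolve_left hs0.1.ne'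

end Primitive

/-! ### Continuity of point evaluations on the Hilbert space -/

section Evaluation

theorem norm_fst_le' (u : H) : ‖u.1.fst‖ ≤ ‖u‖ := by
  apply WithLp.norm_fst_le

theorem norm_snd_le' (u : H) : ‖u.1.snd‖ ≤ ‖u‖ := by
  apply WithLp.norm_snd_le

theorem continuous_of_add_of_bound {F : H → ℂ} (hadd : ∀ u v, F (u + v) = F u + F v) {C : ℝ}
    (hC : ∀ u, ‖F u‖ ≤ C * ‖u‖) : Continuous F :=
  AddMonoidHomClass.continuous_of_bound (AddMonoidHom.mk' F hadd) C hC

theorem norm_fn₂_le (u : H) {ρ : ℝ} (hρ : ρ ∈ I) : ‖fn₂ u ρ‖ ≤ ‖u‖ :=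
  (norm_primitive_le u.1.snd hρ).trans (norm_snd_le' u)

theorem norm_fn₁_le (u : H) {ρ : ℝ} (hρ : ρ ∈ I) : ‖fn₁ u ρ‖ ≤ ‖u‖ :=
  norm_K_le_of_bound (fun _ hs => (norm_K_le u.1.fst hs).trans (norm_fst_le' u)) hρ

theorem continuous_fn₁ {ρ : ℝ} (hρ : ρ ∈ I) : Continuous fun u : H => fn₁ u ρ :=
  continuous_of_add_of_bound (C := 1) (fun u v => fn₁_add u v hρ)
    fun u => by rw [one_mul]; exact norm_fn₁_le u hρ

theorem continuous_fn₂ {ρ : ℝ} (hρ : ρ ∈ I) : Continuous fun u : H => fn₂ u ρ :=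
  continuous_of_add_of_bound (C := 1) (fun u v => fn₂_add u v hρ)
    fun u => by rw [one_mul]; exact norm_fn₂_le u hρ

theorem K_fst_add (u v : H) {ρ : ℝ} (hρ : ρ ∈ I) :
    K (u + v).1.fst ρ = K u.1.fst ρ + K v.1.fst ρ := by
  rw [← K_add (integrableOn_L2 _) (integrableOn_L2 _) hρ]
  exact K_congr (Lp.coeFn_add u.1.fst v.1.fst) hρ

theorem continuous_K_fst {ρ : ℝ} (hρ : ρ ∈ I) : Continuous fun u : H => K u.1.fst ρ :=
  continuous_of_add_of_bound (C := 1) (fun u v => K_fst_add u v hρ)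
    fun u => by rw [one_mul]; exact (norm_K_le u.1.fst hρ).trans (norm_fst_le' u)

theorem K_fn₂_add (u v : H) {ρ : ℝ} (hρ : ρ ∈ I) :
    K (fn₂ (u + v)) ρ = K (fn₂ u) ρ + K (fn₂ v) ρ := by
  rw [← K_add (integrableOn_fn₂ _) (integrableOn_fn₂ _) hρ]
  exact K_congr (ae_of_I fun s hs => fn₂_add u v hs) hρ

theorem continuous_K_fn₂ {ρ : ℝ} (hρ : ρ ∈ I) : Continuous fun u : H => K (fn₂ u) ρ :=
  continuous_of_add_of_bound (C := 1) (fun u v => K_fn₂_add u v hρ)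
    fun u => by rw [one_mul]; exact norm_K_le_of_bound (fun _ hs => norm_fn₂_le u hs) hρ

theorem continuousOn_fn₂ (u : H) : ContinuousOn (fn₂ u) I :=
  continuousOn_primitive (integrableOn_L2 _)

theorem ext_of_coords {u v : H} (h1 : u.1.fst = v.1.fst) (h2 : u.1.snd = v.1.snd) : u = v := by
  refine Subtype.ext ?_
  apply WithLp.ofLp_injective
  exact Prod.ext h1 h2

/-- Elements of the completion are determined by their functions. For the first one `K` is stripped
twice: `K u.1.fst` vanishes almost everywhere, hence everywhere by continuity, and then so does its
integrand. -/
theorem eq_zero_of_fn {u : H} (h1 : ∀ ρ ∈ I, fn₁ u ρ = 0) (h2 : ∀ ρ ∈ I, fn₂ u ρ = 0) :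
    u = 0 := by
  refine ext_of_coords ?_ ?_
  · have e := ae_eq_zero_of_K_eq_zero (integrableOn_K (integrableOn_L2 u.1.fst)) h1
    have hc := continuousOn_K (integrableOn_L2 u.1.fst)
    have h0 : ∀ ρ ∈ I, K u.1.fst ρ = 0 := by
      have e' : K u.1.fst =ᵐ[volume.restrict I] 0 := by
        rw [← restrict_Ioc_eq_restrict_Icc]; exact e
      exact Measure.eqOn_Icc_of_ae_eq volume zero_ne_one e' hc continuousOn_const
    exact Lp.ext ((ae_eq_zero_of_K_eq_zero (integrableOn_L2 _) h0).trans (Lp.coeFn_zero _ _ _).symm)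
  · exact Lp.ext ((ae_eq_zero_of_primitive_eq_zero (integrableOn_L2 _) h2).trans
      (Lp.coeFn_zero _ _ _).symm)

theorem fn₁_sub (u v : H) {ρ : ℝ} (hρ : ρ ∈ I) : fn₁ (u - v) ρ = fn₁ u ρ - fn₁ v ρ := by
  rw [eq_sub_iff_add_eq, ← fn₁_add _ _ hρ, sub_add_cancel]

theorem fn₂_sub (u v : H) {ρ : ℝ} (hρ : ρ ∈ I) : fn₂ (u - v) ρ = fn₂ u ρ - fn₂ v ρ := by
  rw [eq_sub_iff_add_eq, ← fn₂_add _ _ hρ, sub_add_cancel]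

theorem ext_of_fn {u v : H} (h1 : ∀ ρ ∈ I, fn₁ u ρ = fn₁ v ρ) (h2 : ∀ ρ ∈ I, fn₂ u ρ = fn₂ v ρ) :
    u = v := by
  rw [← sub_eq_zero]
  exact eq_zero_of_fn (fun ρ hρ => by rw [fn₁_sub _ _ hρ, h1 ρ hρ, sub_self])
    (fun ρ hρ => by rw [fn₂_sub _ _ hρ, h2 ρ hρ, sub_self])

end Evaluation

/-! ### Vanishing moments and the zero function -/

section Moments

theorem integral_eval_smul_eq_zero {f : L2} {α β : ℝ} (hβ : β ≠ 0)
    (h : ∀ k : ℕ, ∫ ρ, (α + β * ρ) ^ k • f ρ ∂μ = 0) (P : Polynomial ℝ) :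
    ∫ ρ, P.eval ρ • f ρ ∂μ = 0 := by
  have hi : ∀ k : ℕ, Integrable (fun ρ => (α + β * ρ) ^ k • f ρ) μ := fun k => by
    have h1 : IntegrableOn (fun ρ => (α + β * ρ) ^ k • f ρ) (Icc 0 1) :=
      ((integrableOn_Icc_iff_integrableOn_Ioc).2 (integrableOn_L2 f)).continuousOn_smul
        (by fun_prop) isCompact_Icc
    exact h1.mono_set Ioc_subset_Icc_self
  set Q := P.comp (Polynomial.C β⁻¹ * (Polynomial.X - Polynomial.C α))
  have e : ∀ ρ, P.eval ρ = Q.eval (α + β * ρ) := fun ρ => by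
    simp [Q, hβ]
  simp only [e, Polynomial.eval_eq_sum_range, Finset.sum_smul, mul_smul]
  have hi' : ∀ k ∈ Finset.range (Q.natDegree + 1),
      Integrable (fun ρ => Q.coeff k • (α + β * ρ) ^ k • f ρ) μ := fun k _ => by
    have := (hi k).smul (Q.coeff k)
    exact this
  rw [integral_finsetSum _ hi']
  refine Finset.sum_eq_zero fun k _ => ?_
  rw [integral_smul, h k, smul_zero]

/-- Powers of a nonconstant affine function span the polynomials. Weierstrass approximation passes
to continuous test functions, and the fundamental lemma of the calculus of variations concludes. -/
theorem eq_zero_of_moments {f : L2} {α β : ℝ} (hβ : β ≠ 0)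
    (h : ∀ k : ℕ, ∫ ρ, (α + β * ρ) ^ k • f ρ ∂μ = 0) : f = 0 := by
  have hf := integrableOn_L2 f
  have key : ∀ φ : ℝ → ℝ, Continuous φ → ∫ ρ, φ ρ • f ρ ∂μ = 0 := fun φ hφ => by
    have bound : ∀ ε > 0, ‖∫ ρ, φ ρ • f ρ ∂μ‖ ≤ ε * ∫ ρ, ‖f ρ‖ ∂μ := fun ε hε => by
      obtain ⟨P, hP⟩ := exists_polynomial_near_of_continuousOn 0 1 φ hφ.continuousOn ε hε
      have hi : ∀ ψ : ℝ → ℝ, Continuous ψ → Integrable (fun ρ => ψ ρ • f ρ) μ := fun ψ hψ => by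
        have h1 : IntegrableOn (fun ρ => ψ ρ • f ρ) (Icc 0 1) :=
          ((integrableOn_Icc_iff_integrableOn_Ioc).2 hf).continuousOn_smul
            hψ.continuousOn isCompact_Icc
        exact h1.mono_set Ioc_subset_Icc_self
      have e : ∫ ρ, φ ρ • f ρ ∂μ = ∫ ρ, (φ ρ • f ρ - P.eval ρ • f ρ) ∂μ := by
        rw [integral_sub (hi φ hφ) (hi _ P.continuous), integral_eval_smul_eq_zero hβ h P, sub_zero]
      rw [e, ← integral_const_mul]
      refine norm_integral_le_of_norm_le (hf.norm.const_mul ε) ?_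
      filter_upwards [ae_restrict_mem measurableSet_Ioc] with ρ hρ
      rw [← sub_smul, norm_smul, Real.norm_eq_abs, abs_sub_comm]
      exact mul_le_mul_of_nonneg_right (hP ρ (Ioc_subset_Icc_self hρ)).le (norm_nonneg _)
    have hlim : Filter.Tendsto (fun ε : ℝ => ε * ∫ ρ, ‖f ρ‖ ∂μ) (nhdsWithin 0 (Ioi 0)) (nhds 0) := by
      have : Continuous fun ε : ℝ => ε * ∫ ρ, ‖f ρ‖ ∂μ := by fun_prop
      simpa using (this.tendsto 0).mono_left nhdsWithin_le_nhds
    have := ge_of_tendsto hlim (by filter_upwards [self_mem_nhdsWithin] with ε hε using bound ε hε)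
    exact norm_le_zero_iff.1 this
  have hloc : LocallyIntegrableOn f (Ioo 0 1) volume :=
    (hf.mono_set Ioo_subset_Ioc_self).locallyIntegrableOn
  have h1 := isOpen_Ioo.ae_eq_zero_of_integral_contDiff_smul_eq_zero hloc
    fun φ hφ _ hs => by
      rw [← key φ hφ.continuous]
      refine (setIntegral_eq_integral_of_forall_compl_eq_zero fun x hx => ?_).symm
      have : φ x = 0 := image_eq_zero_of_notMem_tsupport fun hx' =>
        hx (Ioo_subset_Ioc_self (hs hx'))
      rw [this, zero_smul]
  have h2 : ∀ᵐ x : ℝ, x ≠ 1 := by simp [ae_iff, measure_singleton]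
  refine Lp.ext (Filter.EventuallyEq.trans ?_ (Lp.coeFn_zero _ _ _).symm)
  refine (ae_restrict_iff' measurableSet_Ioc).2 ?_
  filter_upwards [h1, h2] with x hx hx1 hx01
  exact hx ⟨hx01.1, lt_of_le_of_ne hx01.2 hx1⟩

theorem inner_eq_integral {p f : L2} {r : ℝ → ℝ} (hp : p =ᵐ[μ] fun ρ => (r ρ : ℂ)) :
    inner ℂ p f = ∫ ρ, r ρ • f ρ ∂μ := by
  rw [L2.inner_def]
  refine integral_congr_ae ?_
  filter_upwards [hp] with ρ hρ
  rw [hρ]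
  simp [mul_comm]

end Moments

/-! ### The free operator as a first-order system in `a = D² u₁`, `b = u₂'` -/

section SmoothPair

theorem hasDerivWithinAt_ofReal (s : Set ℝ) (x : ℝ) :
    HasDerivWithinAt (fun ρ : ℝ => (ρ : ℂ)) 1 s x :=
  Complex.ofRealCLM.hasDerivAt.hasDerivWithinAt

theorem hasDerivWithinAt_ofReal_pow (n : ℕ) (s : Set ℝ) (x : ℝ) :
    HasDerivWithinAt (fun ρ : ℝ => (ρ : ℂ) ^ n) (n * (x : ℂ) ^ (n - 1)) s x := by
  simpa using (hasDerivWithinAt_ofReal s x).fun_pow n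

theorem ContDiffOn.derivWithin_I {f : ℝ → ℂ} (hf : ContDiffOn ℝ ∞ f I) :
    ContDiffOn ℝ ∞ (derivWithin f I) I :=
  contDiffOn_derivWithin_of hf (by simp)

theorem hasDerivWithinAt_of_smooth {f : ℝ → ℂ} (hf : ContDiffOn ℝ ∞ f I) {ρ : ℝ} (hρ : ρ ∈ I) :
    HasDerivWithinAt f (derivWithin f I ρ) I ρ :=
  hasDerivWithinAt_of (hf.of_le (by exact_mod_cast le_top)) hρ

theorem hasDerivWithinAt_KK {a : ℝ → ℂ} (ha : IntegrableOn a (Ioc 0 1)) {ρ : ℝ} (hρ : ρ ∈ I) :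
    HasDerivWithinAt (K (K a)) (ρ • K a ρ) I ρ :=
  hasDerivWithinAt_K (continuousOn_K ha) hρ

theorem iteratedDerivWithin_succ_of {f f' : ℝ → ℂ}
    (h : ∀ ρ ∈ I, HasDerivWithinAt f (f' ρ) I ρ) (k : ℕ) :
    iteratedDerivWithin (k + 1) f I 0 = iteratedDerivWithin k f' I 0 := by
  rw [iteratedDerivWithin_succ']
  exact iteratedDerivWithin_congr
    (fun ρ hρ => derivWithin_of_hasDerivWithinAt hρ (h ρ hρ)) (by simp)

/-- The fourth derivative shows that the extra condition in `Dom₀` amounts to the boundary condition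
`a 0 = 0`. -/
theorem iteratedDerivWithin_KK {a : ℝ → ℂ} (ha : ContDiffOn ℝ ∞ a I) :
    (∀ k ≤ 3, iteratedDerivWithin k (K (K a)) I 0 = 0) ∧
      iteratedDerivWithin 4 (K (K a)) I 0 = 3 * a 0 := by
  have hai := integrableOn_of_continuousOn ha.continuousOn
  have ha' := fun {ρ : ℝ} (hρ : ρ ∈ I) => hasDerivWithinAt_of_smooth ha hρ
  have ha'' := fun {ρ : ℝ} (hρ : ρ ∈ I) =>
    hasDerivWithinAt_of_smooth (ContDiffOn.derivWithin_I ha) hρ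
  set a' := derivWithin a I
  set a'' := derivWithin a' I
  have h1 : ∀ ρ ∈ I, HasDerivWithinAt (K (K a)) ((ρ : ℂ) * K a ρ) I ρ := fun ρ hρ =>
    hasDerivWithinAt_KK hai hρ
  have h2 : ∀ ρ ∈ I, HasDerivWithinAt (fun ρ : ℝ => (ρ : ℂ) * K a ρ)
      (K a ρ + (ρ : ℂ) ^ 2 * a ρ) I ρ := fun ρ hρ => by
    refine HasDerivWithinAt.congr_deriv ((hasDerivWithinAt_ofReal I ρ).mul (hasDerivWithinAt_K ha.continuousOn hρ)) ?_
    rw [Complex.real_smul]; ring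
  have h3 : ∀ ρ ∈ I, HasDerivWithinAt (fun ρ : ℝ => K a ρ + (ρ : ℂ) ^ 2 * a ρ)
      (3 * (ρ : ℂ) * a ρ + (ρ : ℂ) ^ 2 * a' ρ) I ρ := fun ρ hρ => by
    refine HasDerivWithinAt.congr_deriv ((hasDerivWithinAt_K ha.continuousOn hρ).add
      ((hasDerivWithinAt_ofReal_pow 2 I ρ).mul (ha' hρ))) ?_
    rw [Complex.real_smul]; push_cast; ring
  have h4 : ∀ ρ ∈ I, HasDerivWithinAt (fun ρ : ℝ => 3 * (ρ : ℂ) * a ρ + (ρ : ℂ) ^ 2 * a' ρ)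
      (3 * a ρ + 5 * (ρ : ℂ) * a' ρ + (ρ : ℂ) ^ 2 * a'' ρ) I ρ := fun ρ hρ => by
    refine HasDerivWithinAt.congr_deriv ((((hasDerivWithinAt_ofReal I ρ).const_mul 3).mul (ha' hρ)).add
      ((hasDerivWithinAt_ofReal_pow 2 I ρ).mul (ha'' hρ))) ?_
    push_cast; ring
  refine ⟨fun k hk => ?_, ?_⟩
  · interval_cases k
    · simp [K_zero_right]
    · rw [iteratedDerivWithin_succ_of h1]; simp
    · rw [iteratedDerivWithin_succ_of h1, iteratedDerivWithin_succ_of h2]; simp [K_zero_right]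
    · rw [iteratedDerivWithin_succ_of h1, iteratedDerivWithin_succ_of h2,
        iteratedDerivWithin_succ_of h3]
      simp
  · rw [iteratedDerivWithin_succ_of h1, iteratedDerivWithin_succ_of h2,
      iteratedDerivWithin_succ_of h3, iteratedDerivWithin_succ_of h4]
    simp

/-- The pair `(K² a, ∫₀ b)`, whose coordinates in `L²(0,1) × L²(0,1)` are `a` and `b`. -/
def smoothPair (a b : ℝ → ℂ) (ha : ContDiffOn ℝ ∞ a I) (hb : ContDiffOn ℝ ∞ b I) : PreH :=
  ⟨(K (K a), primitive b), (contDiffOn_K (contDiffOn_K ha)).of_le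
    (WithTop.coe_le_coe.2 (le_top : ((4 : ℕ) : ℕ∞) ≤ ⊤)),
    (contDiffOn_primitive hb).of_le (by exact_mod_cast le_top),
    (iteratedDerivWithin_KK ha).1, primitive_zero_right b⟩

variable {a b : ℝ → ℂ} (ha : ContDiffOn ℝ ∞ a I) (hb : ContDiffOn ℝ ∞ b I)

theorem smoothPair_mem_Dom₀ (h0 : a 0 = 0) : (smoothPair a b ha hb).1 ∈ Dom₀ := by
  refine ⟨contDiffOn_K (contDiffOn_K ha), contDiffOn_primitive hb, fun k hk => ?_,
    primitive_zero_right b⟩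
  rcases Nat.lt_succ_iff_lt_or_eq.1 (Nat.lt_succ_of_le hk) with h | rfl
  · exact (iteratedDerivWithin_KK ha).1 k (by omega)
  · exact (iteratedDerivWithin_KK ha).2.trans (by rw [h0, mul_zero])

theorem D_KK {a : ℝ → ℂ} (ha : IntegrableOn a (Ioc 0 1)) {ρ : ℝ} (hρ : ρ ∈ I) :
    D (K (K a)) ρ = K a ρ := by
  rw [D, derivWithin_of_hasDerivWithinAt hρ (hasDerivWithinAt_KK ha hρ)]
  rcases eq_or_ne ρ 0 with rfl | h
  · simp [K_zero_right]
  · rw [smul_smul, inv_mul_cancel₀ h, one_smul]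

theorem DD_KK {a : ℝ → ℂ} (ha : ContinuousOn a I) {ρ : ℝ} (hρ : ρ ∈ Ioc (0 : ℝ) 1) :
    D (D (K (K a))) ρ = a ρ := by
  have hI := Ioc_subset_Icc_self hρ
  have e : EqOn (D (K (K a))) (K a) I := fun s hs => D_KK (integrableOn_of_continuousOn ha) hs
  rw [D, derivWithin_congr e (e hI), derivWithin_of_hasDerivWithinAt hI (hasDerivWithinAt_K ha hI),
    smul_smul, inv_mul_cancel₀ hρ.1.ne', one_smul]

theorem toH_fst (u : PreH) : (toH u).1.fst =ᵐ[μ] D (D u.1.1) := (memLp_DD u.2).coeFn_toLp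

theorem toH_snd (u : PreH) : (toH u).1.snd =ᵐ[μ] derivWithin u.1.2 I := (memLp_deriv u.2).coeFn_toLp

theorem toH_smoothPair_fst : (toH (smoothPair a b ha hb)).1.fst =ᵐ[μ] a :=
  (toH_fst _).trans (ae_of_Ioc fun _ hρ => DD_KK ha.continuousOn hρ)

theorem toH_smoothPair_snd : (toH (smoothPair a b ha hb)).1.snd =ᵐ[μ] b :=
  (toH_snd _).trans (ae_of_I fun _ hρ => derivWithin_of_hasDerivWithinAt hρ
    (hasDerivWithinAt_primitive hb.continuousOn hρ))

/-- First coordinate of the free operator in terms of the coordinates `a = D² u₁`, `b = u₂'`. -/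
def coord₁ (a b : ℝ → ℂ) (ρ : ℝ) : ℂ := -((ρ : ℂ) * derivWithin a I ρ) + derivWithin b I ρ - 2 * a ρ

/-- Second coordinate of the free operator in terms of the coordinates `a = D² u₁`, `b = u₂'`. -/
def coord₂ (a b : ℝ → ℂ) (ρ : ℝ) : ℂ := derivWithin a I ρ - (ρ : ℂ) * derivWithin b I ρ - 2 * b ρ

include ha hb in
theorem contDiffOn_coord₁ : ContDiffOn ℝ ∞ (coord₁ a b) I := by
  have h : ContDiffOn ℝ ∞ (fun ρ : ℝ => (ρ : ℂ)) I := Complex.ofRealCLM.contDiff.contDiffOn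
  exact (((h.mul (ContDiffOn.derivWithin_I ha)).neg).add (ContDiffOn.derivWithin_I hb)).sub
    (contDiffOn_const.mul ha)

include ha hb in
theorem contDiffOn_coord₂ : ContDiffOn ℝ ∞ (coord₂ a b) I := by
  have h : ContDiffOn ℝ ∞ (fun ρ : ℝ => (ρ : ℂ)) I := Complex.ofRealCLM.contDiff.contDiffOn
  exact ((ContDiffOn.derivWithin_I ha).sub (h.mul (ContDiffOn.derivWithin_I hb))).sub
    (contDiffOn_const.mul hb)

include ha hb in
theorem primitive_coord₂ (h0 : a 0 = 0) {ρ : ℝ} (hρ : ρ ∈ I) :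
    primitive (coord₂ a b) ρ = a ρ - ρ * b ρ - primitive b ρ := by
  refine primitive_eq_of_hasDerivWithinAt (F := fun ρ : ℝ => a ρ - ρ * b ρ - primitive b ρ)
    (contDiffOn_coord₂ ha hb).continuousOn (fun ρ hρ => ?_) (by simp [primitive_zero_right, h0]) hρ
  refine HasDerivWithinAt.congr_deriv (((hasDerivWithinAt_of_smooth ha hρ).sub
    ((hasDerivWithinAt_ofReal I ρ).mul (hasDerivWithinAt_of_smooth hb hρ))).sub
    (hasDerivWithinAt_primitive hb.continuousOn hρ)) ?_
  rw [coord₂]; ring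

/-- Conjugation by the coordinates turns the nonlocal operator into the local system `coord₁`,
`coord₂`. The boundary condition enters in integrating `coord₂`, whose term `a'` would otherwise
leave `-a 0` behind. -/
theorem smoothPair_mem_graph₀ (h0 : a 0 = 0) :
    (toH (smoothPair a b ha hb), toH (smoothPair (coord₁ a b) (coord₂ a b)
      (contDiffOn_coord₁ ha hb) (contDiffOn_coord₂ ha hb))) ∈ graph₀ := by
  have hai := integrableOn_of_continuousOn ha.continuousOn
  have ca := contDiffOn_coord₁ ha hb
  have ha' := fun {ρ} (hρ : ρ ∈ I) => hasDerivWithinAt_of_smooth ha hρ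
  have hb' := fun {ρ} (hρ : ρ ∈ I) => hasDerivWithinAt_of_smooth hb hρ
  have hP := fun {ρ} (hρ : ρ ∈ I) => hasDerivWithinAt_primitive hb.continuousOn hρ
  have hKP := fun {ρ} (hρ : ρ ∈ I) =>
    hasDerivWithinAt_K (contDiffOn_primitive hb).continuousOn hρ
  have hx := fun ρ => hasDerivWithinAt_ofReal I ρ
  have e1 : ∀ ρ ∈ I, K (coord₁ a b) ρ = -((ρ : ℂ) ^ 2 * a ρ) + ρ * b ρ - primitive b ρ :=
    fun ρ hρ => by
      refine K_eq_of_hasDerivWithinAt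
        (F := fun ρ : ℝ => -((ρ : ℂ) ^ 2 * a ρ) + ρ * b ρ - primitive b ρ)
        ca.continuousOn (fun ρ hρ => ?_) (by simp [primitive_zero_right]) hρ
      refine HasDerivWithinAt.congr_deriv ((((hasDerivWithinAt_ofReal_pow 2 I ρ).mul (ha' hρ)).neg.add ((hx ρ).mul (hb' hρ))).sub (hP hρ)) ?_
      rw [Complex.real_smul, coord₁]; push_cast; ring
  have e2 : ∀ ρ ∈ I, K (K (coord₁ a b)) ρ =
      -((ρ : ℂ) ^ 2 * K a ρ) + 2 * K (K a) ρ + (ρ : ℂ) ^ 2 * primitive b ρ -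
        3 * K (primitive b) ρ := fun ρ hρ => by
    refine K_eq_of_hasDerivWithinAt (F := fun ρ : ℝ => -((ρ : ℂ) ^ 2 * K a ρ) + 2 * K (K a) ρ +
      (ρ : ℂ) ^ 2 * primitive b ρ - 3 * K (primitive b) ρ) (contDiffOn_K ca).continuousOn
      (fun ρ hρ => ?_) (by simp [K_zero_right]) hρ
    refine HasDerivWithinAt.congr_deriv (((((hasDerivWithinAt_ofReal_pow 2 I ρ).mul (hasDerivWithinAt_K ha.continuousOn hρ)).neg.add
      ((hasDerivWithinAt_KK hai hρ).const_mul 2)).add ((hasDerivWithinAt_ofReal_pow 2 I ρ).mul (hP hρ))).sub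
      ((hKP hρ).const_mul 3)) ?_
    rw [e1 ρ hρ]; simp only [Complex.real_smul]; push_cast; ring
  refine ⟨smoothPair a b ha hb, _, smoothPair_mem_Dom₀ ha hb h0, fun ρ hρ => ⟨?_, ?_⟩, rfl⟩
  · have hI := Ioc_subset_Icc_self hρ
    change K (K (coord₁ a b)) ρ = -(ρ • derivWithin (K (K a)) I ρ) + 2 * K (K a) ρ +
      ρ ^ 2 • primitive b ρ - 3 * K (primitive b) ρ
    rw [e2 ρ hI, derivWithin_of_hasDerivWithinAt hI (hasDerivWithinAt_KK hai hI)]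
    simp only [Complex.real_smul]; push_cast; ring
  · have hI := Ioc_subset_Icc_self hρ
    change primitive (coord₂ a b) ρ = D (D (K (K a))) ρ - ρ • derivWithin (primitive b) I ρ -
      primitive b ρ
    rw [primitive_coord₂ ha hb h0 hI, derivWithin_of_hasDerivWithinAt hI (hP hI), DD_KK ha.continuousOn hρ,
      Complex.real_smul]

end SmoothPair

/-! ### Closability of the free operator -/

section Closable

theorem K_fst_toH (u : PreH) {ρ : ℝ} (hρ : ρ ∈ I) : K (toH u).1.fst ρ = D u.1.1 ρ := by
  have h2 : ContDiffOn ℝ 2 u.1.1 I := u.2.1.of_le (by norm_num)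
  have hint : IntegrableOn (derivWithin (D u.1.1) I) (Ioc 0 1) := by
    refine (integrableOn_smul ((memLp_DD u.2).integrable (by norm_num))).congr
      (ae_of_Ioc fun s hs => ?_)
    change s • (s⁻¹ • derivWithin (D u.1.1) I s) = _
    rw [smul_smul, mul_inv_cancel₀ hs.1.ne', one_smul]
  rw [K_congr (toH_fst u) hρ, K_D (continuousOn_D u.2)
    (fun s hs => (hasDerivWithinAt_D h2 hs).differentiableWithinAt) hint hρ]
  simp [D]

theorem K_fn₂_toH (u : PreH) {ρ : ℝ} (hρ : ρ ∈ I) : K (fn₂ (toH u)) ρ = K u.1.2 ρ :=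
  K_congr (ae_of_I fun _ hs => fn₂_toH u hs) hρ

/-- Integrated form of the relation `v = L₀ u`, which passes to limits. -/
def FreeRel (p : H × H) : Prop :=
  ∀ ρ ∈ I, K p.1.1.fst ρ = (ρ : ℂ) ^ 2 * fn₂ p.1 ρ - K (fn₂ p.1) ρ + K (fn₂ p.2) ρ ∧
    fn₁ p.2 ρ = -((ρ : ℂ) ^ 2 * K p.1.1.fst ρ) + 2 * fn₁ p.1 ρ + (ρ : ℂ) ^ 2 * fn₂ p.1 ρ -
      3 * K (fn₂ p.1) ρ

/-- Applying `K` to the second component of `v = L₀ u` and integrating `ρ u₂'` by parts removes the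
derivative of `u₂`; in the first component `ρ u₁' = ρ² D u₁`, and `D u₁` is `K` of the first
coordinate. -/
theorem freeRel_of_mem_graph₀ {p : H × H} (hp : p ∈ graph₀) : FreeRel p := by
  obtain ⟨u, v, -, huv, rfl⟩ := hp
  intro ρ hρ
  have cu : ContinuousOn u.1.2 I := u.2.2.1.continuousOn
  have cu' : ContinuousOn (fun s : ℝ => s • derivWithin u.1.2 I s) I :=
    continuousOn_id.smul (contDiffOn_derivWithin_of (m := 0) u.2.2.1 (by norm_num)).continuousOn
  have cv : ContinuousOn v.1.2 I := v.2.2.1.continuousOn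
  refine ⟨?_, ?_⟩
  · have e1 : (toH u).1.fst =ᵐ[μ] v.1.2 + ((fun s : ℝ => s • derivWithin u.1.2 I s) + u.1.2) := by
      refine (toH_fst u).trans (ae_of_Ioc fun s hs => ?_)
      simp only [Pi.add_apply, (huv s hs).2, free₂]
      ring
    have e2 : K (fun s : ℝ => s • derivWithin u.1.2 I s) ρ = (ρ : ℂ) ^ 2 * u.1.2 ρ - 2 * K u.1.2 ρ := by
      refine K_eq_of_hasDerivWithinAt (F := fun ρ : ℝ => (ρ : ℂ) ^ 2 * u.1.2 ρ - 2 * K u.1.2 ρ) cu'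
        (fun s hs => ?_) (by simp [K_zero_right]) hρ
      refine HasDerivWithinAt.congr_deriv (((hasDerivWithinAt_ofReal_pow 2 I s).mul (hasDerivWithinAt_of u.2.2.1 hs)).sub
        ((hasDerivWithinAt_K cu hs).const_mul 2)) ?_
      simp only [Complex.real_smul]; push_cast; ring
    rw [K_congr e1 hρ, K_add (integrableOn_of_continuousOn cv)
      ((integrableOn_of_continuousOn cu').add (integrableOn_of_continuousOn cu)) hρ,
      K_add (integrableOn_of_continuousOn cu') (integrableOn_of_continuousOn cu) hρ, e2,
      fn₂_toH u hρ, K_fn₂_toH u hρ, K_fn₂_toH v hρ]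
    ring
  · simp only [K_fst_toH u hρ, fn₁_toH u hρ, fn₁_toH v hρ, fn₂_toH u hρ, K_fn₂_toH u hρ]
    rcases hρ.1.eq_or_lt with rfl | h
    · have hu0 : u.1.1 0 = 0 := by simpa using u.2.2.2.1 0 (by norm_num)
      have hv0 : v.1.1 0 = 0 := by simpa using v.2.2.2.1 0 (by norm_num)
      simp [hu0, hv0, K_zero_right]
    · rw [(huv ρ ⟨h, hρ.2⟩).1, free₁]
      have hne : (ρ : ℂ) ≠ 0 := by exact_mod_cast h.ne'
      simp only [D, Complex.real_smul]
      push_cast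
      field_simp

/-- Only functionals bounded in the norm of the space occur in the integrated relation. -/
theorem isClosed_freeRel : IsClosed {p : H × H | FreeRel p} := by
  have h1 : Continuous (Prod.fst : H × H → H) := continuous_fst
  have h2 : Continuous (Prod.snd : H × H → H) := continuous_snd
  simp only [FreeRel, ofPred_forall, ofPred_and]
  refine isClosed_iInter fun ρ => isClosed_iInter fun hρ => ?_
  have c1 := (continuous_fn₁ hρ).comp h1
  have c2 := (continuous_fn₂ hρ).comp h1
  have c3 := (continuous_K_fst hρ).comp h1
  have c4 := (continuous_K_fn₂ hρ).comp h1
  have c5 := (continuous_fn₁ hρ).comp h2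
  have c6 := (continuous_K_fn₂ hρ).comp h2
  refine IsClosed.inter (isClosed_eq c3 ?_) (isClosed_eq c5 ?_)
  · exact ((continuous_const.mul c2).sub c4).add c6
  · exact (((continuous_const.mul c3).neg.add (continuous_const.mul c1)).add
      (continuous_const.mul c2)).sub (continuous_const.mul c4)

theorem freeRel_of_mem_closure {p : H × H} (hp : p ∈ graph₀.topologicalClosure) : FreeRel p :=
  closure_minimal (fun _ h => freeRel_of_mem_graph₀ h) isClosed_freeRel hp

/-- Single-valuedness of the closed graph, which is closability. -/
theorem FreeRel.snd_eq_zero {p : H × H} (hp : FreeRel p) (h0 : p.1 = 0) : p.2 = 0 := by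
  have z1 : ∀ ρ ∈ I, fn₁ p.1 ρ = 0 := fun ρ hρ => by rw [h0]; exact fn₁_zero hρ
  have z2 : ∀ ρ ∈ I, fn₂ p.1 ρ = 0 := fun ρ hρ => by rw [h0]; exact fn₂_zero hρ
  have z3 : ∀ ρ ∈ I, K (fn₂ p.1) ρ = 0 := fun ρ hρ => by
    rw [K_congr (g := 0) (ae_of_I z2) hρ]; simp [K]
  have z4 : ∀ ρ ∈ I, K p.1.1.fst ρ = 0 := fun ρ hρ => by
    have e : p.1.1.fst = 0 := by rw [h0]; rfl
    rw [e, K_congr (g := 0) (Lp.coeFn_zero ℂ 2 μ) hρ]; simp [K]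
  have k1 : ∀ ρ ∈ I, K (fn₂ p.2) ρ = 0 := fun ρ hρ => by
    have := (hp ρ hρ).1
    rw [z4 ρ hρ, z2 ρ hρ, z3 ρ hρ] at this
    simpa using this.symm
  refine eq_zero_of_fn (fun ρ hρ => ?_) ?_
  · rw [(hp ρ hρ).2, z1 ρ hρ, z2 ρ hρ, z3 ρ hρ, z4 ρ hρ]; simp
  · have e : fn₂ p.2 =ᵐ[volume.restrict I] 0 := by
      rw [← restrict_Ioc_eq_restrict_Icc]
      exact ae_eq_zero_of_K_eq_zero (integrableOn_fn₂ _) k1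
    exact Measure.eqOn_Icc_of_ae_eq volume zero_ne_one e (continuousOn_fn₂ _) continuousOn_const

theorem preL₀_graph : preL₀.graph = graph₀ :=
  Submodule.toLinearPMap_graph_eq _ fun _ hp h0 => (freeRel_of_mem_graph₀ hp).snd_eq_zero h0

theorem L₀_graph : L₀.graph = graph₀.topologicalClosure := by
  have hc : preL₀.IsClosable := by
    refine ⟨graph₀.topologicalClosure.toLinearPMap, ?_⟩
    rw [preL₀_graph, Submodule.toLinearPMap_graph_eq _ fun _ hp h0 =>
      (freeRel_of_mem_closure hp).snd_eq_zero h0]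
  rw [L₀, ← hc.graph_closure_eq_closure_graph, preL₀_graph]

end Closable

/-! ### Energy estimate for the free operator -/

section Dissipative

theorem derivWithin_of_eqOn_Ioo {f g : ℝ → ℂ} (h : EqOn f g (Ioo 0 1)) {ρ : ℝ} {g' : ℂ}
    (hρ : ρ ∈ Ioo (0 : ℝ) 1) (hg : HasDerivAt g g' ρ) : derivWithin f I ρ = g' := by
  have hf : HasDerivAt f g' ρ := hg.congr_of_eventuallyEq
    (by filter_upwards [Ioo_mem_nhds hρ.1 hρ.2] with x hx using h hx)
  exact derivWithin_of_hasDerivWithinAt (Ioo_subset_Icc_self hρ) hf.hasDerivWithinAt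

theorem re_inner_eq_integral (x y : H) : Integrable (fun ρ =>
      inner ℝ (x.1.fst ρ) (y.1.fst ρ) + inner ℝ (x.1.snd ρ) (y.1.snd ρ)) μ ∧
    (inner ℂ x y).re =
      ∫ ρ, (inner ℝ (x.1.fst ρ) (y.1.fst ρ) + inner ℝ (x.1.snd ρ) (y.1.snd ρ)) ∂μ := by
  have h1 : Integrable (fun ρ => inner ℂ (x.1.fst ρ) (y.1.fst ρ)) μ := L2.integrable_inner _ _
  have h2 : Integrable (fun ρ => inner ℂ (x.1.snd ρ) (y.1.snd ρ)) μ := L2.integrable_inner _ _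
  have e : ∀ z w : ℂ, inner ℝ z w = Complex.reCLM (inner ℂ z w) := fun z w => by
    rw [Complex.inner]; simp
  have r1 := Complex.reCLM.integrable_comp h1
  have r2 := Complex.reCLM.integrable_comp h2
  simp only [e]
  refine ⟨r1.add r2, ?_⟩
  rw [integral_add r1 r2, Complex.reCLM.integral_comp_comm h1, Complex.reCLM.integral_comp_comm h2]
  rw [Submodule.coe_inner, WithLp.prod_inner_apply, Complex.add_re, L2.inner_def, L2.inner_def]
  rfl

/-- The shift `3/2` turns the zeroth-order coefficient `-2` into `-1/2`, which makes the integrand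
the exact derivative of `Φ = -(ρ/2)(|A|² + |b|²) + Re (A conj b)`. The boundary term vanishes at 0
because `A` does, and at 1 it is `-|A - b|²/2`. -/
theorem re_inner_le_of_mem_graph₀ {x y : H} (h : (x, y) ∈ graph₀) :
    (inner ℂ x (y + (3 / 2 : ℂ) • x)).re ≤ 0 := by
  obtain ⟨u, v, hu, huv, e⟩ := h
  obtain ⟨rfl, rfl⟩ := Prod.mk.inj e
  obtain ⟨s1, s2, s3, -⟩ := hu
  have t1 := ContDiffOn.derivWithin_I s1
  have t2 := ContDiffOn.derivWithin_I t1
  have tb := ContDiffOn.derivWithin_I s2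
  have hd : ∀ {f : ℝ → ℂ}, ContDiffOn ℝ ∞ f I → ∀ {ρ : ℝ}, ρ ∈ Ioo (0 : ℝ) 1 →
      HasDerivAt f (derivWithin f I ρ) ρ := fun {_} hf {_} hρ =>
    (hasDerivWithinAt_of_smooth hf (Ioo_subset_Icc_self hρ)).hasDerivAt (Icc_mem_nhds hρ.1 hρ.2)
  have hd1 := fun {ρ : ℝ} (hρ : ρ ∈ Ioo (0 : ℝ) 1) => hd s1 hρ
  have hd2 := fun {ρ : ℝ} (hρ : ρ ∈ Ioo (0 : ℝ) 1) => hd t1 hρ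
  have hd3 := fun {ρ : ℝ} (hρ : ρ ∈ Ioo (0 : ℝ) 1) => hd t2 hρ
  have hdb := fun {ρ : ℝ} (hρ : ρ ∈ Ioo (0 : ℝ) 1) => hd s2 hρ
  have hdb' := fun {ρ : ℝ} (hρ : ρ ∈ Ioo (0 : ℝ) 1) => hd tb hρ
  have hx : ∀ (n : ℕ) (ρ : ℝ), HasDerivAt (fun ρ : ℝ => (ρ : ℂ) ^ n) (n * (ρ : ℂ) ^ (n - 1)) ρ :=
    fun n ρ => by
      have := hasDerivWithinAt_ofReal_pow n univ ρ
      rwa [hasDerivWithinAt_univ] at this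
  have hx1 : ∀ ρ : ℝ, HasDerivAt (fun ρ : ℝ => (ρ : ℂ)) 1 ρ := fun ρ => by
    have := hasDerivWithinAt_ofReal univ ρ
    rwa [hasDerivWithinAt_univ] at this
  set u' := derivWithin u.1.1 I
  set u'' := derivWithin u' I
  set u''' := derivWithin u'' I
  set b := derivWithin u.1.2 I
  set b' := derivWithin b I
  set A : ℝ → ℂ := fun ρ => u'' ρ / (ρ : ℂ) ^ 2 - u' ρ / (ρ : ℂ) ^ 3
  set A' : ℝ → ℂ := fun ρ =>
    u''' ρ / (ρ : ℂ) ^ 2 - 3 * u'' ρ / (ρ : ℂ) ^ 3 + 3 * u' ρ / (ρ : ℂ) ^ 4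
  have hA : ∀ ρ ∈ Ioc (0 : ℝ) 1, D (D u.1.1) ρ = A ρ := fun ρ hρ => by
    rw [DD_eq (u.2.1.of_le (by norm_num)) hρ]
    have : (ρ : ℂ) ≠ 0 := by exact_mod_cast hρ.1.ne'
    simp only [A, Complex.real_smul]
    push_cast
    field_simp
    ring
  have hdA : ∀ {ρ : ℝ}, ρ ∈ Ioo (0 : ℝ) 1 → HasDerivAt A (A' ρ) ρ := fun {ρ} hρ => by
    have h0 : (ρ : ℂ) ≠ 0 := by exact_mod_cast hρ.1.ne'
    refine HasDerivAt.congr_deriv (((hd3 hρ).div (hx 2 ρ) (pow_ne_zero _ h0)).sub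
      ((hd2 hρ).div (hx 3 ρ) (pow_ne_zero _ h0))) ?_
    simp only [A']
    push_cast
    field_simp
    ring
  have hv2 : ∀ ρ ∈ Ioo (0 : ℝ) 1, derivWithin v.1.2 I ρ = A' ρ - (ρ : ℂ) * b' ρ - 2 * b ρ :=
    fun ρ hρ => by
      refine derivWithin_of_eqOn_Ioo (g := fun ρ : ℝ => A ρ - (ρ : ℂ) * b ρ - u.1.2 ρ)
        (fun s hs => ?_) hρ ?_
      · rw [(huv s (Ioo_subset_Ioc_self hs)).2, free₂, hA s (Ioo_subset_Ioc_self hs),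
          Complex.real_smul]
      · refine HasDerivAt.congr_deriv (((hdA hρ).sub ((hx1 ρ).mul (hdb' hρ))).sub (hdb hρ)) ?_
        ring
  have hv1 : ∀ ρ ∈ Ioo (0 : ℝ) 1, D v.1.1 ρ = -((ρ : ℂ) ^ 2 * A ρ) + ρ * b ρ - u.1.2 ρ :=
    fun ρ hρ => by
      have h0 : (ρ : ℂ) ≠ 0 := by exact_mod_cast hρ.1.ne'
      have hK : HasDerivAt (K u.1.2) (ρ • u.1.2 ρ) ρ :=
        (hasDerivWithinAt_K s2.continuousOn (Ioo_subset_Icc_self hρ)).hasDerivAt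
          (Icc_mem_nhds hρ.1 hρ.2)
      rw [D, derivWithin_of_eqOn_Ioo (g := fun ρ : ℝ => -((ρ : ℂ) * u' ρ) + 2 * u.1.1 ρ +
        (ρ : ℂ) ^ 2 * u.1.2 ρ - 3 * K u.1.2 ρ) (fun s hs => ?_) hρ
        ((((((hx1 ρ).mul (hd2 hρ)).neg).add ((hd1 hρ).const_mul 2)).add
          ((hx 2 ρ).mul (hdb hρ))).sub (hK.const_mul 3))]
      · simp only [A, Complex.real_smul]
        push_cast
        field_simp
        ring
      · rw [(huv s (Ioo_subset_Ioc_self hs)).1, free₁]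
        simp only [Complex.real_smul]
        push_cast
        rfl
  have hv11 : ∀ ρ ∈ Ioo (0 : ℝ) 1, D (D v.1.1) ρ = -((ρ : ℂ) * A' ρ) + b' ρ - 2 * A ρ :=
    fun ρ hρ => by
      have h0 : (ρ : ℂ) ≠ 0 := by exact_mod_cast hρ.1.ne'
      rw [D, derivWithin_of_eqOn_Ioo hv1 hρ (((((hx 2 ρ).mul (hdA hρ)).neg).add
        ((hx1 ρ).mul (hdb' hρ))).sub (hdb hρ)), Complex.real_smul]
      push_cast
      field_simp
      ring
  set Φ : ℝ → ℝ := fun ρ => -(ρ / 2) * (‖A ρ‖ ^ 2 + ‖b ρ‖ ^ 2) + inner ℝ (A ρ) (b ρ)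
  set Φ' : ℝ → ℝ := fun ρ =>
    inner ℝ (A ρ) (-((ρ : ℂ) * A' ρ) + b' ρ - 2 * A ρ + (3 / 2 : ℂ) * A ρ) +
      inner ℝ (b ρ) (A' ρ - (ρ : ℂ) * b' ρ - 2 * b ρ + (3 / 2 : ℂ) * b ρ)
  have hΦ : ∀ ρ ∈ Ioo (0 : ℝ) 1, HasDerivAt Φ (Φ' ρ) ρ := fun ρ hρ => by
    have hl : HasDerivAt (fun ρ : ℝ => -(ρ / 2)) (-(1 / 2)) ρ :=
      ((hasDerivAt_id ρ).div_const 2).neg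
    refine HasDerivAt.congr_deriv ((hl.mul ((hdA hρ).norm_sq.add (hdb' hρ).norm_sq)).add
      ((hdA hρ).inner ℝ (hdb' hρ))) ?_
    simp only [Φ', Complex.inner, Complex.sq_norm, Complex.normSq_apply, Complex.mul_re,
      Complex.mul_im, Complex.add_re, Complex.add_im, Complex.sub_re, Complex.sub_im,
      Complex.neg_re, Complex.neg_im, Complex.conj_re, Complex.conj_im, Complex.ofReal_re,
      Complex.ofReal_im, Pi.add_apply]
    norm_num
    ring
  set w := toH v + (3 / 2 : ℂ) • toH u
  obtain ⟨hi, hre⟩ := re_inner_eq_integral (toH u) w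
  have hae : (fun ρ => inner ℝ ((toH u).1.fst ρ) (w.1.fst ρ) +
      inner ℝ ((toH u).1.snd ρ) (w.1.snd ρ)) =ᵐ[μ] Φ' := by
    have w1 : w.1.fst =ᵐ[μ] fun ρ => (toH v).1.fst ρ + (3 / 2 : ℂ) * (toH u).1.fst ρ := by
      refine (Lp.coeFn_add (toH v).1.fst ((3 / 2 : ℂ) • (toH u).1.fst)).trans ?_
      filter_upwards [Lp.coeFn_smul (3 / 2 : ℂ) (toH u).1.fst] with ρ hρ
      rw [Pi.add_apply, hρ]; rfl
    have w2 : w.1.snd =ᵐ[μ] fun ρ => (toH v).1.snd ρ + (3 / 2 : ℂ) * (toH u).1.snd ρ := by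
      refine (Lp.coeFn_add (toH v).1.snd ((3 / 2 : ℂ) • (toH u).1.snd)).trans ?_
      filter_upwards [Lp.coeFn_smul (3 / 2 : ℂ) (toH u).1.snd] with ρ hρ
      rw [Pi.add_apply, hρ]; rfl
    have hne : ∀ᵐ ρ ∂μ, ρ ≠ 1 := ae_restrict_of_ae (by simp [ae_iff, measure_singleton])
    filter_upwards [w1, w2, toH_fst u, toH_snd u, toH_fst v, toH_snd v, hne,
      ae_restrict_mem measurableSet_Ioc] with ρ h1 h2 h3 h4 h5 h6 h7 h8
    have hρ : ρ ∈ Ioo (0 : ℝ) 1 := ⟨h8.1, lt_of_le_of_ne h8.2 h7⟩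
    rw [h1, h2, h3, h4, h5, h6, hA ρ h8, hv11 ρ hρ, hv2 ρ hρ]
  have hiΦ : IntervalIntegrable Φ' volume 0 1 :=
    (intervalIntegrable_iff_integrableOn_Ioc_of_le zero_le_one).2 (hi.congr hae)
  have hlim1 : Filter.Tendsto Φ (nhdsWithin 1 (Iio 1)) (nhds (Φ 1)) := by
    have cA : ContinuousWithinAt A I 1 := by
      have h1 : (1 : ℝ) ∈ I := by simp
      have c2 : ContinuousWithinAt u'' I 1 := t2.continuousOn 1 h1
      have c1 : ContinuousWithinAt u' I 1 := t1.continuousOn 1 h1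
      have cx : ContinuousWithinAt (fun ρ : ℝ => (ρ : ℂ)) I 1 :=
        Complex.continuous_ofReal.continuousWithinAt
      exact (c2.div (cx.pow 2) (by simp)).sub (c1.div (cx.pow 3) (by simp))
    have cb : ContinuousWithinAt b I 1 := tb.continuousOn 1 (by simp)
    have cΦ : ContinuousWithinAt Φ I 1 :=
      ((continuousWithinAt_id.div_const 2).neg.mul ((cA.norm.pow 2).add (cb.norm.pow 2))).add
        (ContinuousWithinAt.inner (𝕜 := ℝ) cA cb)
    exact cΦ.mono_left (nhdsWithin_le_of_mem (Icc_mem_nhdsLT zero_lt_one))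
  -- The vanishing fourth derivative in `Dom₀` gives `u' = O(ρ⁴)` and `u'' = O(ρ³)`, hence `A =
  -- O(ρ)`; the conditions of `PreH` alone would only bound `A`.
  have hlim0 : Filter.Tendsto Φ (nhdsWithin 0 (Ioi 0)) (nhds 0) := by
    have e1 : ∀ k, iteratedDerivWithin k u' I = iteratedDerivWithin (k + 1) u.1.1 I :=
      fun k => (iteratedDerivWithin_succ').symm
    have e2 : ∀ k, iteratedDerivWithin k u'' I = iteratedDerivWithin (k + 2) u.1.1 I := fun k => by
      rw [← e1, iteratedDerivWithin_succ']
    obtain ⟨C₁, hC₁⟩ := exists_bound (n := 3) (f := u') (by exact_mod_cast contDiffOn_infty.1 t1 4)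
      fun k hk => by rw [e1]; exact s3 _ (by omega)
    obtain ⟨C₂, hC₂⟩ := exists_bound (n := 2) (f := u'') (by exact_mod_cast contDiffOn_infty.1 t2 3)
      fun k hk => by rw [e2]; exact s3 _ (by omega)
    obtain ⟨C₃, hC₃⟩ := isCompact_Icc.exists_bound_of_continuousOn tb.continuousOn
    have hAb : ∀ ρ ∈ Ioo (0 : ℝ) 1, ‖A ρ‖ ≤ (C₂ + C₁) * ρ := fun ρ hρ => by
      have hI := Ioo_subset_Icc_self hρ
      have hp := hρ.1
      refine (norm_sub_le _ _).trans ?_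
      rw [norm_div, norm_div, norm_pow, norm_pow, Complex.norm_real, Real.norm_of_nonneg hp.le,
        add_mul]
      refine add_le_add ?_ ?_
      · rw [div_le_iff₀ (by positivity)]
        exact (hC₂ ρ hI).trans_eq (by ring)
      · rw [div_le_iff₀ (by positivity)]
        exact (hC₁ ρ hI).trans_eq (by ring)
    refine squeeze_zero_norm' (a := fun ρ : ℝ => ρ / 2 * (((C₂ + C₁) * ρ) ^ 2 + C₃ ^ 2) +
      (C₂ + C₁) * ρ * C₃) ?_ ?_
    · filter_upwards [Ioo_mem_nhdsGT (zero_lt_one (α := ℝ))] with ρ hρ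
      have hp := hρ.1
      have h1 := hAb ρ hρ
      have h2 : ‖b ρ‖ ≤ C₃ := hC₃ ρ (Ioo_subset_Icc_self hρ)
      refine (norm_add_le _ _).trans (add_le_add ?_ ?_)
      · rw [norm_mul, norm_neg, Real.norm_of_nonneg (by positivity),
          Real.norm_of_nonneg (by positivity)]
        gcongr
      · refine (norm_inner_le_norm _ _).trans ?_
        exact mul_le_mul h1 h2 (norm_nonneg _) ((norm_nonneg _).trans h1)
    · have : Continuous fun ρ : ℝ => ρ / 2 * (((C₂ + C₁) * ρ) ^ 2 + C₃ ^ 2) +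
        (C₂ + C₁) * ρ * C₃ := by fun_prop
      simpa using (this.tendsto 0).mono_left nhdsWithin_le_nhds
  rw [hre, integral_congr_ae hae, ← intervalIntegral.integral_of_le zero_le_one,
    intervalIntegral.integral_eq_sub_of_hasDerivAt_of_tendsto zero_lt_one hΦ hiΦ hlim0 hlim1]
  have := real_inner_le_norm (A 1) (b 1)
  simp only [Φ]
  nlinarith [sq_nonneg (‖A 1‖ - ‖b 1‖)]

/-- Cauchy–Schwarz gives `(5/2) ‖x‖² ≤ ‖x‖ ‖x - y‖`; the weaker constant 1 is enough. -/
theorem norm_le_norm_sub_of_re_inner {E : Type*} [NormedAddCommGroup E] [InnerProductSpace ℂ E]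
    {x y : E} (h : (inner ℂ x (y + (3 / 2 : ℂ) • x)).re ≤ 0) : ‖x‖ ≤ ‖x - y‖ := by
  have h2 : (inner ℂ x (x - y)).re ≤ ‖x‖ * ‖x - y‖ :=
    (Complex.re_le_norm _).trans (norm_inner_le_norm _ _)
  have h3 : (inner ℂ x x).re = ‖x‖ ^ 2 := inner_self_eq_norm_sq (𝕜 := ℂ) x
  rw [inner_add_right, inner_smul_right, Complex.add_re, Complex.mul_re,
    show (inner ℂ x x).im = 0 from inner_self_im (𝕜 := ℂ) x, h3] at h
  rw [inner_sub_right, Complex.sub_re, h3] at h2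
  norm_num at h
  by_contra hlt
  push Not at hlt
  nlinarith [norm_nonneg (x - y), norm_nonneg x]

theorem norm_le_of_mem_closure {p : H × H} (hp : p ∈ graph₀.topologicalClosure) :
    ‖p.1‖ ≤ ‖p.1 - p.2‖ := by
  have hc : IsClosed {p : H × H | ‖p.1‖ ≤ ‖p.1 - p.2‖} :=
    isClosed_le (by fun_prop) (by fun_prop)
  exact closure_minimal
    (fun p hp => norm_le_norm_sub_of_re_inner (re_inner_le_of_mem_graph₀ hp)) hc hp

end Dissipative

/-! ### The point 1 in the resolvent set of the free operator -/

section Resolvent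

/-- A closed operator `A` such that `1 - A` is bounded below with dense range has `1` in its
resolvent set. -/
theorem exists_isResolventAt_one {E : Type*} [NormedAddCommGroup E] [InnerProductSpace ℂ E]
    [CompleteSpace E] {A : E →ₗ.[ℂ] E} (hc : IsClosed (A.graph : Set (E × E)))
    (hb : ∀ p ∈ A.graph, ‖p.1‖ ≤ ‖p.1 - p.2‖)
    (hd : ∀ z : E, (∀ p ∈ A.graph, inner ℂ (p.1 - p.2) z = 0) → z = 0) :
    ∃ R, IsResolventAt A 1 R := by
  have : CompleteSpace A.graph := hc.completeSpace_coe
  set Ψ : A.graph →L[ℂ] E :=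
    (ContinuousLinearMap.fst ℂ E E - ContinuousLinearMap.snd ℂ E E) ∘L A.graph.subtypeL
  have hΨ : ∀ p, Ψ p = p.1.1 - p.1.2 := fun p => rfl
  -- In the graph norm, `‖y‖ ≤ ‖x‖ + ‖x - y‖ ≤ 2 ‖x - y‖`. The range is therefore closed, and being
  -- dense it is everything.
  have anti : AntilipschitzWith 2 Ψ := by
    refine Ψ.antilipschitz_of_bound fun p => ?_
    have h1 := hb p.1 p.2
    have h2 : ‖p.1.2‖ ≤ ‖p.1.1‖ + ‖p.1.1 - p.1.2‖ := by
      have := norm_sub_le p.1.1 (p.1.1 - p.1.2)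
      rwa [sub_sub_cancel] at this
    rw [hΨ]
    change max ‖p.1.1‖ ‖p.1.2‖ ≤ 2 * _
    refine max_le ?_ ?_ <;> linarith [norm_nonneg (p.1.1 - p.1.2)]
  have hcl : IsClosed (Ψ.range : Set E) := by
    have h := anti.isClosed_range Ψ.uniformContinuous
    exact h
  have : CompleteSpace Ψ.range := hcl.completeSpace_coe
  have hr : Ψ.range = ⊤ := by
    rw [← Submodule.orthogonal_eq_bot_iff, Submodule.eq_bot_iff]
    intro z hz
    refine hd z fun p hp => ?_
    exact (Submodule.mem_orthogonal _ _).1 hz _ ⟨⟨p, hp⟩, rfl⟩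
  set e := ContinuousLinearEquiv.ofBijective Ψ (LinearMap.ker_eq_bot.2 anti.injective) hr
  have he : ∀ p, e p = p.1.1 - p.1.2 := fun p => rfl
  refine ⟨ContinuousLinearMap.fst ℂ E E ∘L A.graph.subtypeL ∘L (e.symm : E →L[ℂ] A.graph),
    isResolventAt_iff.2 ⟨fun y => ?_, fun x y hxy => ?_⟩⟩
  · have h1 : (e.symm y).1.1 - (e.symm y).1.2 = y := by rw [← he, e.apply_symm_apply]
    refine mem_graph_of_eq (e.symm y).2 rfl ?_
    change (1 : ℂ) • (e.symm y).1.1 - y = _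
    rw [one_smul]
    nth_rewrite 2 [← h1]
    rw [sub_sub_cancel]
  · change (e.symm ((1 : ℂ) • x - y)).1.1 = x
    have : (1 : ℂ) • x - y = e ⟨(x, y), hxy⟩ := by rw [he, one_smul]
    rw [this, e.symm_apply_apply]

/-- With `p = a + b` and `q = a - b`, the system for `1 - L₀` splits into two scalar equations; the
boundary condition `a 0 = 0` is their only link. -/
theorem exists_mem_graph₀_of_characteristics {p q p' q' f₁ f₂ : ℝ → ℝ}
    (hp : ContDiffOn ℝ ∞ p I) (hq : ContDiffOn ℝ ∞ q I)
    (hp' : ∀ ρ ∈ I, HasDerivWithinAt p (p' ρ) I ρ) (hq' : ∀ ρ ∈ I, HasDerivWithinAt q (q' ρ) I ρ)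
    (h0 : p 0 + q 0 = 0) (h1 : ∀ ρ ∈ I, 3 * p ρ - (1 - ρ) * p' ρ = f₁ ρ)
    (h2 : ∀ ρ ∈ I, 3 * q ρ + (1 + ρ) * q' ρ = f₂ ρ) :
    ∃ z ∈ graph₀, (z.1 - z.2).1.fst =ᵐ[μ] (fun ρ => (((f₁ ρ + f₂ ρ) / 2 : ℝ) : ℂ)) ∧
      (z.1 - z.2).1.snd =ᵐ[μ] (fun ρ => (((f₁ ρ - f₂ ρ) / 2 : ℝ) : ℂ)) := by
  set a : ℝ → ℂ := fun ρ => (((p ρ + q ρ) / 2 : ℝ) : ℂ)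
  set b : ℝ → ℂ := fun ρ => (((p ρ - q ρ) / 2 : ℝ) : ℂ)
  have ha : ContDiffOn ℝ ∞ a I := Complex.ofRealCLM.contDiff.comp_contDiffOn ((hp.add hq).div_const 2)
  have hb : ContDiffOn ℝ ∞ b I := Complex.ofRealCLM.contDiff.comp_contDiffOn ((hp.sub hq).div_const 2)
  have ha' : ∀ ρ ∈ I, derivWithin a I ρ = (((p' ρ + q' ρ) / 2 : ℝ) : ℂ) := fun ρ hρ =>
    derivWithin_of_hasDerivWithinAt hρ (Complex.ofRealCLM.hasFDerivAt.comp_hasDerivWithinAt ρ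
      (((hp' ρ hρ).add (hq' ρ hρ)).div_const 2))
  have hb' : ∀ ρ ∈ I, derivWithin b I ρ = (((p' ρ - q' ρ) / 2 : ℝ) : ℂ) := fun ρ hρ =>
    derivWithin_of_hasDerivWithinAt hρ (Complex.ofRealCLM.hasFDerivAt.comp_hasDerivWithinAt ρ
      (((hp' ρ hρ).sub (hq' ρ hρ)).div_const 2))
  have ha0 : a 0 = 0 := by simp only [a, h0]; simp
  refine ⟨_, smoothPair_mem_graph₀ ha hb ha0, ?_, ?_⟩
  · refine (Lp.coeFn_sub (toH (smoothPair a b ha hb)).1.fst _).trans ?_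
    filter_upwards [toH_smoothPair_fst ha hb, toH_smoothPair_fst (contDiffOn_coord₁ ha hb)
      (contDiffOn_coord₂ ha hb), ae_restrict_mem measurableSet_Ioc] with ρ e1 e2 hρ
    have hI := Ioc_subset_Icc_self hρ
    refine (congrArg₂ (· - ·) e1 e2).trans ?_
    rw [coord₁, ha' ρ hI, hb' ρ hI, ← h1 ρ hI, ← h2 ρ hI]
    simp only [a]
    push_cast
    ring
  · refine (Lp.coeFn_sub (toH (smoothPair a b ha hb)).1.snd _).trans ?_
    filter_upwards [toH_smoothPair_snd ha hb, toH_smoothPair_snd (contDiffOn_coord₁ ha hb)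
      (contDiffOn_coord₂ ha hb), ae_restrict_mem measurableSet_Ioc] with ρ e1 e2 hρ
    have hI := Ioc_subset_Icc_self hρ
    refine (congrArg₂ (· - ·) e1 e2).trans ?_
    rw [coord₂, ha' ρ hI, hb' ρ hI, ← h1 ρ hI, ← h2 ρ hI]
    simp only [b]
    push_cast
    ring

theorem inner_eq_of_ae {x z : H} {r₁ r₂ : ℝ → ℝ} (h1 : x.1.fst =ᵐ[μ] fun ρ => (r₁ ρ : ℂ))
    (h2 : x.1.snd =ᵐ[μ] fun ρ => (r₂ ρ : ℂ)) :
    inner ℂ x z = ∫ ρ, r₁ ρ • z.1.fst ρ ∂μ + ∫ ρ, r₂ ρ • z.1.snd ρ ∂μ := by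
  rw [Submodule.coe_inner, WithLp.prod_inner_apply]
  exact congrArg₂ _ (inner_eq_integral h1) (inner_eq_integral h2)

theorem integrable_smul_of_continuous {r : ℝ → ℝ} (hr : Continuous r) (f : L2) :
    Integrable (fun ρ => r ρ • f ρ) μ := by
  have h1 : IntegrableOn (fun ρ => r ρ • f ρ) (Icc 0 1) :=
    ((integrableOn_Icc_iff_integrableOn_Ioc).2 (integrableOn_L2 f)).continuousOn_smul
      hr.continuousOn isCompact_Icc
  exact h1.mono_set Ioc_subset_Icc_self

theorem integral_pow_smul_eq_zero {x z : H} {α β κ σ : ℝ} {k : ℕ} (hκ : κ ≠ 0)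
    (h1 : x.1.fst =ᵐ[μ] fun ρ => ((κ * (α + β * ρ) ^ k : ℝ) : ℂ))
    (h2 : x.1.snd =ᵐ[μ] fun ρ => ((κ * (σ * (α + β * ρ) ^ k) : ℝ) : ℂ)) (h : inner ℂ x z = 0) :
    ∫ ρ, (α + β * ρ) ^ k • (z.1.fst + (σ : ℂ) • z.1.snd) ρ ∂μ = 0 := by
  have i1 := integrable_smul_of_continuous (r := fun ρ => (α + β * ρ) ^ k) (by fun_prop) z.1.fst
  have i2 := integrable_smul_of_continuous (r := fun ρ => (α + β * ρ) ^ k) (by fun_prop) z.1.snd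
  have e : ∫ ρ, (α + β * ρ) ^ k • (z.1.fst + (σ : ℂ) • z.1.snd) ρ ∂μ =
      ∫ ρ, ((α + β * ρ) ^ k • z.1.fst ρ + σ • (α + β * ρ) ^ k • z.1.snd ρ) ∂μ := by
    refine integral_congr_ae ?_
    filter_upwards [Lp.coeFn_add z.1.fst ((σ : ℂ) • z.1.snd), Lp.coeFn_smul (σ : ℂ) z.1.snd]
      with ρ e1 e2
    rw [e1, Pi.add_apply, e2, Pi.smul_apply, smul_add, smul_comm σ]
    simp
  rw [inner_eq_of_ae h1 h2] at h
  simp only [mul_smul] at h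
  rw [integral_smul, integral_smul, integral_smul, ← smul_add] at h
  have i3 : Integrable (fun ρ => σ • (α + β * ρ) ^ k • z.1.snd ρ) μ := i2.smul σ
  rw [e, integral_add i1 i3]
  refine Eq.trans ?_ ((smul_eq_zero.1 h).resolve_left hκ)
  congr 1
  exact integral_smul σ _

/-- `(1 - ρ)^k` and `(1 + ρ)^k` are eigenfunctions of the two scalar operators with eigenvalue `3 +
k`. Subtracting the homogeneous solution `(1 + ρ)⁻³` of the `q` equation repairs the boundary
condition without changing the image. Hence all moments of `z.1.fst ± z.1.snd` vanish. -/
theorem eq_zero_of_forall_inner_eq_zero {z : H}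
    (h : ∀ p ∈ graph₀, inner ℂ (p.1 - p.2) z = 0) : z = 0 := by
  have hne : ∀ ρ ∈ I, (1 + ρ : ℝ) ≠ 0 := fun ρ hρ => by linarith [hρ.1]
  set c : ℝ → ℝ := fun ρ => ((1 + ρ) ^ 3)⁻¹
  set c' : ℝ → ℝ := fun ρ => -3 * ((1 + ρ) ^ 4)⁻¹
  have hc : ContDiffOn ℝ ∞ c I :=
    ContDiffOn.inv (by fun_prop) fun ρ hρ => pow_ne_zero 3 (hne ρ hρ)
  have hl : ∀ ρ : ℝ, HasDerivWithinAt (fun ρ : ℝ => 1 + ρ) 1 I ρ := fun ρ =>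
    ((hasDerivAt_id ρ).const_add 1).hasDerivWithinAt
  have hl' : ∀ ρ : ℝ, HasDerivWithinAt (fun ρ : ℝ => 1 - ρ) (-1) I ρ := fun ρ =>
    ((hasDerivAt_id ρ).const_sub 1).hasDerivWithinAt
  have hc' : ∀ ρ ∈ I, HasDerivWithinAt c (c' ρ) I ρ := fun ρ hρ => by
    have h1 := hne ρ hρ
    refine HasDerivWithinAt.congr_deriv (((hl ρ).fun_pow 3).fun_inv (pow_ne_zero 3 h1)) ?_
    simp only [c']
    push_cast
    field_simp
  have pow_succ' : ∀ (k : ℕ) (x : ℝ), x * (k * x ^ (k - 1)) = k * x ^ k := fun k x => by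
    rcases k with _ | k
    · simp
    · rw [Nat.add_sub_cancel, pow_succ]; ring
  have hk : ∀ k : ℕ, (3 + k : ℝ) / 2 ≠ 0 := fun k => by positivity
  have s1 : z.1.fst + ((1 : ℝ) : ℂ) • z.1.snd = 0 := by
    refine eq_zero_of_moments (α := 1) (β := -1) (by norm_num) fun k => ?_
    obtain ⟨w, hw, w1, w2⟩ := exists_mem_graph₀_of_characteristics
      (p := fun ρ => (1 - ρ) ^ k) (q := fun ρ => -c ρ)
      (p' := fun ρ => k * (1 - ρ) ^ (k - 1) * (-1)) (q' := fun ρ => -c' ρ)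
      (f₁ := fun ρ => (3 + k) * (1 - ρ) ^ k) (f₂ := fun _ => 0) (by fun_prop) hc.neg
      (fun ρ _ => (hl' ρ).fun_pow k) (fun ρ hρ => (hc' ρ hρ).neg) (by simp [c])
      (fun ρ _ => by linear_combination pow_succ' k (1 - ρ))
      (fun ρ hρ => by
        have h1 := hne ρ hρ
        simp only [c, c']
        field_simp
        ring)
    refine integral_pow_smul_eq_zero (hk k) (w1.trans (ae_of_all _ fun ρ => ?_))
      (w2.trans (ae_of_all _ fun ρ => ?_)) (h w hw)
    all_goals
      refine congrArg Complex.ofReal ?_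
      rw [neg_one_mul, ← sub_eq_add_neg]
      ring
  have s2 : z.1.fst + ((-1 : ℝ) : ℂ) • z.1.snd = 0 := by
    refine eq_zero_of_moments (α := 1) (β := 1) (by norm_num) fun k => ?_
    obtain ⟨w, hw, w1, w2⟩ := exists_mem_graph₀_of_characteristics
      (p := fun _ => 0) (q := fun ρ => (1 + ρ) ^ k - c ρ) (p' := fun _ => 0)
      (q' := fun ρ => k * (1 + ρ) ^ (k - 1) * 1 - c' ρ)
      (f₁ := fun _ => 0) (f₂ := fun ρ => (3 + k) * (1 + ρ) ^ k) contDiffOn_const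
      (ContDiffOn.sub (by fun_prop) hc) (fun ρ _ => hasDerivWithinAt_const _ _ _)
      (fun ρ hρ => ((hl ρ).fun_pow k).sub (hc' ρ hρ)) (by simp [c]) (fun ρ _ => by ring)
      (fun ρ hρ => by
        have h1 := hne ρ hρ
        have h2 : 3 * c ρ + (1 + ρ) * c' ρ = 0 := by
          simp only [c, c']
          field_simp
          ring
        linear_combination pow_succ' k (1 + ρ) - h2)
    refine integral_pow_smul_eq_zero (hk k) (w1.trans (ae_of_all _ fun ρ => ?_))
      (w2.trans (ae_of_all _ fun ρ => ?_)) (h w hw)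
    all_goals
      refine congrArg Complex.ofReal ?_
      rw [one_mul]
      ring
  have e1 : (2 : ℂ) • z.1.fst = 0 := by
    have := congrArg₂ (· + ·) s1 s2
    simpa [two_smul, add_assoc] using this
  have e2 : z.1.fst = 0 := (smul_eq_zero.1 e1).resolve_left two_ne_zero
  refine ext_of_coords e2 ?_
  simpa [e2] using s1

/-- `1` belongs to the resolvent set of the free operator. -/
theorem exists_isResolventAt_L₀ : ∃ R, IsResolventAt L₀ 1 R := by
  refine exists_isResolventAt_one ?_ (fun p hp => ?_) fun z hz => ?_
  · rw [L₀_graph]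
    exact graph₀.isClosed_topologicalClosure
  · rw [L₀_graph] at hp
    exact norm_le_of_mem_closure hp
  · refine eq_zero_of_forall_inner_eq_zero fun p hp => hz p ?_
    rw [L₀_graph]
    exact graph₀.le_topologicalClosure hp

/-- Polynomial coordinates are already attained. The completion is thus all of `L² × L²`, and
operators into it may be prescribed coordinate by coordinate, as in `inlH`. -/
theorem topologicalClosure_range_embed : (LinearMap.range embed).topologicalClosure = ⊤ := by
  rw [Submodule.topologicalClosure_eq_top_iff, Submodule.eq_bot_iff]
  intro z hz
  have hz' : ∀ u : PreH, inner ℂ (embed u) z = 0 := fun u =>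
    (Submodule.mem_orthogonal _ _).1 hz _ (LinearMap.mem_range_self _ _)
  have hm : ∀ k : ℕ, ContDiffOn ℝ ∞ (fun ρ : ℝ => (((0 + 1 * ρ) ^ k : ℝ) : ℂ)) I := fun k =>
    Complex.ofRealCLM.contDiff.comp_contDiffOn (f := fun ρ : ℝ => (0 + 1 * ρ) ^ k) (by fun_prop)
  have h0 : ContDiffOn ℝ ∞ (fun _ : ℝ => ((0 : ℝ) : ℂ)) I := contDiffOn_const
  have key : ∀ {r₁ r₂ : ℝ → ℝ} (h1 : ContDiffOn ℝ ∞ (fun ρ => (r₁ ρ : ℂ)) I)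
      (h2 : ContDiffOn ℝ ∞ (fun ρ => (r₂ ρ : ℂ)) I),
      ∫ ρ, r₁ ρ • z.fst ρ ∂μ + ∫ ρ, r₂ ρ • z.snd ρ ∂μ = 0 := fun {r₁ r₂} h1 h2 => by
    rw [← hz' (smoothPair _ _ h1 h2), WithLp.prod_inner_apply]
    exact congrArg₂ _ (inner_eq_integral (toH_smoothPair_fst h1 h2)).symm
      (inner_eq_integral (toH_smoothPair_snd h1 h2)).symm
  have e1 : z.fst = 0 := eq_zero_of_moments (α := 0) (β := 1) one_ne_zero fun k => by
    simpa using key (hm k) h0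
  have e2 : z.snd = 0 := eq_zero_of_moments (α := 0) (β := 1) one_ne_zero fun k => by
    simpa using key h0 (hm k)
  apply WithLp.ofLp_injective
  exact Prod.ext e1 e2

end Resolvent

/-! ### Compactness of integration on `L²(0,1)` -/

section Compact

theorem primitive_add (f g : L2) {ρ : ℝ} (hρ : ρ ∈ I) :
    primitive (f + g : L2) ρ = primitive f ρ + primitive g ρ := by
  rw [primitive_congr (Lp.coeFn_add f g) hρ]
  exact intervalIntegral.integral_add (intervalIntegrable_of (integrableOn_L2 f) hρ)
    (intervalIntegrable_of (integrableOn_L2 g) hρ)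

theorem primitive_smul (c : ℂ) (f : L2) {ρ : ℝ} (hρ : ρ ∈ I) :
    primitive (c • f : L2) ρ = c • primitive f ρ := by
  rw [primitive_congr (Lp.coeFn_smul c f) hρ]
  exact intervalIntegral.integral_smul c _

theorem memLp_of_continuousOn {f : ℝ → ℂ} (hf : ContinuousOn f I) : MemLp f 2 μ := by
  obtain ⟨C, hC⟩ := isCompact_Icc.exists_bound_of_continuousOn hf
  exact MemLp.of_bound (C := C)
    ((hf.mono Ioc_subset_Icc_self).aestronglyMeasurable measurableSet_Ioc)
    ((ae_restrict_iff' measurableSet_Ioc).2 (ae_of_all _ fun ρ hρ => hC ρ (Ioc_subset_Icc_self hρ)))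

theorem norm_le_of_ae_bound {f : L2} {C : ℝ} (hC : 0 ≤ C) (h : ∀ᵐ ρ ∂μ, ‖f ρ‖ ≤ C) : ‖f‖ ≤ C := by
  exact (Lp.norm_le_of_ae_bound hC h).trans_eq (by simp [measureUnivNNReal])

theorem memLp_primitive (f : L2) : MemLp (primitive f) 2 μ :=
  memLp_of_continuousOn (continuousOn_primitive (integrableOn_L2 f))

/-- The operator `f ↦ ∫₀ f` on `L²(0,1)`. -/
def primitiveOp : L2 →L[ℂ] L2 :=
  LinearMap.mkContinuous
    { toFun := fun f => (memLp_primitive f).toLp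
      map_add' := fun f g => by
        rw [← MemLp.toLp_add]
        exact MemLp.toLp_congr _ _ (ae_of_I fun ρ hρ => primitive_add f g hρ)
      map_smul' := fun c f => by
        rw [RingHom.id_apply, ← MemLp.toLp_const_smul]
        exact MemLp.toLp_congr _ _ (ae_of_I fun ρ hρ => primitive_smul c f hρ) } 1
    fun f => by
      rw [one_mul]
      refine norm_le_of_ae_bound (norm_nonneg _) ?_
      filter_upwards [(memLp_primitive f).coeFn_toLp, ae_restrict_mem measurableSet_Ioc] with ρ h1 h2
      change ‖(memLp_primitive f).toLp _ ρ‖ ≤ ‖f‖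
      rw [h1]
      exact norm_primitive_le f (Ioc_subset_Icc_self h2)

theorem coeFn_primitiveOp (f : L2) : primitiveOp f =ᵐ[μ] primitive f :=
  (memLp_primitive f).coeFn_toLp

/-- Cauchy–Schwarz against the indicator of `(t, ρ]`. -/
theorem norm_primitive_sub_le (f : L2) {t ρ : ℝ} (ht : 0 ≤ t) (htρ : t ≤ ρ) (hρ : ρ ≤ 1) :
    ‖primitive f ρ - primitive f t‖ ≤ √(ρ - t) * ‖f‖ := by
  have h1 : primitive f ρ - primitive f t = ∫ s in Ioc t ρ, f s ∂μ := by
    rw [primitive, primitive, intervalIntegral.integral_interval_sub_left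
      (intervalIntegrable_of (integrableOn_L2 f) ⟨ht.trans htρ, hρ⟩)
      (intervalIntegrable_of (integrableOn_L2 f) ⟨ht, htρ.trans hρ⟩),
      intervalIntegral.integral_of_le htρ, Measure.restrict_restrict measurableSet_Ioc,
      inter_eq_left.2 (Ioc_subset_Ioc ht hρ)]
  have hm : μ (Ioc t ρ) ≠ ⊤ := measure_ne_top _ _
  have hr : μ.real (Ioc t ρ) = ρ - t := by
    rw [measureReal_restrict_apply measurableSet_Ioc, inter_eq_left.2 (Ioc_subset_Ioc ht hρ),
      Real.volume_real_Ioc_of_le htρ]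
  rw [h1, ← L2.inner_indicatorConstLp_one (𝕜 := ℂ) measurableSet_Ioc hm]
  refine (norm_inner_le_norm _ _).trans (mul_le_mul_of_nonneg_right ?_ (norm_nonneg _))
  rw [norm_indicatorConstLp two_ne_zero ENNReal.ofNat_ne_top, hr, Real.sqrt_eq_rpow]
  simp

/-- Evaluation of the primitive at the points `i / n`. -/
def samples (n : ℕ) (hn : 0 < n) : L2 →L[ℂ] (Fin (n + 1) → ℂ) :=
  ContinuousLinearMap.pi fun i => LinearMap.mkContinuous
    { toFun := fun f => primitive f (i / n)
      map_add' := fun f g => primitive_add f g ⟨by positivity,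
        div_le_one_of_le₀ (by exact_mod_cast Nat.lt_succ_iff.1 i.2) (by positivity)⟩
      map_smul' := fun c f => primitive_smul c f ⟨by positivity,
        div_le_one_of_le₀ (by exact_mod_cast Nat.lt_succ_iff.1 i.2) (by positivity)⟩ } 1
    fun f => by
      rw [one_mul]
      exact norm_primitive_le f ⟨by positivity,
        div_le_one_of_le₀ (by exact_mod_cast Nat.lt_succ_iff.1 i.2) (by positivity)⟩

theorem memLp_step (n : ℕ) (c : Fin (n + 1) → ℂ) :
    MemLp (fun ρ : ℝ => c (Fin.ofNat (n + 1) ⌊n * ρ⌋₊)) 2 μ := by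
  refine MemLp.of_bound (C := ‖c‖) ?_ (ae_of_all _ fun ρ => norm_le_pi_norm c _)
  have h1 : Measurable fun ρ : ℝ => ⌊n * ρ⌋₊ := Nat.measurable_floor.comp (by fun_prop)
  have h2 : Measurable fun k : ℕ => c (Fin.ofNat (n + 1) k) := measurable_from_nat
  exact (h2.comp h1).aestronglyMeasurable

/-- The step function on `[0,1]` with given values on the intervals `[i/n, (i+1)/n)`. -/
def stepFun (n : ℕ) : (Fin (n + 1) → ℂ) →ₗ[ℂ] L2 where
  toFun c := (memLp_step n c).toLp
  map_add' c d := by rw [← MemLp.toLp_add]; rfl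
  map_smul' r c := by rw [RingHom.id_apply, ← MemLp.toLp_const_smul]; rfl

/-- The finite rank approximation of `primitiveOp` by step functions. -/
def stepOp (n : ℕ) : L2 →L[ℂ] L2 :=
  (LinearMap.toContinuousLinearMap (stepFun (n + 1))) ∘L samples (n + 1) n.succ_pos

theorem isCompactOperator_stepOp (n : ℕ) : IsCompactOperator (stepOp n) :=
  (isCompactOperator_of_locallyCompactSpace_dom (samples (n + 1) n.succ_pos)).clm_comp
    (LinearMap.toContinuousLinearMap (stepFun (n + 1)))

theorem coeFn_stepOp (n : ℕ) (f : L2) {ρ : ℝ}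
    (hρ : stepOp n f ρ = (samples (n + 1) n.succ_pos f) (Fin.ofNat (n + 2) ⌊(n + 1 : ℕ) * ρ⌋₊))
    (h : ρ ∈ Ioc (0 : ℝ) 1) :
    stepOp n f ρ = primitive f (⌊(n + 1 : ℕ) * ρ⌋₊ / (n + 1 : ℕ)) := by
  -- The reduction modulo `n + 2` in `Fin.ofNat` is harmless: even `ρ = 1` has index at most `n +
  -- 1`.
  have h1 : ⌊((n + 1 : ℕ) : ℝ) * ρ⌋₊ < n + 2 := by
    rw [Nat.lt_succ_iff]
    refine Nat.floor_le_of_le ?_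
    exact mul_le_of_le_one_right (by positivity) h.2
  rw [hρ]
  change primitive f (((Fin.ofNat (n + 2) ⌊((n + 1 : ℕ) : ℝ) * ρ⌋₊ : Fin (n + 2)) : ℕ) /
    (n + 1 : ℕ)) = _
  rw [Fin.val_ofNat, Nat.mod_eq_of_lt h1]

/-- The sampling node to the left of `ρ` is at distance at most `1 / (n + 1)`, and the Hölder-1/2
bound is uniform over the unit ball. So integration is a norm limit of finite-rank operators. -/
theorem norm_primitiveOp_sub_stepOp_le (n : ℕ) :
    ‖stepOp n - primitiveOp‖ ≤ √(1 / ((n : ℝ) + 1)) := by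
  refine ContinuousLinearMap.opNorm_le_bound _ (Real.sqrt_nonneg _) fun f => ?_
  refine norm_le_of_ae_bound (by positivity) ?_
  have h0 : stepOp n f =ᵐ[μ] fun ρ =>
      (samples (n + 1) n.succ_pos f) (Fin.ofNat (n + 2) ⌊(n + 1 : ℕ) * ρ⌋₊) :=
    (memLp_step (n + 1) _).coeFn_toLp
  filter_upwards [h0, coeFn_primitiveOp f, Lp.coeFn_sub (stepOp n f) (primitiveOp f),
    ae_restrict_mem measurableSet_Ioc] with ρ h1 h2 h3 h4
  have hn : (0 : ℝ) < (n + 1 : ℕ) := by positivity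
  have hfl : (⌊((n + 1 : ℕ) : ℝ) * ρ⌋₊ : ℝ) ≤ (n + 1 : ℕ) * ρ :=
    Nat.floor_le (mul_nonneg hn.le h4.1.le)
  have hlt := Nat.lt_floor_add_one (((n + 1 : ℕ) : ℝ) * ρ)
  rw [sub_apply, h3, Pi.sub_apply, coeFn_stepOp n f h1 h4, h2, norm_sub_rev]
  refine (norm_primitive_sub_le f (by positivity) ?_ h4.2).trans ?_
  · rw [div_le_iff₀ hn, mul_comm ρ]; exact hfl
  · refine mul_le_mul_of_nonneg_right (Real.sqrt_le_sqrt ?_) (norm_nonneg _)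
    rw [sub_le_iff_le_add, ← Nat.cast_add_one, ← add_div, le_div_iff₀ hn, mul_comm ρ, add_comm (1 : ℝ)]
    exact hlt.le

theorem isCompactOperator_primitiveOp : IsCompactOperator primitiveOp := by
  refine isCompactOperator_of_tendsto (F := stepOp) (l := Filter.atTop) ?_
    (Filter.Eventually.of_forall isCompactOperator_stepOp)
  rw [tendsto_iff_norm_sub_tendsto_zero]
  refine squeeze_zero (fun _ => norm_nonneg _) norm_primitiveOp_sub_stepOp_le ?_
  have h : Filter.Tendsto (fun n : ℕ => √(1 / ((n : ℝ) + 1))) Filter.atTop (nhds √0) :=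
    (Real.continuous_sqrt.tendsto 0).comp tendsto_one_div_add_atTop_nhds_zero_nat
  rwa [Real.sqrt_zero] at h

end Compact

/-! ### The potential as a compact operator -/

section Potential

theorem memLp_mul {φ : ℝ → ℂ} (hφ : ContinuousOn φ I) (f : L2) :
    MemLp (fun ρ => φ ρ * f ρ) 2 μ := by
  obtain ⟨C, hC⟩ := isCompact_Icc.exists_bound_of_continuousOn hφ
  refine MemLp.of_le_mul (c := C) (Lp.memLp f)
    (((hφ.mono Ioc_subset_Icc_self).aestronglyMeasurable measurableSet_Ioc).mul
      (Lp.aestronglyMeasurable f)) ?_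
  filter_upwards [ae_restrict_mem measurableSet_Ioc] with ρ hρ
  rw [norm_mul]
  exact mul_le_mul_of_nonneg_right (hC ρ (Ioc_subset_Icc_self hρ)) (norm_nonneg _)

/-- Multiplication by a continuous function as an operator on `L²(0,1)`. -/
def mulOp (φ : ℝ → ℂ) (hφ : ContinuousOn φ I) : L2 →L[ℂ] L2 :=
  LinearMap.mkContinuousOfExistsBound
    { toFun := fun f => (memLp_mul hφ f).toLp
      map_add' := fun f g => by
        rw [← MemLp.toLp_add]
        refine MemLp.toLp_congr _ _ ?_
        filter_upwards [Lp.coeFn_add f g] with ρ hρ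
        rw [hρ, Pi.add_apply, mul_add]; rfl
      map_smul' := fun c f => by
        rw [RingHom.id_apply, ← MemLp.toLp_const_smul]
        refine MemLp.toLp_congr _ _ ?_
        filter_upwards [Lp.coeFn_smul c f] with ρ hρ
        rw [hρ, Pi.smul_apply, mul_smul_comm]; rfl } (by
      obtain ⟨C, hC⟩ := isCompact_Icc.exists_bound_of_continuousOn hφ
      refine ⟨C, fun f => Lp.norm_le_mul_norm_of_ae_le_mul ?_⟩
      filter_upwards [(memLp_mul hφ f).coeFn_toLp, ae_restrict_mem measurableSet_Ioc] with ρ h1 h2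
      change ‖(memLp_mul hφ f).toLp _ ρ‖ ≤ C * ‖f ρ‖
      rw [h1, norm_mul]
      exact mul_le_mul_of_nonneg_right (hC ρ (Ioc_subset_Icc_self h2)) (norm_nonneg _))

theorem coeFn_mulOp {φ : ℝ → ℂ} (hφ : ContinuousOn φ I) (f : L2) :
    mulOp φ hφ f =ᵐ[μ] fun ρ => φ ρ * f ρ :=
  (memLp_mul hφ f).coeFn_toLp

/-- The operator `K` on `L²(0,1)`. -/
def KOp : L2 →L[ℂ] L2 := primitiveOp ∘L mulOp (fun ρ => (ρ : ℂ)) (by fun_prop)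

theorem coeFn_KOp {f : L2} {g : ℝ → ℂ} (h : f =ᵐ[μ] g) : KOp f =ᵐ[μ] K g := by
  refine (coeFn_primitiveOp _).trans (ae_of_I fun ρ hρ => ?_)
  rw [K_eq_primitive]
  refine primitive_congr ?_ hρ
  filter_upwards [coeFn_mulOp (φ := fun ρ => (ρ : ℂ)) (by fun_prop) f, h] with ρ h1 h2
  exact h1.trans (by rw [h2, Complex.real_smul])

/-- The function `D V`. -/
def V₁ (ρ : ℝ) : ℝ := -288 * (3 * ρ ^ 2 - 35) / (5 + 3 * ρ ^ 2) ^ 3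

/-- The function `D² V`. -/
def V₂ (ρ : ℝ) : ℝ := -576 * (330 - 18 * ρ ^ 2) / (5 + 3 * ρ ^ 2) ^ 4

theorem five_add_ne_zero (ρ : ℝ) : 5 + 3 * ρ ^ 2 ≠ 0 := by positivity

theorem hasDerivAt_V (ρ : ℝ) : HasDerivAt V (ρ * V₁ ρ) ρ := by
  have h0 := five_add_ne_zero ρ
  have h1 : HasDerivAt (fun ρ : ℝ => -144 * (5 - ρ ^ 2)) (-144 * (-(2 * ρ))) ρ := by
    simpa using ((hasDerivAt_pow 2 ρ).const_sub 5).const_mul (-144 : ℝ)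
  have h2 : HasDerivAt (fun ρ : ℝ => 5 + 3 * ρ ^ 2) (3 * (2 * ρ)) ρ := by
    simpa using ((hasDerivAt_pow 2 ρ).const_mul 3).const_add (5 : ℝ)
  refine HasDerivAt.congr_deriv (h1.div (h2.fun_pow 2) (pow_ne_zero 2 h0)) ?_
  simp only [V₁]
  push_cast
  field_simp
  ring

theorem hasDerivAt_V₁ (ρ : ℝ) : HasDerivAt V₁ (ρ * V₂ ρ) ρ := by
  have h0 := five_add_ne_zero ρ
  have h1 : HasDerivAt (fun ρ : ℝ => -288 * (3 * ρ ^ 2 - 35)) (-288 * (3 * (2 * ρ))) ρ := by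
    simpa using (((hasDerivAt_pow 2 ρ).const_mul 3).sub_const 35).const_mul (-288 : ℝ)
  have h2 : HasDerivAt (fun ρ : ℝ => 5 + 3 * ρ ^ 2) (3 * (2 * ρ)) ρ := by
    simpa using ((hasDerivAt_pow 2 ρ).const_mul 3).const_add (5 : ℝ)
  refine HasDerivAt.congr_deriv (h1.div (h2.fun_pow 3) (pow_ne_zero 3 h0)) ?_
  simp only [V₂]
  push_cast
  field_simp
  ring

theorem continuous_V : Continuous V :=
  continuous_iff_continuousAt.2 fun ρ => (hasDerivAt_V ρ).continuousAt

theorem continuous_V₁ : Continuous V₁ :=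
  continuous_iff_continuousAt.2 fun ρ => (hasDerivAt_V₁ ρ).continuousAt

theorem continuous_V₂ : Continuous V₂ :=
  Continuous.div (by fun_prop) (by fun_prop) fun ρ => pow_ne_zero 4 (five_add_ne_zero ρ)

/-- `φ ↦ D² (V K² φ)`. -/
def potCoord (φ : ℝ → ℂ) (ρ : ℝ) : ℂ := V₂ ρ * K (K φ) ρ + 2 * (V₁ ρ * K φ ρ) + V ρ * φ ρ

/-- The Leibniz rule for the derivation `D`, with `D K φ = φ`, read in integrated form. -/
theorem KK_potCoord {φ : ℝ → ℂ} (hφ : ContinuousOn φ I) {ρ : ℝ} (hρ : ρ ∈ I) :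
    K (K (potCoord φ)) ρ = V ρ * K (K φ) ρ := by
  have hφi := integrableOn_of_continuousOn hφ
  have ck := continuousOn_K hφi
  have ckk := continuousOn_K (integrableOn_K hφi)
  have cV : ContinuousOn (fun ρ => (V ρ : ℂ)) I :=
    (Complex.continuous_ofReal.comp continuous_V).continuousOn
  have cV₁ : ContinuousOn (fun ρ => (V₁ ρ : ℂ)) I :=
    (Complex.continuous_ofReal.comp continuous_V₁).continuousOn
  have cV₂ : ContinuousOn (fun ρ => (V₂ ρ : ℂ)) I :=
    (Complex.continuous_ofReal.comp continuous_V₂).continuousOn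
  have dV : ∀ ρ, HasDerivWithinAt (fun ρ => (V ρ : ℂ)) (ρ * V₁ ρ : ℝ) I ρ := fun ρ =>
    Complex.ofRealCLM.hasFDerivAt.comp_hasDerivWithinAt ρ (hasDerivAt_V ρ).hasDerivWithinAt
  have dV₁ : ∀ ρ, HasDerivWithinAt (fun ρ => (V₁ ρ : ℂ)) (ρ * V₂ ρ : ℝ) I ρ := fun ρ =>
    Complex.ofRealCLM.hasFDerivAt.comp_hasDerivWithinAt ρ (hasDerivAt_V₁ ρ).hasDerivWithinAt
  have dk := fun {ρ : ℝ} (hρ : ρ ∈ I) => hasDerivWithinAt_K hφ hρ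
  have dkk := fun {ρ : ℝ} (hρ : ρ ∈ I) => hasDerivWithinAt_KK hφi hρ
  have e1 : ∀ ρ ∈ I, K (potCoord φ) ρ = V₁ ρ * K (K φ) ρ + V ρ * K φ ρ := fun ρ hρ => by
    refine K_eq_of_hasDerivWithinAt (f := potCoord φ) (F := fun ρ => V₁ ρ * K (K φ) ρ + V ρ * K φ ρ)
      (((cV₂.mul ckk).add (continuousOn_const.mul (cV₁.mul ck))).add (cV.mul hφ))
      (fun ρ hρ => ?_) (by simp [K_zero_right]) hρ
    refine HasDerivWithinAt.congr_deriv (((dV₁ ρ).mul (dkk hρ)).add ((dV ρ).mul (dk hρ))) ?_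
    simp only [potCoord, Complex.real_smul]
    push_cast
    ring
  rw [K_congr (ae_of_I e1) hρ]
  refine K_eq_of_hasDerivWithinAt (f := fun ρ => V₁ ρ * K (K φ) ρ + V ρ * K φ ρ)
    (F := fun ρ => V ρ * K (K φ) ρ)
    ((cV₁.mul ckk).add (cV.mul ck)) (fun ρ hρ => ?_) (by simp [K_zero_right]) hρ
  refine HasDerivWithinAt.congr_deriv ((dV ρ).mul (dkk hρ)) ?_
  simp only [Complex.real_smul]
  push_cast
  ring

/-- The inclusion of the first coordinate. -/
def inlH : L2 →L[ℂ] H :=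
  LinearMap.mkContinuous
    { toFun := fun f => ⟨WithLp.toLp 2 (f, 0), by
        rw [topologicalClosure_range_embed]; exact Submodule.mem_top⟩
      map_add' := fun f g => ext_of_coords rfl (add_zero (0 : L2)).symm
      map_smul' := fun c f => ext_of_coords rfl (smul_zero c : c • (0 : L2) = 0).symm } 1
    fun f => by
      rw [one_mul]
      change ‖WithLp.toLp 2 (f, (0 : L2))‖ ≤ ‖f‖
      rw [← abs_of_nonneg (norm_nonneg (WithLp.toLp 2 (f, (0 : L2)))), ← abs_of_nonneg (norm_nonneg f),
        ← sq_le_sq, WithLp.prod_norm_sq_eq_of_L2]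
      simp

/-- The second coordinate. -/
def sndH : H →L[ℂ] L2 :=
  LinearMap.mkContinuous
    { toFun := fun u => u.1.snd
      map_add' := fun _ _ => rfl
      map_smul' := fun _ _ => rfl } 1
    fun u => by rw [one_mul]; exact norm_snd_le' u

/-- The operator `φ ↦ D² (V K² φ)` on `L²(0,1)`. -/
def potCoordOp : L2 →L[ℂ] L2 :=
  mulOp (fun ρ => (V₂ ρ : ℂ)) (Complex.continuous_ofReal.comp continuous_V₂).continuousOn ∘L
      KOp ∘L KOp +
    (2 : ℂ) • (mulOp (fun ρ => (V₁ ρ : ℂ))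
      (Complex.continuous_ofReal.comp continuous_V₁).continuousOn ∘L KOp) +
    mulOp (fun ρ => (V ρ : ℂ)) (Complex.continuous_ofReal.comp continuous_V).continuousOn

/-- The potential operator `u ↦ (-V K² u₂, 0)` as a bounded operator. -/
def potOp : H →L[ℂ] H := (inlH ∘L (-potCoordOp)) ∘L primitiveOp ∘L sndH

/-- One integration, `u₂' ↦ u₂`, supplies the compactness; the other factors are bounded. -/
theorem isCompactOperator_potOp : IsCompactOperator potOp :=
  (isCompactOperator_primitiveOp.comp_clm sndH).clm_comp (inlH ∘L (-potCoordOp))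

theorem coeFn_potOp_fst (u : H) : (potOp u).1.fst =ᵐ[μ] fun ρ => -potCoord (fn₂ u) ρ := by
  set f := primitiveOp u.1.snd
  have hf : f =ᵐ[μ] fn₂ u := coeFn_primitiveOp u.1.snd
  set T₂ := mulOp (fun ρ => (V₂ ρ : ℂ)) (Complex.continuous_ofReal.comp continuous_V₂).continuousOn
  set T₁ := mulOp (fun ρ => (V₁ ρ : ℂ)) (Complex.continuous_ofReal.comp continuous_V₁).continuousOn
  set T₀ := mulOp (fun ρ => (V ρ : ℂ)) (Complex.continuous_ofReal.comp continuous_V).continuousOn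
  change (-(T₂ (KOp (KOp f)) + (2 : ℂ) • T₁ (KOp f) + T₀ f) : L2) =ᵐ[μ] _
  filter_upwards [Lp.coeFn_neg (T₂ (KOp (KOp f)) + (2 : ℂ) • T₁ (KOp f) + T₀ f),
    Lp.coeFn_add (T₂ (KOp (KOp f)) + (2 : ℂ) • T₁ (KOp f)) (T₀ f),
    Lp.coeFn_add (T₂ (KOp (KOp f))) ((2 : ℂ) • T₁ (KOp f)), Lp.coeFn_smul (2 : ℂ) (T₁ (KOp f)),
    coeFn_mulOp (Complex.continuous_ofReal.comp continuous_V₂).continuousOn (KOp (KOp f)),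
    coeFn_mulOp (Complex.continuous_ofReal.comp continuous_V₁).continuousOn (KOp f),
    coeFn_mulOp (Complex.continuous_ofReal.comp continuous_V).continuousOn f,
    coeFn_KOp (coeFn_KOp hf), coeFn_KOp hf, hf] with ρ h1 h2 h3 h4 h5 h6 h7 h8 h9 h10
  rw [h1, Pi.neg_apply, h2, Pi.add_apply, h3, Pi.add_apply, h4, Pi.smul_apply]
  refine congrArg Neg.neg (congrArg₂ _ (congrArg₂ _ (h5.trans ?_) (congrArg (2 * ·) (h6.trans ?_)))
    (h7.trans ?_))
  · rw [h8]; rfl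
  · rw [h9]; rfl
  · rw [h10]; rfl

theorem fn₂_potOp (u : H) {ρ : ℝ} (hρ : ρ ∈ I) : fn₂ (potOp u) ρ = 0 := by
  have e : (potOp u).1.snd = 0 := rfl
  rw [fn₂_eq_primitive, e, primitive_congr (g := 0) (Lp.coeFn_zero ℂ 2 μ) hρ]
  simp [primitive]

theorem fn₁_potOp (u : H) {ρ : ℝ} (hρ : ρ ∈ I) :
    fn₁ (potOp u) ρ = -(V ρ • K (K (fn₂ u)) ρ) := by
  have e : ∀ ρ ∈ I, K (potOp u).1.fst ρ = -K (potCoord (fn₂ u)) ρ := fun ρ hρ => by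
    rw [K_congr (g := (-1 : ℂ) • potCoord (fn₂ u))
      ((coeFn_potOp_fst u).trans (ae_of_I fun s _ => by simp)) hρ, K_smul]
    simp
  have e2 := congrFun (K_smul (K (potCoord (fn₂ u))) (-1)) ρ
  rw [fn₁, K_congr (g := (-1 : ℂ) • K (potCoord (fn₂ u)))
    (ae_of_I fun s hs => by rw [e s hs]; simp) hρ, e2, Pi.smul_apply,
    KK_potCoord (continuousOn_fn₂ u) hρ, Complex.real_smul, neg_one_smul]

theorem mem_graphPot_iff {p : H × H} : p ∈ graphPot ↔ p.2 = potOp p.1 := by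
  constructor
  · intro h
    refine ext_of_fn (fun ρ hρ => ?_) fun ρ hρ => ?_
    · rw [fn₁_potOp _ hρ]; exact (h ρ hρ).1
    · rw [fn₂_potOp _ hρ]; exact (h ρ hρ).2
  · intro h ρ hρ
    rw [h]
    exact ⟨fn₁_potOp _ hρ, fn₂_potOp _ hρ⟩

theorem Lpot_graph : Lpot.graph = graphPot :=
  Submodule.toLinearPMap_graph_eq _ fun p hp h0 => by
    rw [mem_graphPot_iff.1 hp, h0, map_zero]

theorem mem_Lpot_graph {x y : H} : (x, y) ∈ Lpot.graph ↔ y = potOp x := by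
  rw [Lpot_graph, mem_graphPot_iff]

theorem mem_L_graph_iff (x y : H) : (x, y) ∈ L.graph ↔ (x, y - potOp x) ∈ L₀.graph := by
  have hp : ∀ h : x ∈ Lpot.domain, Lpot ⟨x, h⟩ = potOp x := fun h =>
    mem_Lpot_graph.1 (Lpot.mem_graph ⟨x, h⟩)
  constructor
  · intro h
    obtain ⟨⟨z, hz⟩, rfl, rfl⟩ := (LinearPMap.mem_graph_iff _).1 h
    refine mem_graph_of_eq (L₀.mem_graph ⟨z, hz.1⟩) rfl ?_
    change L₀ ⟨z, hz.1⟩ + Lpot ⟨z, hz.2⟩ - potOp z = _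
    rw [hp, add_sub_cancel_right]
  · intro h
    obtain ⟨⟨z, hz⟩, h1, h2⟩ := (LinearPMap.mem_graph_iff _).1 h
    obtain rfl : z = x := h1
    have hz' : z ∈ Lpot.domain := LinearPMap.mem_domain_of_mem_graph (mem_Lpot_graph.2 rfl)
    refine (LinearPMap.mem_graph_iff _).2 ⟨⟨z, hz, hz'⟩, rfl, ?_⟩
    change L₀ ⟨z, hz⟩ + Lpot ⟨z, hz'⟩ = y
    rw [hp, h2, sub_add_cancel]

end Potential

/-! ### The symmetry mode as an eigenvector -/

section SymmetryMode

/-- The first component of the symmetry mode. -/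
def modeFst (ρ : ℝ) : ℝ := ρ ^ 5 * ((5 - ρ ^ 2) / (5 + 3 * ρ ^ 2) ^ 3)

/-- The second component of the symmetry mode. -/
def modeSnd (ρ : ℝ) : ℝ := ρ * (125 - 50 * ρ ^ 2 - 3 * ρ ^ 4) / (5 + 3 * ρ ^ 2) ^ 4

/-- The function `K` of the second component of the symmetry mode. -/
def modeK (ρ : ℝ) : ℝ := ρ ^ 3 * ((25 + 3 * ρ ^ 2) / (3 * (5 + 3 * ρ ^ 2) ^ 3))

/-- The function `K²` of the second component of the symmetry mode. -/
def modeKK (ρ : ℝ) : ℝ := ρ ^ 5 * (1 / (3 * (5 + 3 * ρ ^ 2) ^ 2))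

theorem hasDerivAt_five_add (ρ : ℝ) : HasDerivAt (fun ρ : ℝ => 5 + 3 * ρ ^ 2) (6 * ρ) ρ := by
  refine HasDerivAt.congr_deriv (((hasDerivAt_pow 2 ρ).const_mul 3).const_add (5 : ℝ)) ?_
  push_cast
  ring

theorem hasDerivAt_modeKK (ρ : ℝ) : HasDerivAt modeKK (ρ * modeK ρ) ρ := by
  have h0 := five_add_ne_zero ρ
  have h3 := ((hasDerivAt_five_add ρ).fun_pow 2).const_mul 3
  refine HasDerivAt.congr_deriv ((hasDerivAt_pow 5 ρ).mul
    ((hasDerivAt_const ρ (1 : ℝ)).div h3 (by positivity))) ?_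
  simp only [modeK]
  push_cast
  field_simp
  ring

theorem hasDerivAt_modeK (ρ : ℝ) : HasDerivAt modeK (ρ * modeSnd ρ) ρ := by
  have h0 := five_add_ne_zero ρ
  have h3 := ((hasDerivAt_five_add ρ).fun_pow 3).const_mul 3
  refine HasDerivAt.congr_deriv ((hasDerivAt_pow 3 ρ).mul
    ((((hasDerivAt_pow 2 ρ).const_mul 3).const_add (25 : ℝ)).div h3 (by positivity))) ?_
  simp only [modeSnd]
  push_cast
  field_simp
  ring

/-- The second component of `L g = g`, integrated: `D u₁ = ρ² u₂`, hence `u₁ = K (ρ² u₂)`, and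
integration by parts follows. -/
theorem modeFst_eq (ρ : ℝ) : modeFst ρ = ρ ^ 2 * modeK ρ - 2 * modeKK ρ := by
  have h0 := five_add_ne_zero ρ
  simp only [modeFst, modeK, modeKK]
  field_simp
  ring

theorem hasDerivAt_modeFst (ρ : ℝ) : HasDerivAt modeFst (ρ * (ρ ^ 2 * modeSnd ρ)) ρ := by
  have e : modeFst = fun ρ => ρ ^ 2 * modeK ρ - 2 * modeKK ρ := funext modeFst_eq
  rw [e]
  refine HasDerivAt.congr_deriv (((hasDerivAt_pow 2 ρ).mul (hasDerivAt_modeK ρ)).sub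
    ((hasDerivAt_modeKK ρ).const_mul 2)) ?_
  push_cast
  ring

/-- The first component of `L g = g` after `u₁` has been eliminated by `modeFst_eq`. -/
theorem mode_equation (ρ : ℝ) :
    -(ρ ^ 2 * (1 - ρ ^ 2) * modeSnd ρ) + (3 - ρ ^ 2) * modeK ρ + (2 + V ρ) * modeKK ρ = 0 := by
  have h0 := five_add_ne_zero ρ
  simp only [modeSnd, modeK, modeKK, V]
  field_simp
  ring

theorem contDiff_modeSnd : ContDiff ℝ ∞ modeSnd :=
  ContDiff.div (by fun_prop) (by fun_prop) fun x => pow_ne_zero _ (five_add_ne_zero x)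

theorem continuous_modeSnd : Continuous modeSnd := contDiff_modeSnd.continuous

theorem continuous_modeK : Continuous modeK :=
  continuous_iff_continuousAt.2 fun ρ => (hasDerivAt_modeK ρ).continuousAt

theorem hasDerivAt_coe {f : ℝ → ℝ} {f' ρ : ℝ} (h : HasDerivAt f f' ρ) :
    HasDerivAt (fun ρ => (f ρ : ℂ)) (f' : ℂ) ρ :=
  h.ofReal_comp

theorem fn₁_symmetryMode {ρ : ℝ} (hρ : ρ ∈ I) : fn₁ symmetryMode ρ = modeFst ρ :=
  fn₁_toH _ hρ

theorem fn₂_symmetryMode {ρ : ℝ} (hρ : ρ ∈ I) : fn₂ symmetryMode ρ = modeSnd ρ :=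
  fn₂_toH _ hρ

theorem K_of_eq_modeSnd {f : ℝ → ℂ} {k : ℂ} (h : ∀ ρ ∈ I, f ρ = k * modeSnd ρ) {ρ : ℝ}
    (hρ : ρ ∈ I) : K f ρ = k * modeK ρ := by
  rw [K_congr (ae_of_I h) hρ]
  refine K_eq_of_hasDerivWithinAt (f := fun ρ => k * modeSnd ρ) (F := fun ρ => k * modeK ρ)
    (continuousOn_const.mul (Complex.continuous_ofReal.comp continuous_modeSnd).continuousOn)
    (fun ρ _ => ?_) (by simp [modeK]) hρ
  refine HasDerivWithinAt.congr_deriv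
    ((hasDerivAt_coe (hasDerivAt_modeK ρ)).hasDerivWithinAt.const_mul k) ?_
  rw [Complex.real_smul]
  push_cast
  ring

theorem K_of_eq_modeK {f : ℝ → ℂ} {k : ℂ} (h : ∀ ρ ∈ I, f ρ = k * modeK ρ) {ρ : ℝ}
    (hρ : ρ ∈ I) : K f ρ = k * modeKK ρ := by
  rw [K_congr (ae_of_I h) hρ]
  refine K_eq_of_hasDerivWithinAt (f := fun ρ => k * modeK ρ) (F := fun ρ => k * modeKK ρ)
    (continuousOn_const.mul (Complex.continuous_ofReal.comp continuous_modeK).continuousOn)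
    (fun ρ _ => ?_) (by simp [modeKK]) hρ
  refine HasDerivWithinAt.congr_deriv
    ((hasDerivAt_coe (hasDerivAt_modeKK ρ)).hasDerivWithinAt.const_mul k) ?_
  rw [Complex.real_smul]
  push_cast
  ring

theorem K_fn₂_symmetryMode {ρ : ℝ} (hρ : ρ ∈ I) : K (fn₂ symmetryMode) ρ = modeK ρ := by
  rw [K_of_eq_modeSnd (k := 1) (fun s hs => by rw [fn₂_symmetryMode hs, one_mul]) hρ, one_mul]

theorem KK_fn₂_symmetryMode {ρ : ℝ} (hρ : ρ ∈ I) : K (K (fn₂ symmetryMode)) ρ = modeKK ρ := by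
  rw [K_of_eq_modeK (k := 1) (fun s hs => by rw [K_fn₂_symmetryMode hs, one_mul]) hρ, one_mul]

theorem symmetryMode_ne_zero : symmetryMode ≠ 0 := fun h => by
  have h1 : (1 : ℝ) ∈ I := by simp
  have h2 := fn₂_symmetryMode h1
  rw [h, fn₂_zero h1] at h2
  have h3 : modeSnd 1 = 0 := by exact_mod_cast h2.symm
  norm_num [modeSnd] at h3

/-- The symmetry mode is an eigenvector of `L` with eigenvalue `1`. -/
theorem symmetryMode_mem_graph : (symmetryMode, symmetryMode) ∈ L.graph := by
  have hg : ContDiffOn ℝ ∞ (fun ρ => (modeSnd ρ : ℂ)) I :=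
    (Complex.ofRealCLM.contDiff.comp contDiff_modeSnd).contDiffOn
  have hx : ContDiffOn ℝ ∞ (fun ρ : ℝ => (ρ : ℂ)) I := Complex.ofRealCLM.contDiff.contDiffOn
  set b := derivWithin (fun ρ => (modeSnd ρ : ℂ)) I
  have hb : ContDiffOn ℝ ∞ b I := ContDiffOn.derivWithin_I hg
  -- This is `D² u₁`, read off from the second component `a - ρ u₂' - u₂ = u₂` of the eigenvalue
  -- equation; it vanishes at 0, so the mode lies in `Dom₀` itself.
  set a : ℝ → ℂ := fun ρ => ρ * b ρ + 2 * modeSnd ρ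
  have ha : ContDiffOn ℝ ∞ a I := (hx.mul hb).add (contDiffOn_const.mul hg)
  have ha0 : a 0 = 0 := by simp [a, modeSnd]
  have hP : ∀ ρ ∈ I, primitive b ρ = modeSnd ρ := fun ρ hρ =>
    primitive_eq_of_hasDerivWithinAt (F := fun ρ => (modeSnd ρ : ℂ)) hb.continuousOn
      (fun ρ hρ => hasDerivWithinAt_of_smooth hg hρ) (by simp [modeSnd]) hρ
  have hK : ∀ ρ ∈ I, K a ρ = (ρ : ℂ) ^ 2 * modeSnd ρ := fun ρ hρ => by
    refine K_eq_of_hasDerivWithinAt (F := fun ρ : ℝ => (ρ : ℂ) ^ 2 * modeSnd ρ) ha.continuousOn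
      (fun ρ hρ => ?_) (by simp) hρ
    refine HasDerivWithinAt.congr_deriv ((hasDerivWithinAt_ofReal_pow 2 I ρ).mul
      (hasDerivWithinAt_of_smooth hg hρ)) ?_
    simp only [a, Complex.real_smul]
    push_cast
    ring
  have hKK : ∀ ρ ∈ I, K (K a) ρ = modeFst ρ := fun ρ hρ => by
    rw [K_congr (ae_of_I hK) hρ]
    refine K_eq_of_hasDerivWithinAt (f := fun ρ : ℝ => (ρ : ℂ) ^ 2 * modeSnd ρ)
      (F := fun ρ => (modeFst ρ : ℂ)) ((hx.pow 2).mul hg).continuousOn (fun ρ _ => ?_)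
      (by simp [modeFst]) hρ
    refine HasDerivWithinAt.congr_deriv (hasDerivAt_coe (hasDerivAt_modeFst ρ)).hasDerivWithinAt ?_
    rw [Complex.real_smul]
    push_cast
    ring
  have e1 : toH (smoothPair a b ha hb) = symmetryMode :=
    ext_of_fn (fun ρ hρ => by rw [fn₁_toH _ hρ, fn₁_symmetryMode hρ]; exact hKK ρ hρ)
      fun ρ hρ => by rw [fn₂_toH _ hρ, fn₂_symmetryMode hρ]; exact hP ρ hρ
  have hgr := smoothPair_mem_graph₀ ha hb ha0
  have hrel := freeRel_of_mem_graph₀ hgr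
  rw [mem_L_graph_iff, L₀_graph]
  refine graph₀.le_topologicalClosure ?_
  have e2 : toH (smoothPair (coord₁ a b) (coord₂ a b) (contDiffOn_coord₁ ha hb)
      (contDiffOn_coord₂ ha hb)) = symmetryMode - potOp symmetryMode := by
    refine ext_of_fn (fun ρ hρ => ?_) fun ρ hρ => ?_
    · have h1 := (hrel ρ hρ).2
      simp only at h1
      rw [h1, K_congr (toH_smoothPair_fst ha hb) hρ, hK ρ hρ, e1, fn₁_sub _ _ hρ, fn₁_potOp _ hρ,
        fn₁_symmetryMode hρ, fn₂_symmetryMode hρ, K_fn₂_symmetryMode hρ, KK_fn₂_symmetryMode hρ,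
        modeFst_eq, Complex.real_smul]
      have := congrArg Complex.ofReal (mode_equation ρ)
      push_cast at this ⊢
      linear_combination -this
    · rw [fn₂_sub _ _ hρ, fn₂_potOp _ hρ, fn₂_symmetryMode hρ, fn₂_toH _ hρ]
      change primitive (coord₂ a b) ρ = _
      rw [primitive_coord₂ ha hb ha0 hρ, hP ρ hρ]
      simp only [a]
      ring
  rwa [e1, e2] at hgr

end SymmetryMode

/-! ### Algebraic simplicity of the eigenvalue 1 -/

section Simplicity

/-- The functions `u₂`, `y = K u₂` and `w = K² u₂` of a solution `u` of `u - L u = c g` satisfy the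
ordinary differential equation in its integrated form. -/
theorem ode_of_mem_graph {c : ℂ} {x : H} (h : (x, x - c • symmetryMode) ∈ L.graph) {ρ : ℝ}
    (hρ : ρ ∈ I) :
    fn₁ x ρ = (ρ : ℂ) ^ 2 * K (fn₂ x) ρ - 2 * K (K (fn₂ x)) ρ - c * modeKK ρ ∧
    -((ρ : ℂ) ^ 2 * (1 - (ρ : ℂ) ^ 2) * fn₂ x ρ) + (3 - (ρ : ℂ) ^ 2) * K (fn₂ x) ρ +
      (2 + V ρ) * K (K (fn₂ x)) ρ = c * (2 * (ρ : ℂ) ^ 2 * modeK ρ - 3 * modeKK ρ) := by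
  rw [mem_L_graph_iff, L₀_graph] at h
  have hrel := freeRel_of_mem_closure h
  have cu := continuousOn_fn₂ x
  have cy := continuousOn_K (integrableOn_fn₂ x)
  set v := x - c • symmetryMode - potOp x
  have hv2 : ∀ ρ ∈ I, fn₂ v ρ = fn₂ x ρ - c * modeSnd ρ := fun ρ hρ => by
    rw [fn₂_sub _ _ hρ, fn₂_sub _ _ hρ, fn₂_potOp _ hρ, fn₂_smul _ _ hρ, fn₂_symmetryMode hρ,
      sub_zero, smul_eq_mul]
  have hv1 : ∀ ρ ∈ I, fn₁ v ρ = fn₁ x ρ - c * modeFst ρ + V ρ * K (K (fn₂ x)) ρ := fun ρ hρ => by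
    rw [fn₁_sub _ _ hρ, fn₁_sub _ _ hρ, fn₁_potOp _ hρ, fn₁_smul _ _ hρ, fn₁_symmetryMode hρ,
      smul_eq_mul, Complex.real_smul, sub_neg_eq_add]
  have hvK : ∀ ρ ∈ I, K (fn₂ v) ρ = K (fn₂ x) ρ - c * modeK ρ := fun ρ hρ => by
    rw [K_congr (ae_of_I hv2) hρ]
    refine K_eq_of_hasDerivWithinAt (f := fun ρ => fn₂ x ρ - c * modeSnd ρ)
      (F := fun ρ => K (fn₂ x) ρ - c * modeK ρ) (cu.sub (continuousOn_const.mul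
      (Complex.continuous_ofReal.comp continuous_modeSnd).continuousOn)) (fun ρ hρ => ?_)
      (by simp [K_zero_right, modeK]) hρ
    refine HasDerivWithinAt.congr_deriv ((hasDerivWithinAt_K cu hρ).sub
      ((hasDerivAt_coe (hasDerivAt_modeK ρ)).hasDerivWithinAt.const_mul c)) ?_
    simp only [Complex.real_smul]
    push_cast
    ring
  have hKa : ∀ ρ ∈ I, K x.1.fst ρ = (ρ : ℂ) ^ 2 * fn₂ x ρ - c * modeK ρ := fun ρ hρ => by
    have h1 := (hrel ρ hρ).1
    simp only at h1
    rw [h1, hvK ρ hρ]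
    ring
  have hu : ∀ ρ ∈ I, fn₁ x ρ = (ρ : ℂ) ^ 2 * K (fn₂ x) ρ - 2 * K (K (fn₂ x)) ρ - c * modeKK ρ :=
    fun ρ hρ => by
      rw [fn₁, K_congr (ae_of_I hKa) hρ]
      refine K_eq_of_hasDerivWithinAt (f := fun ρ => (ρ : ℂ) ^ 2 * fn₂ x ρ - c * modeK ρ)
        (F := fun ρ => (ρ : ℂ) ^ 2 * K (fn₂ x) ρ - 2 * K (K (fn₂ x)) ρ - c * modeKK ρ)
        (((Complex.continuous_ofReal.continuousOn.pow 2).mul cu).sub (continuousOn_const.mul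
          (Complex.continuous_ofReal.comp continuous_modeK).continuousOn)) (fun ρ hρ => ?_)
        (by simp [K_zero_right, modeKK]) hρ
      refine HasDerivWithinAt.congr_deriv ((((hasDerivWithinAt_ofReal_pow 2 I ρ).mul
        (hasDerivWithinAt_K cu hρ)).sub ((hasDerivWithinAt_K cy hρ).const_mul 2)).sub
        ((hasDerivAt_coe (hasDerivAt_modeKK ρ)).hasDerivWithinAt.const_mul c)) ?_
      simp only [Complex.real_smul]
      push_cast
      ring
  refine ⟨hu ρ hρ, ?_⟩
  have h2 := (hrel ρ hρ).2
  simp only at h2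
  rw [hv1 ρ hρ, hKa ρ hρ, hu ρ hρ, modeFst_eq] at h2
  push_cast at h2
  linear_combination h2

/-- The eigenvalue `1` of `L` is algebraically simple. -/
theorem simple_of_mem_graph {c : ℂ} {x : H} (h : (x, x - c • symmetryMode) ∈ L.graph) :
    c = 0 ∧ x ∈ ℂ ∙ symmetryMode := by
  have hode := fun {ρ : ℝ} (hρ : ρ ∈ I) => ode_of_mem_graph h hρ
  set u := fn₂ x
  set y := K u
  set w := K y
  have cu : ContinuousOn u I := continuousOn_fn₂ x
  have cy : ContinuousOn y I := continuousOn_K (integrableOn_fn₂ x)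
  have cw : ContinuousOn w I := continuousOn_K (integrableOn_of_continuousOn cy)
  have dy : ∀ {ρ : ℝ}, ρ ∈ Ioo (0 : ℝ) 1 → HasDerivAt y ((ρ : ℂ) * u ρ) ρ := fun {ρ} hρ =>
    (hasDerivWithinAt_K cu (Ioo_subset_Icc_self hρ)).hasDerivAt (Icc_mem_nhds hρ.1 hρ.2)
  have dw : ∀ {ρ : ℝ}, ρ ∈ Ioo (0 : ℝ) 1 → HasDerivAt w ((ρ : ℂ) * y ρ) ρ := fun {ρ} hρ =>
    (hasDerivWithinAt_K cy (Ioo_subset_Icc_self hρ)).hasDerivAt (Icc_mem_nhds hρ.1 hρ.2)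
  have dmK := fun ρ => hasDerivAt_coe (hasDerivAt_modeK ρ)
  have dmKK := fun ρ => hasDerivAt_coe (hasDerivAt_modeKK ρ)
  set Y : ℝ → ℂ := fun ρ => ((25 + 3 * ρ ^ 2) / (3 * (5 + 3 * ρ ^ 2) ^ 3) : ℝ)
  set W : ℝ → ℂ := fun ρ => (1 / (3 * (5 + 3 * ρ ^ 2) ^ 2) : ℝ)
  have hY : ∀ ρ : ℝ, (modeK ρ : ℂ) = (ρ : ℂ) ^ 3 * Y ρ := fun ρ => by
    simp only [modeK, Y]; push_cast; ring
  have hW : ∀ ρ : ℝ, (modeKK ρ : ℂ) = (ρ : ℂ) ^ 5 * W ρ := fun ρ => by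
    simp only [modeKK, W]; push_cast; ring
  have hW0 : ∀ ρ, W ρ ≠ 0 := fun ρ => by
    have : 1 / (3 * (5 + 3 * ρ ^ 2) ^ 2) ≠ 0 := by positivity
    exact Complex.ofReal_ne_zero.2 this
  have cY : Continuous Y := Complex.continuous_ofReal.comp
    (Continuous.div (by fun_prop) (by fun_prop) fun ρ => by positivity)
  have cW : Continuous W := Complex.continuous_ofReal.comp
    (Continuous.div (by fun_prop) (by fun_prop) fun ρ => by positivity)
  -- Since `w' = ρ y` and `modeKK' = ρ modeK`, the bracket is a Wronskian up to a factor `ρ`, and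
  -- `(1 - ρ²) / ρ³` is the integrating factor of its equation. With this weight the source is the
  -- derivative of `c modeKK² / ρ³`, so `P / ρ³` is constant.
  set P : ℝ → ℂ := fun ρ => (1 - (ρ : ℂ) ^ 2) * (w ρ * modeK ρ - y ρ * modeKK ρ) -
    c * (modeKK ρ : ℂ) ^ 2
  -- `P / ρ³` with the power cancelled explicitly, so that it is continuous up to `ρ = 0`, where it
  -- vanishes because `w` does.
  set Q : ℝ → ℂ := fun ρ => (1 - (ρ : ℂ) ^ 2) * (w ρ * Y ρ - y ρ * ((ρ : ℂ) ^ 2 * W ρ)) -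
    c * ((ρ : ℂ) ^ 7 * W ρ ^ 2)
  have hPQ : ∀ ρ : ℝ, P ρ = (ρ : ℂ) ^ 3 * Q ρ := fun ρ => by
    simp only [P, Q, hY, hW]; ring
  have cx : ContinuousOn (fun ρ : ℝ => (ρ : ℂ)) I := Complex.continuous_ofReal.continuousOn
  have cQ : ContinuousOn Q I :=
    ((continuousOn_const.sub (cx.pow 2)).mul ((cw.mul cY.continuousOn).sub
      (cy.mul ((cx.pow 2).mul cW.continuousOn)))).sub
      (continuousOn_const.mul ((cx.pow 7).mul (cW.continuousOn.pow 2)))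
  have hx : ∀ (n : ℕ) (ρ : ℝ), HasDerivAt (fun ρ : ℝ => (ρ : ℂ) ^ n) (n * (ρ : ℂ) ^ (n - 1)) ρ :=
    fun n ρ => by
      have := hasDerivWithinAt_ofReal_pow n univ ρ
      rwa [hasDerivWithinAt_univ] at this
  have dQ : ∀ ρ ∈ Ioo (0 : ℝ) 1, HasDerivAt Q 0 ρ := fun ρ hρ => by
    have h0 : (ρ : ℂ) ≠ 0 := by exact_mod_cast hρ.1.ne'
    have dP := (((hx 2 ρ).const_sub 1).mul (((dw hρ).mul (dmK ρ)).sub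
      ((dy hρ).mul (dmKK ρ)))).sub (((dmKK ρ).fun_pow 2).const_mul c)
    have dR := dP.div (hx 3 ρ) (pow_ne_zero 3 h0)
    have hev : Q =ᶠ[nhds ρ] fun ρ => P ρ / (ρ : ℂ) ^ 3 := by
      filter_upwards [Ioo_mem_nhds hρ.1 hρ.2] with s hs
      have hs0 : (s : ℂ) ≠ 0 := by exact_mod_cast hs.1.ne'
      rw [hPQ, mul_div_cancel_left₀ _ (pow_ne_zero 3 hs0)]
    refine HasDerivAt.congr_deriv (dR.congr_of_eventuallyEq hev) ?_
    rw [div_eq_zero_iff]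
    left
    have h1 := (hode (Ioo_subset_Icc_self hρ)).2
    have h2 := congrArg Complex.ofReal (mode_equation ρ)
    push_cast at h2 ⊢
    simp only [Pi.mul_apply, Pi.sub_apply]
    linear_combination (ρ : ℂ) ^ 2 * ((modeKK ρ : ℂ) * h1 - w ρ * h2)
  have hw0 : w 0 = 0 := K_zero_right y
  have hQ : ∀ ρ ∈ I, Q ρ = 0 := fun ρ hρ => by
    rw [← primitive_eq_of_hasDerivAt (f := fun _ => 0) cQ dQ integrableOn_zero
      (by simp only [Q, hw0]; simp [y, K_zero_right]) hρ]
    simp [primitive]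
  -- At `ρ = 1` the factor `1 - ρ²` kills the Wronskian, as `w` and `y` are finite there, leaving
  -- `-c W(1)² = 0`.
  have hc : c = 0 := by
    have h1 := hQ 1 (by simp)
    simp only [Q] at h1
    simpa [hW0 1] using h1
  refine ⟨hc, ?_⟩
  have hmKK : ∀ ρ ∈ Ioo (0 : ℝ) 1, (modeKK ρ : ℂ) ≠ 0 := fun ρ hρ => by
    have h0 : (ρ : ℂ) ≠ 0 := by exact_mod_cast hρ.1.ne'
    rw [hW]
    exact mul_ne_zero (pow_ne_zero 5 h0) (hW0 ρ)
  have hN : ∀ ρ ∈ Ioo (0 : ℝ) 1, w ρ * modeK ρ - y ρ * modeKK ρ = 0 := fun ρ hρ => by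
    have h1 := hPQ ρ
    rw [hQ ρ (Ioo_subset_Icc_self hρ)] at h1
    simp only [P, hc, zero_mul, mul_zero, sub_zero] at h1
    refine (mul_eq_zero.1 h1).resolve_left ?_
    have : 1 - ρ ^ 2 ≠ 0 := by nlinarith [hρ.1, hρ.2]
    exact_mod_cast this
  -- A vanishing Wronskian makes `w` proportional to `modeKK`; differentiating the proportionality
  -- twice carries it to `y` and to `u`.
  have dq : ∀ ρ ∈ Ioo (0 : ℝ) 1, HasDerivAt (fun ρ => w ρ / modeKK ρ) 0 ρ := fun ρ hρ => by
    refine HasDerivAt.congr_deriv ((dw hρ).div (dmKK ρ) (hmKK ρ hρ)) ?_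
    rw [div_eq_zero_iff]
    left
    push_cast
    linear_combination -(ρ : ℂ) * hN ρ hρ
  obtain ⟨k, hk⟩ := isOpen_Ioo.exists_is_const_of_deriv_eq_zero isPreconnected_Ioo
    (fun ρ hρ => (dq ρ hρ).differentiableAt.differentiableWithinAt) fun ρ hρ => (dq ρ hρ).deriv
  have hwk : ∀ ρ ∈ Ioo (0 : ℝ) 1, w ρ = k * modeKK ρ := fun ρ hρ => by
    rw [← hk ρ hρ, div_mul_cancel₀ _ (hmKK ρ hρ)]
  have transfer : ∀ {f g f' g' : ℝ → ℂ}, (∀ ρ ∈ Ioo (0 : ℝ) 1, f ρ = k * g ρ) →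
      (∀ ρ ∈ Ioo (0 : ℝ) 1, HasDerivAt f (ρ * f' ρ) ρ) →
      (∀ ρ ∈ Ioo (0 : ℝ) 1, HasDerivAt g (ρ * g' ρ) ρ) →
      ∀ ρ ∈ Ioo (0 : ℝ) 1, f' ρ = k * g' ρ := fun {f g f' g'} hfg hf hg ρ hρ => by
    have h0 : (ρ : ℂ) ≠ 0 := by exact_mod_cast hρ.1.ne'
    have h1 : HasDerivAt f (k * (ρ * g' ρ)) ρ := ((hg ρ hρ).const_mul k).congr_of_eventuallyEq (by
      filter_upwards [Ioo_mem_nhds hρ.1 hρ.2] with s hs using hfg s hs)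
    have h2 := (hf ρ hρ).unique h1
    refine mul_left_cancel₀ h0 ?_
    rw [h2]
    ring
  have hyk : ∀ ρ ∈ Ioo (0 : ℝ) 1, y ρ = k * modeK ρ :=
    transfer (g := fun ρ => (modeKK ρ : ℂ)) hwk (fun ρ hρ => dw hρ)
      fun ρ _ => (dmKK ρ).congr_deriv (by push_cast; rfl)
  have huk : ∀ ρ ∈ Ioo (0 : ℝ) 1, u ρ = k * modeSnd ρ :=
    transfer (g := fun ρ => (modeK ρ : ℂ)) hyk (fun ρ hρ => dy hρ)
      fun ρ _ => (dmK ρ).congr_deriv (by push_cast; rfl)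
  have huI : EqOn u (fun ρ => k * modeSnd ρ) I :=
    EqOn.of_subset_closure (fun ρ hρ => huk ρ hρ) cu
      (continuousOn_const.mul (Complex.continuous_ofReal.comp continuous_modeSnd).continuousOn)
      Ioo_subset_Icc_self (by rw [closure_Ioo zero_ne_one])
  have hyI : ∀ ρ ∈ I, y ρ = k * modeK ρ := fun ρ hρ => K_of_eq_modeSnd huI hρ
  have hwI : ∀ ρ ∈ I, w ρ = k * modeKK ρ := fun ρ hρ => K_of_eq_modeK hyI hρ
  refine Submodule.mem_span_singleton.2 ⟨k, ext_of_fn (fun ρ hρ => ?_) fun ρ hρ => ?_⟩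
  · rw [fn₁_smul _ _ hρ, fn₁_symmetryMode hρ, (hode hρ).1, hyI ρ hρ, hwI ρ hρ, hc, modeFst_eq,
      smul_eq_mul]
    push_cast
    ring
  · rw [fn₂_smul _ _ hρ, fn₂_symmetryMode hρ, smul_eq_mul]
    exact (huI hρ).symm

theorem exists_isReducedResolventAt_L : ∃ φ S, IsReducedResolventAt L 1 symmetryMode φ S := by
  obtain ⟨R, hR⟩ := exists_isResolventAt_L₀
  refine exists_isReducedResolventAt mem_L_graph_iff hR isCompactOperator_potOp ?_
    symmetryMode_ne_zero fun c x hx => ?_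
  · rw [one_smul]
    exact symmetryMode_mem_graph
  · rw [one_smul] at hx
    exact simple_of_mem_graph hx

end Simplicity

end YangMills

end

theorem lemma3p7 :
    (∃ (c : ℂ) (r : ℝ), YangMills.Separates YangMills.L 1 c r) ∧
    ∀ (c : ℂ) (r : ℝ), YangMills.Separates YangMills.L 1 c r →
      Module.finrank ℂ (YangMills.rieszProjection YangMills.L c r).range = 1 ∧
      (YangMills.rieszProjection YangMills.L c r).range = ℂ ∙ YangMills.symmetryMode := by
  obtain ⟨φ, S, h⟩ := YangMills.exists_isReducedResolventAt_L
  refine ⟨h.exists_separates, fun c r hs => ?_⟩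
  rw [h.rieszProjection_eq hs, h.range_smulRight]
  exact ⟨finrank_span_singleton h.ne_zero, rfl⟩
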